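/- Setting. Let $\Sigma$ be an alphabet of size $K\ge 1$. A semi-Markovian causal graph (SMCG) is a DAG $G$ on observable vertices $\mathbf V$ and unobservable vertices $\mathbf U$ (both finite) in which every unobservable vertex is a root with exactly two children, both observable. For $\mathbf S\subseteq\mathbf V$, $\mathrm{Pa}(\mathbf S)$ is the set of observable parents of $\mathbf S$ outside $\mathbf S$. The c-components of the induced subgraph $G[\mathbf X]$, $\mathbf X\subseteq\mathbf V$, are the connected components of the graph on $\mathbf X$ that joins two vertices with a common unobservable parent. $\mathcal G_{d,\ell}$ is the class of SMCGs in which every observable vertex has at most $d$ observable parents and every c-component of $G$ has at most $\ell$ vertices. A semi-Markovian Bayesian network (SMBN) $\mathcal X$ over $G$ consists of a conditional distribution $\Pr[x\mid \pi(x)]$ on $\Sigma$ for every vertex $x$ and every assignment $\pi(x)$ to all parents of $x$. For $\mathbf T\subseteq\mathbf V$ and $\mathbf t\in\Sigma^{\mathbf T}$ its interventional distribution is $P_{\mathcal X}[\mathbf v\mid do(\mathbf t)]=\sum_{\mathbf u}\prod_{V_i\in\mathbf V\setminus\mathbf T}\Pr[v_i\mid\pi(V_i)]\prod_{U_j\in\mathbf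 U}\Pr[u_j\mid \pi(U_j)]$ if $\mathbf v$ agrees with $\mathbf t$, and $0$ otherwise. A learning algorithm for $G$ performs finitely many interventions $do(\mathbf t)$ (possibly with $\mathbf T=\emptyset$), fixed in advance and pairwise distinct, draws the same number of independent samples of $\mathbf V$ from $P_{\mathcal X}[\mathbf V\mid do(\mathbf t)]$ under each of them, and runs a deterministic program on these samples on a random access machine with logarithmic instruction costs. Its running time is the worst-case cost of the run, plus one unit per vertex for setting up each intervention, one unit per vertex for drawing each sample, and one unit per instruction for storing the program. Its output is a table of rational local distributions $P_{\mathcal N}[\mathbf s\mid do(\mathrm{pa}(\mathbf S))]$, and the oracle $\mathcal N$ that it defines answers a query $(\mathbf T,\mathbf t)$ by $$P_{\mathcal N}[\mathbf w\mid do(\mathbf t)]=\prod_{i=1}^{p}P_{\mathcal N}[\mathbf s_i\mid do(\mathrm{pa}(\mathbf S_i))],\qquad \mathbf w\in\Sigma^{\mathbf V\setminus\mathbf T},$$ where $\mathbf S_1,\dots,\mathbf S_p$ are the c-components of $G[\mathbf V\setminus\mathbf T]$ and $\mathbf s_i$, $\mathrm{pa}(\mathbf S_i)$ are read off from $(\mathbf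 w,\mathbf t)$. The algorithm $\varepsilon$-learns $G$ if for every SMBN $\mathcal X$ over $G$, with probability at least $2/3$ over the samples, for all $\mathbf T\subseteq\mathbf V$ and $\mathbf t\in\Sigma^{\mathbf T}$ simultaneously, $P_{\mathcal N}[\,\cdot\mid do(\mathbf t)]$ is a probability distribution on $\Sigma^{\mathbf V\setminus\mathbf T}$ and $$\delta_{TV}\bigl(P_{\mathcal X}[\mathbf V\setminus\mathbf T\mid do(\mathbf t)],\,P_{\mathcal N}[\mathbf V\setminus\mathbf T\mid do(\mathbf t)]\bigr)<\varepsilon .$$ Theorem. All constants in $O$ and $\tilde O$ below are absolute, and $\tilde O(f)$ means at most $C f(\log f)^{c}$ for absolute constants $C,c$. Let $d\ge1$, $0<\varepsilon\le1$, and let $G\in\mathcal G_{d,\ell}$ have $n\geq 1$ observable vertices. (1) If $n\ge2$, there is an algorithm that $\varepsilon$-learns $G$, makes $O(K^{\ell d}(3d)^\ell\log n)$ interventions, takes $\tilde O(K^{\ell(2d+3)}n^2\varepsilon^{-4})$ samples per intervention, and runs in time $\tilde O(2^\ell K^{\ell(3d+3)}n^3\varepsilon^{-4})$. (2) If the maximum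 degree of $G$ (number of observable parents plus number of observable children of an observable vertex) is at most $d$, there is an algorithm that $\varepsilon$-learns $G$, makes $O(K^{\ell d}(3d)^\ell\,\ell d^2\log K)$ interventions, and has the same bounds on the samples per intervention and on the running time as in (1). -/

import Mathlib

open Finset
open scoped BigOperators

/-! ### Causal graphs -/

/-- A causal graph: a directed acyclic graph on the observable vertices `V` and the unobservable
vertices `U`. -/
structure CausalGraph (V : Type*) (U : Type*) where
  edge : V ⊕ U → V ⊕ U → Prop
  acyclic : ∀ x, ¬ Relation.TransGen edge x x

/-- A semi-Markovian causal graph: every unobservable vertex is a root and has exactly two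
children, both observable. -/
structure SMCG (V : Type*) (U : Type*) extends CausalGraph V U where
  root : ∀ (u : U) (x : V ⊕ U), ¬ edge x (Sum.inr u)
  two_children : ∀ u : U, ∃ v w : V, v ≠ w ∧
    ∀ x : V ⊕ U, edge (Sum.inr u) x ↔ x = Sum.inl v ∨ x = Sum.inl w

namespace SMCG

variable {V U : Type*} [Fintype V]

open Classical in
/-- `Pa(S)`: the observable parents of `S`, excluding `S`. -/
noncomputable def pa (G : SMCG V U) (S : Finset V) : Finset V :=
  univ.filter fun y => y ∉ S ∧ ∃ x ∈ S, G.edge (Sum.inl y) (Sum.inl x)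

open Classical in
/-- Number of observable parents. -/
noncomputable def inDegree (G : SMCG V U) (v : V) : ℕ :=
  (univ.filter fun y : V => G.edge (Sum.inl y) (Sum.inl v)).card

open Classical in
/-- Number of observable children. -/
noncomputable def outDegree (G : SMCG V U) (v : V) : ℕ :=
  (univ.filter fun y : V => G.edge (Sum.inl v) (Sum.inl y)).card

/-- The bi-directed edge `v ↔ w`: a common unobservable parent. -/
def Bidirected (G : SMCG V U) (v w : V) : Prop :=
  v ≠ w ∧ ∃ u : U, G.edge (Sum.inr u) (Sum.inl v) ∧ G.edge (Sum.inr u) (Sum.inl w)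

/-- `v` and `w` are joined by a path of bi-directed edges of the induced subgraph `G[X]`. -/
def ConnectedIn (G : SMCG V U) (X : Finset V) : V → V → Prop :=
  Relation.ReflTransGen fun a b => a ∈ X ∧ b ∈ X ∧ G.Bidirected a b

open Classical in
/-- `C(X)`: the set of c-components of the induced subgraph `G[X]`, i.e. of the classes of
vertices of `X` under connection by bi-directed paths of `G[X]`. -/
noncomputable def cComponents (G : SMCG V U) (X : Finset V) : Finset (Finset V) :=
  X.image fun a => X.filter fun b => G.ConnectedIn X a b

/-- The class of graphs with maximum in-degree at most `d` and c-components of size at most `l`. -/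
def InClass (G : SMCG V U) (d l : ℕ) : Prop :=
  (∀ v, G.inDegree v ≤ d) ∧ ∀ S ∈ G.cComponents univ, S.card ≤ l

/-- Maximum degree (in-degree plus out-degree) at most `d`. -/
def MaxDegreeLE (G : SMCG V U) (d : ℕ) : Prop :=
  ∀ v, G.inDegree v + G.outDegree v ≤ d

end SMCG

/-! ### Causal Bayesian networks and interventions -/

/-- A causal Bayesian network on the causal graph `G` over the alphabet `A`: a conditional
distribution for every vertex, given the values of all its parents. -/
structure CBN {V U : Type*} (G : CausalGraph V U) (A : Type*) [Fintype A] where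
  cpd : (x : V ⊕ U) → ({y : V ⊕ U // G.edge y x} → A) → A → ℝ
  cpd_nonneg : ∀ x p a, 0 ≤ cpd x p a
  cpd_sum : ∀ x p, ∑ a, cpd x p a = 1

/-- A semi-Markovian Bayesian network. -/
abbrev SMBN {V U : Type*} (G : SMCG V U) (A : Type*) [Fintype A] := CBN G.toCausalGraph A

/-- An intervention `do(t)` on a set `T` of observable vertices: `some a` on the vertices of `T`
(with the value `a` that they are set to), `none` on the vertices outside `T`. -/
abbrev Intervention (V A : Type*) := V → Option A

namespace Intervention

variable {V A : Type*}

/-- `V \ T`: the vertices that are not intervened on. -/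
def free [Fintype V] (I : Intervention V A) : Finset V :=
  univ.filter fun i => (I i).isNone

/-- The assignment to `V` that agrees with the intervention on `T` and with `w` on `V \ T`. -/
def fill [Fintype V] (I : Intervention V A) (w : {i // i ∈ I.free} → A) (i : V) : A :=
  match h : I i with
  | some a => a
  | none => w ⟨i, by simp [free, h]⟩

end Intervention

open Classical in
/-- The interventional distribution `P_M[v | do(t)]` on assignments `v` to the observables. -/
noncomputable def CBN.doProb {V U A : Type*} [Fintype V] [Fintype U] [Fintype A]
    {G : CausalGraph V U} (M : CBN G A) (I : Intervention V A) (v : V → A) : ℝ :=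
  if ∀ i a, I i = some a → v i = a then
    ∑ u : U → A,
      (∏ i ∈ I.free, M.cpd (Sum.inl i) (fun y => Sum.elim v u y.1) (v i)) *
        ∏ j : U, M.cpd (Sum.inr j) (fun y => Sum.elim v u y.1) (u j)
  else 0

/-- `P_M[V \ T | do(t)]`, on assignments `w` to `V \ T`. -/
noncomputable def CBN.doProbFree {V U A : Type*} [Fintype V] [Fintype U] [Fintype A]
    {G : CausalGraph V U} (M : CBN G A) (I : Intervention V A)
    (w : {i // i ∈ I.free} → A) : ℝ :=
  M.doProb I (I.fill w)

/-- `P` is a probability distribution on the finite set `D`. -/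
def IsDistribution {D : Type*} [Fintype D] (P : D → ℝ) : Prop :=
  (∀ x, 0 ≤ P x) ∧ ∑ x, P x = 1

/-- Total variation distance. -/
noncomputable def tvDist {D : Type*} [Fintype D] (P Q : D → ℝ) : ℝ :=
  (1 / 2) * ∑ x, |P x - Q x|

/-! ### Oracles -/

/-- A table of local distributions: `q S p s` is the learned value of
`P[S = s | do(Pa(S) = p)]`. -/
abbrev LocalTable {V U : Type*} [Fintype V] (G : SMCG V U) (A : Type*) :=
  (S : Finset V) → ({y // y ∈ G.pa S} → A) → ({x // x ∈ S} → A) → ℝ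

/-- The oracle of a table of local distributions: on input `T` and `t` it outputs the function
`w ↦ ∏_i q(s_i | do(pa(S_i)))`, with `S_1, …, S_p` the c-components of `G[V \ T]` and with the
values `s_i` and `pa(S_i)` taken from the assignment `(w, t)` to `V`. -/
noncomputable def LocalTable.oracle {V U : Type*} [Fintype V] {G : SMCG V U} {A : Type*}
    (q : LocalTable G A) (I : Intervention V A) (w : {i // i ∈ I.free} → A) : ℝ :=
  ∏ S ∈ G.cComponents I.free, q S (fun y => I.fill w y.1) (fun x => I.fill w x.1)

open Classical in
/-- Under every intervention the oracle outputs a probability distribution that is strictly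
within `ε` of that of `X` in total variation distance. -/
def LocalTable.IsAccurate {V U A : Type*} [Fintype V] [Fintype U] [Fintype A] {G : SMCG V U}
    (q : LocalTable G A) (X : SMBN G A) (ε : ℝ) : Prop :=
  ∀ I : Intervention V A,
    IsDistribution (q.oracle I) ∧ tvDist (X.doProbFree I) (q.oracle I) < ε

/-! ### Random access machines with logarithmic cost -/

namespace RAM

/-- Instructions of a random access machine whose memory cells hold natural numbers.
`sub` is truncated subtraction and `div` is integer division. -/
inductive Instr where
  /-- `mem[dst] := c` -/
  | const (dst c : ℕ)
  /-- `mem[dst] := mem[a] + mem[b]` -/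
  | add (dst a b : ℕ)
  /-- `mem[dst] := mem[a] - mem[b]` -/
  | sub (dst a b : ℕ)
  /-- `mem[dst] := mem[a] * mem[b]` -/
  | mul (dst a b : ℕ)
  /-- `mem[dst] := mem[a] / mem[b]` -/
  | div (dst a b : ℕ)
  /-- `mem[dst] := mem[mem[ptr]]` -/
  | load (dst ptr : ℕ)
  /-- `mem[mem[ptr]] := mem[src]` -/
  | store (ptr src : ℕ)
  /-- go to instruction `target` if `mem[a] = 0` -/
  | jumpIfZero (a target : ℕ)

/-- A configuration: program counter, memory, and the time used so far. -/
structure Config where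
  pc : ℕ
  mem : ℕ → ℕ
  time : ℕ

/-- The logarithmic cost of an instruction: one plus the bit lengths of all the numbers (addresses,
operands and results) that it handles. -/
def cost (m : ℕ → ℕ) : Instr → ℕ
  | .const dst c => 1 + dst.size + c.size
  | .add dst a b =>
      1 + dst.size + a.size + b.size + (m a).size + (m b).size + (m a + m b).size
  | .sub dst a b =>
      1 + dst.size + a.size + b.size + (m a).size + (m b).size + (m a - m b).size
  | .mul dst a b =>
      1 + dst.size + a.size + b.size + (m a).size + (m b).size + (m a * m b).size
  | .div dst a b =>
      1 + dst.size + a.size + b.size + (m a).size + (m b).size + (m a / m b).size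
  | .load dst ptr => 1 + dst.size + ptr.size + (m ptr).size + (m (m ptr)).size
  | .store ptr src => 1 + ptr.size + src.size + (m ptr).size + (m src).size
  | .jumpIfZero a target => 1 + a.size + (m a).size + target.size

/-- The memory after an instruction. -/
def newMem (m : ℕ → ℕ) : Instr → ℕ → ℕ
  | .const dst c => Function.update m dst c
  | .add dst a b => Function.update m dst (m a + m b)
  | .sub dst a b => Function.update m dst (m a - m b)
  | .mul dst a b => Function.update m dst (m a * m b)
  | .div dst a b => Function.update m dst (m a / m b)
  | .load dst ptr => Function.update m dst (m (m ptr))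
  | .store ptr src => Function.update m (m ptr) (m src)
  | .jumpIfZero _ _ => m

/-- The program counter after an instruction. -/
def newPc (m : ℕ → ℕ) (pc : ℕ) : Instr → ℕ
  | .jumpIfZero a target => if m a = 0 then target else pc + 1
  | _ => pc + 1

/-- One step. The machine halts when the program counter leaves the program. -/
def step (p : List Instr) (c : Config) : Config :=
  match p[c.pc]? with
  | none => c
  | some ins => ⟨newPc c.mem c.pc ins, newMem c.mem ins, c.time + cost c.mem ins⟩

/-- Started in `c`, the program `p` halts in the configuration `c'`. -/
def HaltsAt (p : List Instr) (c c' : Config) : Prop :=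
  p.length ≤ c'.pc ∧ ∃ k : ℕ, (step p)^[k] c = c'

end RAM

/-! ### Learning algorithms -/

/-- A (non-adaptive, deterministic) learning algorithm for unknown SMBNs over the known graph `G`,
with alphabet `Fin K`. It performs the pairwise distinct interventions `intervention j`, draws
`numSamples` samples under each of them, and runs a program on the samples. When the program has
halted, the entry `(S, p, s)` of the table of local distributions is the fraction whose numerator
stands in the cell `layout S p s` and whose denominator stands in the next one. -/
structure Learner {n : ℕ} {U : Type*} (G : SMCG (Fin n) U) (K : ℕ) where
  numInterventions : ℕ
  intervention : Fin numInterventions ↪ Intervention (Fin n) (Fin K)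
  numSamples : ℕ
  program : List RAM.Instr
  layout : (S : Finset (Fin n)) → ({y // y ∈ G.pa S} → Fin K) → ({x // x ∈ S} → Fin K) → ℕ

namespace Learner

variable {n K : ℕ} {U : Type*} {G : SMCG (Fin n) U}

/-- All the samples: `ω j s` is the `s`-th sample drawn under the `j`-th intervention. -/
abbrev Samples (L : Learner G K) :=
  Fin L.numInterventions → Fin L.numSamples → Fin n → Fin K

/-- The starting memory holds the samples, row by row from cell `0` on: the value of vertex `i` in
the sample `ω j s` is in the cell `(j * numSamples + s) * n + i`. All other cells are `0`. -/
def startMem (L : Learner G K) (ω : L.Samples) (a : ℕ) : ℕ :=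
  if h : a < L.numInterventions * L.numSamples * n then
    let x := finProdFinEquiv.symm (⟨a, h⟩ : Fin (L.numInterventions * L.numSamples * n))
    let y := finProdFinEquiv.symm x.1
    (ω y.1 y.2 x.2 : ℕ)
  else 0

/-- The starting configuration. -/
def start (L : Learner G K) (ω : L.Samples) : RAM.Config := ⟨0, L.startMem ω, 0⟩

/-- The table of local distributions that stands in the memory `m`. -/
noncomputable def table (L : Learner G K) (m : ℕ → ℕ) : LocalTable G (Fin K) :=
  fun S p s => (m (L.layout S p s) : ℝ) / (m (L.layout S p s + 1) : ℝ)

/-- On all samples the algorithm halts, in time at most `B`. The time comprises one unit per vertex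
for setting up an intervention, one unit per vertex for drawing a sample, one unit per
instruction for storing the program, and the logarithmic cost of the run. -/
def RunsInTime (L : Learner G K) (B : ℝ) : Prop :=
  ∀ ω : L.Samples, ∃ c : RAM.Config, RAM.HaltsAt L.program (L.start ω) c ∧
    ((L.numInterventions * n + L.numInterventions * L.numSamples * n + L.program.length
      + c.time : ℕ) : ℝ) ≤ B

open Classical in
/-- The probability of an event when the samples are independent and the samples of the `j`-th
intervention are distributed according to `P_X[V | do(I_j)]`. -/
noncomputable def prob [Fintype U] (L : Learner G K) (X : SMBN G (Fin K))
    (E : L.Samples → Prop) : ℝ :=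
  ∑ ω ∈ (univ : Finset L.Samples).filter E,
    ∏ j, ∏ s, X.doProb (L.intervention j) (ω j s)

/-- For every unknown SMBN over `G`, with probability at least `2/3` the output is accurate. -/
def Learns [Fintype U] (L : Learner G K) (ε : ℝ) : Prop :=
  ∀ X : SMBN G (Fin K),
    2 / 3 ≤ L.prob X fun ω =>
      ∃ c : RAM.Config, RAM.HaltsAt L.program (L.start ω) c ∧ (L.table c.mem).IsAccurate X ε

end Learner

/-! For a set S of observables let Q_S(v) be its c-factor: the law of S when all other observables
are held at v. It depends only on S ∪ Pa(S). The truncated factorisation says that P[v | do(t)] =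
Q_{V∖T}(v) for v agreeing with t. Q is multiplicative over sets not joined by bidirected edges,
because such sets are fed by disjoint families of independent unobservables (`cFactor_union`).
Together with the chain rule along a topological order this writes P[· | do(t)] as a product of
kernels Q_W / Q_{W∖i}, one for each free vertex i, where W is the part of the component of i in
G[V∖T] up to i. Every such W is a subset of a c-component of G, so at most n·2^ℓ sets W serve all
interventions at once. Moreover Q_W is an observable marginal: it is the law of W under any
intervention that sets Pa(W) and leaves W free (`sum_doProb_mul_indicator`).

Estimation. Each Q_W is replaced by a frequency h_W with add-one smoothing, and each kernel by h_W
divided by its sum over the values of i. The kernels are then well defined and normalised, so every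
oracle answer is exactly a distribution. Adding the vertices in topological order gives a
telescoping bound for the L¹ error of the product (`sumOver_abs_cFactor_sub_kernelProd_le`), and
each term is at most twice the L¹ error of h_W (`localError_condOf_le`); no lower bound on
probabilities is needed. By Cauchy–Schwarz the squared total variation error is at most n·K^{ℓd+ℓ}
times the sum of (h_W − Q_W)² over all W and all assignments to W ∪ Pa(W). This sum does not mention
the intervention. Its expectation is a variance computation, and Markov's inequality makes it small
with probability 2/3, for all interventions simultaneously and without a union bound
(`tableLearner_learns`).

Interventions. Each pair of a set W and values of Pa(W) has to be isolated by some intervention. In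
general a random intervention isolates a given pair with probability of order 1/(ℓd·2^ℓ·K^{ℓd}), and
a greedy cover derandomises this at the cost of a factor log n (`exists_covers_of_inClass`). If all
degrees are bounded, the components can be coloured with O(ℓd²) colours so that those of one colour
do not interfere, and one runs through all colours and patterns (`exists_covers_of_maxDegreeLE`).

Running time. The table entries are ratios of products of counts. They are computed by a fully
unrolled straight-line program, so its length times the bit length of the numbers bounds the cost.
An alphabet with one letter is treated separately. -/

set_option linter.unusedSectionVars false

/-! ### Summing a function of assignments over some of the coordinates -/

section SumOver

variable {V A : Type*} [Fintype V] [DecidableEq V] [Fintype A]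

open Classical in
/-- The sum of `f` over the assignments that agree with `v` outside `F`. -/
noncomputable def sumOver (F : Finset V) (f : (V → A) → ℝ) (v : V → A) : ℝ :=
  ∑ w ∈ univ.filter (fun w : V → A => ∀ i, i ∉ F → w i = v i), f w

theorem sumOver_congr {F : Finset V} {f g : (V → A) → ℝ} {v : V → A}
    (h : ∀ w, (∀ i, i ∉ F → w i = v i) → f w = g w) : sumOver F f v = sumOver F g v := by
  unfold sumOver
  exact sum_congr rfl fun w hw => h w (by simpa using hw)

theorem sumOver_mono {F : Finset V} {f g : (V → A) → ℝ} {v : V → A}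
    (h : ∀ w, (∀ i, i ∉ F → w i = v i) → f w ≤ g w) : sumOver F f v ≤ sumOver F g v := by
  unfold sumOver
  exact sum_le_sum fun w hw => h w (by simpa using hw)

theorem sumOver_nonneg {F : Finset V} {f : (V → A) → ℝ} {v : V → A} (h : ∀ w, 0 ≤ f w) :
    0 ≤ sumOver F f v := sum_nonneg fun w _ => h w

theorem le_sumOver {F : Finset V} {f : (V → A) → ℝ} (v : V → A) (h : ∀ w, 0 ≤ f w) :
    f v ≤ sumOver F f v := by
  classical
  unfold sumOver
  exact single_le_sum (f := f) (fun w _ => h w) (by simp)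

theorem sumOver_add (F : Finset V) (f g : (V → A) → ℝ) (v : V → A) :
    sumOver F (fun w => f w + g w) v = sumOver F f v + sumOver F g v := by
  unfold sumOver
  exact sum_add_distrib

theorem sumOver_sum {ι : Type*} (s : Finset ι) (F : Finset V) (f : ι → (V → A) → ℝ) (v : V → A) :
    sumOver F (fun w => ∑ k ∈ s, f k w) v = ∑ k ∈ s, sumOver F (f k) v := by
  unfold sumOver
  exact sum_comm

theorem sumOver_empty (f : (V → A) → ℝ) (v : V → A) : sumOver ∅ f v = f v := by
  classical
  unfold sumOver
  have : (univ.filter fun w : V → A => ∀ i, i ∉ (∅ : Finset V) → w i = v i) = {v} := by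
    ext w
    simp [funext_iff]
  rw [this, sum_singleton]

theorem sumOver_eq_single {F : Finset V} {f : (V → A) → ℝ} {v : V → A}
    (h : ∀ w, (∀ i, i ∉ F → w i = v i) → w ≠ v → f w = 0) : sumOver F f v = f v := by
  classical
  unfold sumOver
  exact sum_eq_single v (fun w hw => h w (by simpa using hw)) (by simp)

/-- Fubini for a single coordinate: w is recorded as its value at i together with w reset to v at i.
The later inductions remove vertices one at a time through this identity. -/
theorem sumOver_insert {F : Finset V} {i : V} (hi : i ∉ F) (f : (V → A) → ℝ) (v : V → A) :
    sumOver (insert i F) f v = sumOver F (fun w => ∑ a, f (Function.update w i a)) v := by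
  classical
  unfold sumOver
  rw [← sum_product']
  refine sum_bij' (fun w _ => (Function.update w i (v i), w i))
    (fun x _ => Function.update x.1 i x.2) ?_ ?_ ?_ ?_ ?_
  · intro w hw
    simp only [mem_filter, mem_univ, true_and, mem_insert, not_or, mem_product, and_true] at hw ⊢
    intro j hj
    by_cases hji : j = i
    · subst hji; simp
    · simp [hji, hw j ⟨hji, hj⟩]
  · rintro ⟨w, a⟩ hw
    simp only [mem_filter, mem_univ, true_and, mem_insert, not_or, mem_product, and_true] at hw ⊢
    rintro j ⟨hji, hj⟩
    simp [hji, hw j hj]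
  · intro w _
    simp
  · rintro ⟨w, a⟩ hw
    simp only [mem_filter, mem_univ, true_and, mem_product, and_true] at hw
    simp [← hw i hi]
  · intro w _
    simp

theorem sumOver_union {F H : Finset V} (h : Disjoint F H) (f : (V → A) → ℝ) (v : V → A) :
    sumOver (F ∪ H) f v = sumOver F (sumOver H f) v := by
  induction H using Finset.induction_on generalizing f with
  | empty =>
    rw [union_empty]
    exact sumOver_congr fun w _ => (sumOver_empty f w).symm
  | insert i H hi ih =>
    rw [disjoint_insert_right] at h
    rw [union_insert, sumOver_insert (by simp [hi, h.1]), ih h.2]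
    exact sumOver_congr fun w _ => (sumOver_insert hi f w).symm

theorem DependsOn.sum_update {f : (V → A) → ℝ} {D : Finset V} (hf : DependsOn f (D : Set V))
    (i : V) :
    DependsOn (fun w => ∑ a, f (Function.update w i a)) ((D \ {i} : Finset V) : Set V) := by
  intro x y hxy
  refine sum_congr rfl fun a _ => hf fun j hj => ?_
  by_cases hji : j = i
  · subst hji; simp
  · simp only [Function.update_of_ne hji]
    exact hxy j (by simpa [hji] using hj)

theorem DependsOn.sumOver {f : (V → A) → ℝ} {D : Finset V} (hf : DependsOn f (D : Set V))
    (F : Finset V) : DependsOn (sumOver F f) ((D \ F : Finset V) : Set V) := by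
  induction F using Finset.induction_on generalizing f D with
  | empty =>
    intro x y hxy
    rw [sumOver_empty, sumOver_empty]
    exact hf fun j hj => hxy j (by simpa using hj)
  | insert i F hi ih =>
    intro x y hxy
    rw [sumOver_insert hi, sumOver_insert hi]
    refine ih (hf.sum_update i) fun j hj => hxy j ?_
    simp only [coe_sdiff, Set.mem_sdiff, mem_coe, mem_singleton, mem_insert] at hj ⊢
    tauto

theorem sumOver_mul_left {F D : Finset V} {g : (V → A) → ℝ} (hg : DependsOn g (D : Set V))
    (h : Disjoint D F) (f : (V → A) → ℝ) (v : V → A) :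
    sumOver F (fun w => g w * f w) v = g v * sumOver F f v := by
  classical
  unfold sumOver
  rw [mul_sum]
  refine sum_congr rfl fun w hw => ?_
  rw [mem_filter] at hw
  dsimp only
  rw [hg fun j hj => hw.2 j (disjoint_left.1 h hj)]

theorem sumOver_const (F : Finset V) (c : ℝ) (v : V → A) :
    sumOver F (fun _ => c) v = (Fintype.card A : ℝ) ^ F.card * c := by
  induction F using Finset.induction_on with
  | empty => simp [sumOver_empty]
  | insert i F hi ih =>
    rw [sumOver_insert hi, card_insert_of_notMem hi]
    simp only [sum_const, card_univ, nsmul_eq_mul]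
    have : sumOver F (fun _ : V → A => (Fintype.card A : ℝ) * c) v
        = (Fintype.card A : ℝ) * sumOver F (fun _ => c) v := by
      unfold sumOver; rw [mul_sum]
    rw [this, ih]; ring

end SumOver

/-! ### c-factors -/

namespace SMCG

variable {V U : Type*} (G : SMCG V U)

theorem not_edge_self (x : V ⊕ U) : ¬ G.edge x x := fun h => G.acyclic x (.single h)

/-- `ρ` is a topological numbering of the observable vertices. -/
def IsTopological (ρ : V → ℕ) : Prop :=
  Function.Injective ρ ∧ ∀ x y, G.edge (Sum.inl x) (Sum.inl y) → ρ x < ρ y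

/-- The number r of observable ancestors grows strictly along an edge x → y: ancestors of x are
ancestors of y, and x itself is one of y but, by acyclicity, not of x. The index breaks ties and
gives injectivity. -/
theorem exists_isTopological {n : ℕ} {U : Type*} (G : SMCG (Fin n) U) :
    ∃ ρ : Fin n → ℕ, G.IsTopological ρ := by
  classical
  let r : Fin n → ℕ := fun x =>
    (univ.filter fun y : Fin n => Relation.TransGen G.edge (Sum.inl y) (Sum.inl x)).card
  refine ⟨fun x => r x * n + x, ?_, ?_⟩
  · intro x y hxy
    have h : (r x * n + x) % n = (r y * n + y) % n := congrArg (· % n) hxy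
    rw [Nat.mul_add_mod_self_right, Nat.mul_add_mod_self_right, Nat.mod_eq_of_lt x.2,
      Nat.mod_eq_of_lt y.2] at h
    exact Fin.ext h
  · intro x y hxy
    have h : r x < r y := by
      refine card_lt_card ⟨fun z hz => ?_, fun hs => ?_⟩
      · simp only [mem_filter, mem_univ, true_and] at hz ⊢
        exact hz.tail hxy
      · have := hs (by simpa using Relation.TransGen.single hxy)
        simp only [mem_filter, mem_univ, true_and] at this
        exact G.acyclic _ this
    have h2 : (r x + 1) * n ≤ r y * n := Nat.mul_le_mul_right n h
    have := x.2
    dsimp only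
    nlinarith

end SMCG

namespace CBN

variable {V U A : Type*} [Fintype V] [DecidableEq V] [Fintype U] [Fintype A] {G : SMCG V U}

/-- The distribution of an unobservable vertex. -/
def latent (X : SMBN G A) (j : U) (a : A) : ℝ :=
  X.cpd (Sum.inr j) (fun y => (G.root j y.1 y.2).elim) a

open Classical in
/-- The c-factor of `S`: the distribution of `S` when all other observable vertices are set
to their values in `v`. -/
noncomputable def cFactor (X : SMBN G A) (S : Finset V) (v : V → A) : ℝ :=
  ∑ u : U → A, (∏ j, X.latent j (u j)) *
    ∏ i ∈ S, X.cpd (Sum.inl i) (fun y => Sum.elim v u y.1) (v i)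

theorem latent_nonneg (X : SMBN G A) (j : U) (a : A) : 0 ≤ X.latent j a := X.cpd_nonneg _ _ _

theorem sum_latent (X : SMBN G A) (j : U) : ∑ a, X.latent j a = 1 := X.cpd_sum _ _

theorem sum_prod_latent [DecidableEq U] (X : SMBN G A) :
    ∑ u : U → A, ∏ j, X.latent j (u j) = 1 := by
  rw [← Fintype.piFinset_univ, ← Finset.prod_univ_sum (fun _ => univ) (fun j a => X.latent j a)]
  simp [sum_latent]

theorem cFactor_nonneg (X : SMBN G A) (S : Finset V) (v : V → A) : 0 ≤ X.cFactor S v :=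
  sum_nonneg fun _ _ => mul_nonneg (prod_nonneg fun _ _ => X.latent_nonneg _ _)
    (prod_nonneg fun _ _ => X.cpd_nonneg _ _ _)

theorem cFactor_empty (X : SMBN G A) (v : V → A) : X.cFactor ∅ v = 1 := by
  classical
  simp only [cFactor, prod_empty, mul_one]
  exact X.sum_prod_latent

theorem dependsOn_cFactor (X : SMBN G A) (S : Finset V) :
    DependsOn (X.cFactor S) ((S ∪ G.pa S : Finset V) : Set V) := by
  classical
  intro v w h
  have h' : ∀ i ∈ S, v i = w i := fun i hi => h i (by simp [hi])
  refine sum_congr rfl fun u _ => ?_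
  congr 1
  refine prod_congr rfl fun i hi => ?_
  rw [h' i hi]
  congr 1
  funext y
  obtain ⟨y | y, hy⟩ := y
  · refine h y ?_
    by_cases hyS : y ∈ S
    · simp [hyS]
    · simp only [coe_union, Set.mem_union, mem_coe, SMCG.pa, mem_filter, mem_univ, true_and]
      exact Or.inr ⟨hyS, i, hi, hy⟩
  · rfl

/-- Once v agrees with t, the set T enters the definition only through the factors that are left
out, so statements about interventions become statements about c-factors. Unobservables are roots,
hence their conditional distributions have no arguments. -/
theorem doProb_eq (X : SMBN G A) (I : Intervention V A) (v : V → A)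
    (h : ∀ i a, I i = some a → v i = a) : X.doProb I v = X.cFactor I.free v := by
  classical
  rw [CBN.doProb, if_pos h]
  refine sum_congr rfl fun u _ => ?_
  rw [mul_comm]
  congr 1
  refine prod_congr rfl fun j _ => ?_
  unfold latent
  congr 1
  funext y
  exact (G.root j y.1 y.2).elim

/-- If i has no child in S, the value at i occurs only in the factor of i itself, and that factor
sums to 1. -/
theorem sum_cFactor_update (X : SMBN G A) {S : Finset V} {i : V} (hi : i ∉ S)
    (hS : ∀ x ∈ S, ¬ G.edge (Sum.inl i) (Sum.inl x)) (v : V → A) :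
    ∑ a, X.cFactor (insert i S) (Function.update v i a) = X.cFactor S v := by
  classical
  unfold cFactor
  rw [sum_comm]
  refine sum_congr rfl fun u _ => ?_
  rw [← mul_sum]
  congr 1
  have key : ∀ x, ¬ G.edge (Sum.inl i) (Sum.inl x) → ∀ a,
      (fun y : {y : V ⊕ U // G.edge y (Sum.inl x)} => Sum.elim (Function.update v i a) u y.1)
        = fun y => Sum.elim v u y.1 := by
    intro x hx a
    funext y
    obtain ⟨y | y, hy⟩ := y
    · have : y ≠ i := by rintro rfl; exact hx hy
      simp [this]
    · rfl
  have : ∀ a, ∏ x ∈ insert i S, X.cpd (Sum.inl x)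
        (fun y => Sum.elim (Function.update v i a) u y.1) (Function.update v i a x)
      = X.cpd (Sum.inl i) (fun y => Sum.elim v u y.1) a *
        ∏ x ∈ S, X.cpd (Sum.inl x) (fun y => Sum.elim v u y.1) (v x) := by
    intro a
    rw [prod_insert hi, key i (G.not_edge_self _), Function.update_self]
    congr 1
    refine prod_congr rfl fun x hx => ?_
    rw [key x (hS x hx), Function.update_of_ne (by rintro rfl; exact hi hx)]
  simp_rw [this]
  rw [← sum_mul, X.cpd_sum, one_mul]

/-- The vertices of R are summed out from the last to the first in topological order. When its turn
comes, a vertex has no child left in R, and by `hR` none in S. -/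
theorem sumOver_cFactor (X : SMBN G A) {ρ : V → ℕ} (hρ : G.IsTopological ρ) {S R : Finset V}
    (hd : Disjoint S R) (hR : ∀ i ∈ R, ∀ x ∈ S, ¬ G.edge (Sum.inl i) (Sum.inl x)) (v : V → A) :
    sumOver R (X.cFactor (S ∪ R)) v = X.cFactor S v := by
  induction R using Finset.induction_on_max_value ρ generalizing v with
  | empty => rw [sumOver_empty, union_empty]
  | insert i R hi hmax ih =>
    rw [disjoint_insert_right] at hd
    rw [sumOver_insert hi, union_insert,
      ← ih hd.2 (fun j hj => hR j (mem_insert_of_mem hj))]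
    refine sumOver_congr fun w _ => X.sum_cFactor_update (by simp [hi, hd.1]) ?_ w
    intro x hx he
    rcases mem_union.1 hx with hx | hx
    · exact hR i (mem_insert_self _ _) x hx he
    · exact absurd (hρ.2 _ _ he) (not_lt.2 (hmax x hx))

theorem sumOver_cFactor_self (X : SMBN G A) {ρ : V → ℕ} (hρ : G.IsTopological ρ) (S : Finset V)
    (v : V → A) : sumOver S (X.cFactor S) v = 1 := by
  have := X.sumOver_cFactor hρ (S := ∅) (R := S) (by simp) (by simp) v
  rwa [empty_union, cFactor_empty] at this

theorem cFactor_le_one (X : SMBN G A) {ρ : V → ℕ} (hρ : G.IsTopological ρ) (S : Finset V)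
    (v : V → A) : X.cFactor S v ≤ 1 := by
  rw [← X.sumOver_cFactor_self hρ S v]
  exact le_sumOver v (X.cFactor_nonneg S)

/-- Functions of disjoint sets of independent variables are uncorrelated. -/
theorem sum_prod_mul_mul [DecidableEq U] {w : U → A → ℝ} (hw : ∑ u : U → A, ∏ j, w j (u j) = 1)
    (W : Set U) {f g : (U → A) → ℝ} (hf : DependsOn f W) (hg : DependsOn g Wᶜ) :
    ∑ u : U → A, (∏ j, w j (u j)) * (f u * g u)
      = (∑ u : U → A, (∏ j, w j (u j)) * f u) * ∑ u : U → A, (∏ j, w j (u j)) * g u := by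
  classical
  -- Two independent copies u, u' exchange their coordinates outside W. This is an involution on
  -- pairs that preserves the product weight and turns f(u) g(u) into a product of a function of one
  -- copy and a function of the other.
  let mix : (U → A) → (U → A) → U → A := fun u u' j => if j ∈ W then u j else u' j
  rw [sum_mul_sum, ← sum_product']
  rw [← mul_one (∑ u : U → A, (∏ j, w j (u j)) * (f u * g u)), ← hw, sum_mul_sum, ← sum_product']
  refine sum_bij' (fun x _ => (mix x.1 x.2, mix x.2 x.1)) (fun x _ => (mix x.1 x.2, mix x.2 x.1))
    (by simp) (by simp) ?_ ?_ ?_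
  · rintro ⟨x, y⟩ _
    simp only [mix, Prod.mk.injEq]
    constructor <;> · funext j; by_cases hj : j ∈ W <;> simp [hj]
  · rintro ⟨x, y⟩ _
    simp only [mix, Prod.mk.injEq]
    constructor <;> · funext j; by_cases hj : j ∈ W <;> simp [hj]
  · rintro ⟨x, y⟩ _
    have h1 : f (mix x y) = f x := hf fun j hj => by simp [mix, hj]
    have h2 : g (mix y x) = g x := hg fun j hj => by
      simp [mix, show j ∉ W from hj]
    have h3 : (∏ j, w j (mix x y j)) * ∏ j, w j (mix y x j)
        = (∏ j, w j (x j)) * ∏ j, w j (y j) := by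
      rw [← prod_mul_distrib, ← prod_mul_distrib]
      refine prod_congr rfl fun j _ => ?_
      by_cases hj : j ∈ W <;> simp [mix, hj, mul_comm]
    dsimp only
    rw [h1, h2]
    linear_combination (-(f x) * g x) * h3

/-- An unobservable with a child in S and a child in Y would be a bidirected edge. So with W the
unobservables feeding S, the product over S depends on W and the product over Y on the complement,
and independence separates them. -/
theorem cFactor_union (X : SMBN G A) {S Y : Finset V} (hd : Disjoint S Y)
    (h : ∀ x ∈ S, ∀ y ∈ Y, ¬ G.Bidirected x y) (v : V → A) :
    X.cFactor (S ∪ Y) v = X.cFactor S v * X.cFactor Y v := by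
  classical
  unfold cFactor
  let W : Set U := {j | ∃ x ∈ S, G.edge (Sum.inr j) (Sum.inl x)}
  rw [← sum_prod_mul_mul X.sum_prod_latent W]
  · refine sum_congr rfl fun u _ => ?_
    rw [prod_union hd]
  · intro u u' huu
    refine prod_congr rfl fun i hi => ?_
    congr 1
    funext y
    obtain ⟨y | y, hy⟩ := y
    · rfl
    · exact huu y ⟨i, hi, hy⟩
  · intro u u' huu
    refine prod_congr rfl fun i hi => ?_
    congr 1
    funext y
    obtain ⟨y | y, hy⟩ := y
    · rfl
    · refine huu y ?_
      rintro ⟨x, hx, hxy⟩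
      refine h x hx i hi ⟨?_, y, hxy, hy⟩
      rintro rfl
      exact disjoint_left.1 hd hx hi

end CBN

/-! ### Products of estimated conditional distributions -/

section Estimate

variable {V U A L : Type*} [Fintype V] [DecidableEq V] [Fintype U] [Fintype A] [DecidableEq L]
  {G : SMCG V U}

theorem sq_sumOver_abs_le (F : Finset V) (f : (V → A) → ℝ) (v : V → A) :
    sumOver F (fun w => |f w|) v ^ 2
      ≤ (Fintype.card A : ℝ) ^ F.card * sumOver F (fun w => f w ^ 2) v := by
  classical
  have h : (Fintype.card A : ℝ) ^ F.card = sumOver F (fun _ : V → A => (1 : ℝ)) v := by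
    rw [sumOver_const, mul_one]
  rw [h]
  unfold sumOver
  have := sum_mul_sq_le_sq_mul_sq (univ.filter fun w : V → A => ∀ i, i ∉ F → w i = v i)
    (fun _ => (1 : ℝ)) (fun w => |f w|)
  simpa using this

/-- The vertices of `F` in the class of `i` that are not later than `i`. -/
def lowerClass (ρ : V → ℕ) (κ : V → L) (F : Finset V) (i : V) : Finset V :=
  F.filter fun j => κ j = κ i ∧ ρ j ≤ ρ i

/-- `c S i` is a conditional distribution of the last vertex `i` of `S`, given the other vertices
of `S` and the parents of `S`. -/
structure IsKernelFamily (G : SMCG V U) (ρ : V → ℕ) (c : Finset V → V → (V → A) → ℝ) : Prop where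
  nonneg : ∀ S i v, 0 ≤ c S i v
  sum_update : ∀ S i v, i ∈ S → (∀ j ∈ S, ρ j ≤ ρ i) → ∑ a, c S i (Function.update v i a) = 1
  dependsOn : ∀ S i, DependsOn (c S i) ((S ∪ G.pa S : Finset V) : Set V)

/-- The product of the conditional distributions of the vertices of `F`. -/
def kernelProd (ρ : V → ℕ) (κ : V → L) (c : Finset V → V → (V → A) → ℝ) (F : Finset V)
    (v : V → A) : ℝ :=
  ∏ i ∈ F, c (lowerClass ρ κ F i) i v

variable {ρ : V → ℕ} {κ : V → L} {c : Finset V → V → (V → A) → ℝ}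

theorem self_mem_lowerClass {F : Finset V} {i : V} (hi : i ∈ F) : i ∈ lowerClass ρ κ F i := by
  simp [lowerClass, hi]

theorem le_of_mem_lowerClass {F : Finset V} {i j : V} (h : j ∈ lowerClass ρ κ F i) :
    ρ j ≤ ρ i := by
  simp only [lowerClass, mem_filter] at h
  exact h.2.2

theorem lowerClass_subset (F : Finset V) (i : V) : lowerClass ρ κ F i ⊆ F := filter_subset _ _

theorem lowerClass_insert {F : Finset V} {i j : V} (h : ρ j < ρ i) :
    lowerClass ρ κ (insert i F) j = lowerClass ρ κ F j := by
  unfold lowerClass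
  rw [filter_insert, if_neg]
  rintro ⟨-, h'⟩
  omega

theorem lowerClass_insert_self {F : Finset V} {i : V} (h : ∀ j ∈ F, ρ j ≤ ρ i) :
    lowerClass ρ κ (insert i F) i = insert i (F.filter fun j => κ j = κ i) := by
  unfold lowerClass
  rw [filter_insert, if_pos ⟨rfl, le_rfl⟩]
  congr 1
  refine filter_congr fun j hj => ?_
  simp [h j hj]

theorem kernelProd_insert (hρ : G.IsTopological ρ) {F : Finset V} {i : V} (hi : i ∉ F)
    (hmax : ∀ j ∈ F, ρ j ≤ ρ i) (v : V → A) :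
    kernelProd ρ κ c (insert i F) v
      = c (insert i (F.filter fun j => κ j = κ i)) i v * kernelProd ρ κ c F v := by
  unfold kernelProd
  rw [prod_insert hi, lowerClass_insert_self hmax]
  congr 1
  refine prod_congr rfl fun j hj => ?_
  rw [lowerClass_insert]
  refine lt_of_le_of_ne (hmax j hj) fun h => hi ?_
  rwa [← hρ.1 h]

theorem kernelProd_nonneg (hc : IsKernelFamily G ρ c) (F : Finset V) (v : V → A) :
    0 ≤ kernelProd ρ κ c F v := prod_nonneg fun _ _ => hc.nonneg _ _ _

theorem not_mem_union_pa (hρ : G.IsTopological ρ) {S : Finset V} {i : V} (hi : i ∉ S)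
    (hmax : ∀ j ∈ S, ρ j ≤ ρ i) : i ∉ S ∪ G.pa S := by
  simp only [SMCG.pa, mem_union, mem_filter, mem_univ, true_and, not_or, not_and, not_exists]
  refine ⟨hi, fun _ x hx he => ?_⟩
  exact absurd (hρ.2 _ _ he) (not_lt.2 (hmax x hx))

theorem DependsOn.apply_update {f : (V → A) → ℝ} {D : Finset V} (hf : DependsOn f (D : Set V))
    {i : V} (hi : i ∉ D) (v : V → A) (a : A) : f (Function.update v i a) = f v :=
  hf fun j hj => Function.update_of_ne (by rintro rfl; exact hi hj) _ _

theorem kernelProd_update (hρ : G.IsTopological ρ) (hc : IsKernelFamily G ρ c) {F : Finset V}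
    {i : V} (hi : i ∉ F) (hmax : ∀ j ∈ F, ρ j ≤ ρ i) (v : V → A) (a : A) :
    kernelProd ρ κ c F (Function.update v i a) = kernelProd ρ κ c F v := by
  refine prod_congr rfl fun j hj => (hc.dependsOn _ _).apply_update ?_ v a
  exact not_mem_union_pa hρ (fun h => hi (lowerClass_subset _ _ h))
    fun x hx => hmax x (lowerClass_subset _ _ hx)

theorem sumOver_insert_kernel_mul (hc : IsKernelFamily G ρ c)
    {F : Finset V} {i : V} (hi : i ∉ F) (hmax : ∀ j ∈ F, ρ j ≤ ρ i) {g : (V → A) → ℝ}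
    (hg : ∀ w a, g (Function.update w i a) = g w) (v : V → A) :
    sumOver (insert i F) (fun w => c (insert i (F.filter fun j => κ j = κ i)) i w * g w) v
      = sumOver F g v := by
  rw [sumOver_insert hi]
  refine sumOver_congr fun w _ => ?_
  simp_rw [hg]
  rw [← sum_mul, hc.sum_update _ _ _ (mem_insert_self _ _), one_mul]
  intro j hj
  rcases mem_insert.1 hj with rfl | hj
  · exact le_rfl
  · exact hmax j (mem_filter.1 hj).1

/-- Normalisation is exact for arbitrary kernels, however inaccurate: summing out the last vertex
removes its kernel. This is why the oracle always answers with a probability distribution. -/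
theorem sumOver_kernelProd (hρ : G.IsTopological ρ) (hc : IsKernelFamily G ρ c) (F : Finset V)
    (v : V → A) : sumOver F (kernelProd ρ κ c F) v = 1 := by
  induction F using Finset.induction_on_max_value ρ with
  | empty => simp [sumOver_empty, kernelProd]
  | insert i F hi hmax ih =>
    rw [← ih, ← sumOver_insert_kernel_mul (κ := κ) hc hi hmax
      (fun w a => kernelProd_update hρ hc hi hmax w a)]
    exact sumOver_congr fun w _ => kernelProd_insert hρ hi hmax w

/-- The error of the conditional distribution of the last vertex `i` of `S`. -/
noncomputable def localError (X : SMBN G A) (c : Finset V → V → (V → A) → ℝ) (S : Finset V) (i : V)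
    (v : V → A) : ℝ :=
  sumOver (S ∪ G.pa S)
    (fun w => |X.cFactor S w - X.cFactor (S.erase i) w * c S i w|) v

theorem disjoint_pa (G : SMCG V U) (S : Finset V) : Disjoint S (G.pa S) := by
  rw [disjoint_right]
  intro i hi
  simp only [SMCG.pa, mem_filter] at hi
  exact hi.2.1

/-- Parents of S may lie in Y, so D and Q_Y are entangled. Bounding D by its sum over all values of
Pa(S) leaves a function of S alone; then Q_Y sums out to 1, and the result no longer depends on what
surrounds S. -/
theorem sumOver_cFactor_mul_le (X : SMBN G A) (hρ : G.IsTopological ρ) {S Y : Finset V}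
    (hSY : Disjoint S Y) {D : (V → A) → ℝ} (hD0 : ∀ w, 0 ≤ D w)
    (hD : DependsOn D ((S ∪ G.pa S : Finset V) : Set V)) (v : V → A) :
    sumOver (S ∪ Y) (fun w => D w * X.cFactor Y w) v ≤ sumOver (S ∪ G.pa S) D v := by
  have hg : DependsOn (sumOver (G.pa S) D) (S : Set V) := by
    have := DependsOn.sumOver hD (G.pa S)
    rwa [union_sdiff_right, sdiff_eq_self_of_disjoint (disjoint_pa G S)] at this
  calc sumOver (S ∪ Y) (fun w => D w * X.cFactor Y w) v
      ≤ sumOver (S ∪ Y) (fun w => sumOver (G.pa S) D w * X.cFactor Y w) v :=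
        sumOver_mono fun w _ =>
          mul_le_mul_of_nonneg_right (le_sumOver w hD0) (X.cFactor_nonneg _ _)
    _ = sumOver S (sumOver Y fun w => sumOver (G.pa S) D w * X.cFactor Y w) v :=
        sumOver_union hSY _ _
    _ = sumOver S (sumOver (G.pa S) D) v := by
        refine sumOver_congr fun w _ => ?_
        rw [sumOver_mul_left hg hSY, X.sumOver_cFactor_self hρ, mul_one]
    _ = sumOver (S ∪ G.pa S) D v := (sumOver_union (disjoint_pa G S) _ _).symm

theorem dependsOn_localError (X : SMBN G A) (hc : IsKernelFamily G ρ c) {S : Finset V} {i : V} :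
    DependsOn (fun w => |X.cFactor (insert i S) w - X.cFactor S w * c (insert i S) i w|)
      ((insert i S ∪ G.pa (insert i S) : Finset V) : Set V) := by
  intro w w' h
  have h1 : X.cFactor (insert i S) w = X.cFactor (insert i S) w' := X.dependsOn_cFactor _ h
  have h2 : c (insert i S) i w = c (insert i S) i w' := hc.dependsOn _ _ h
  have h3 : X.cFactor S w = X.cFactor S w' := by
    refine X.dependsOn_cFactor _ fun j hj => h j ?_
    simp only [SMCG.pa, coe_union, Set.mem_union, mem_coe, mem_filter, mem_univ, true_and,
      mem_insert] at hj ⊢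
    by_cases hji : j = i
    · exact Or.inl (Or.inl hji)
    · rcases hj with hj | ⟨hj, x, hx, he⟩
      · exact Or.inl (Or.inr hj)
      · exact Or.inr ⟨by tauto, x, Or.inr hx, he⟩
  dsimp only
  rw [h1, h2, h3]

/-- The product of conditional distributions is close to the c-factor if each of them is. -/
theorem sumOver_abs_cFactor_sub_kernelProd_le (X : SMBN G A) (hρ : G.IsTopological ρ)
    (hc : IsKernelFamily G ρ c) (F : Finset V)
    (hκ : ∀ x ∈ F, ∀ y ∈ F, G.Bidirected x y → κ x = κ y) (v : V → A) :
    sumOver F (fun w => |X.cFactor F w - kernelProd ρ κ c F w|) v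
      ≤ ∑ i ∈ F, localError X c (lowerClass ρ κ F i) i v := by
  induction F using Finset.induction_on_max_value ρ with
  | empty => simp [sumOver_empty, kernelProd, X.cFactor_empty]
  | insert i F hi hmax ih =>
    -- The classes of κ stay fixed while F grows; they need not be connected in G[F]. It suffices
    -- that no bidirected edge joins different classes, so that Q splits along S and Y both before
    -- and after adding i.
    set S := F.filter fun j => κ j = κ i with hS
    set Y := F.filter fun j => ¬ κ j = κ i with hY
    have hiS : i ∉ S := fun h => hi (mem_filter.1 h).1
    have hSY : S ∪ Y = F := filter_union_filter_not_eq _ _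
    have hdSY : Disjoint S Y := disjoint_filter_filter_not _ _ _
    have hdiSY : Disjoint (insert i S) Y := by
      rw [disjoint_insert_left]
      exact ⟨fun h => hi (mem_filter.1 h).1, hdSY⟩
    have hbi : ∀ x ∈ insert i S, ∀ y ∈ Y, ¬ G.Bidirected x y := by
      intro x hx y hy hxy
      have hy' := mem_filter.1 hy
      have := hκ x (by
        rcases mem_insert.1 hx with rfl | hx
        · exact mem_insert_self _ _
        · exact mem_insert_of_mem (mem_filter.1 hx).1) y (mem_insert_of_mem hy'.1) hxy
      rcases mem_insert.1 hx with rfl | hx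
      · exact hy'.2 this.symm
      · exact hy'.2 (this.symm.trans (mem_filter.1 hx).2)
    have hQ : ∀ w, X.cFactor (insert i F) w = X.cFactor (insert i S) w * X.cFactor Y w := by
      intro w
      rw [← X.cFactor_union hdiSY hbi, insert_union, hSY]
    have hQ' : ∀ w, X.cFactor F w = X.cFactor S w * X.cFactor Y w := by
      intro w
      rw [← X.cFactor_union hdSY (fun x hx => hbi x (mem_insert_of_mem hx)), hSY]
    have hQu : ∀ w a, |X.cFactor F (Function.update w i a)
        - kernelProd ρ κ c F (Function.update w i a)|
          = |X.cFactor F w - kernelProd ρ κ c F w| := by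
      intro w a
      rw [kernelProd_update hρ hc hi hmax,
        (X.dependsOn_cFactor F).apply_update (not_mem_union_pa hρ hi hmax)]
    rw [sum_insert hi, lowerClass_insert_self hmax]
    have hrest : ∑ j ∈ F, localError X c (lowerClass ρ κ (insert i F) j) j v
        = ∑ j ∈ F, localError X c (lowerClass ρ κ F j) j v := by
      refine sum_congr rfl fun j hj => ?_
      rw [lowerClass_insert]
      refine lt_of_le_of_ne (hmax j hj) fun h => hi ?_
      rwa [← hρ.1 h]
    rw [hrest]
    -- Writing c for the kernel of i and Π_F for the product of the kernels of F, the telescoping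
    -- identity is Q_{S+i} Q_Y − c Π_F = (Q_{S+i} − Q_S c) Q_Y + c (Q_S Q_Y − Π_F). The first term
    -- is the local error of i; in the second, c sums out to 1 and the induction hypothesis applies.
    calc sumOver (insert i F) (fun w => |X.cFactor (insert i F) w
            - kernelProd ρ κ c (insert i F) w|) v
        ≤ sumOver (insert i F) (fun w =>
            |X.cFactor (insert i S) w - X.cFactor S w * c (insert i S) i w| * X.cFactor Y w
            + c (insert i S) i w * |X.cFactor F w - kernelProd ρ κ c F w|) v := by
          refine sumOver_mono fun w _ => ?_
          rw [kernelProd_insert hρ hi hmax, ← hS, hQ, hQ']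
          have h1 := X.cFactor_nonneg Y w
          have h2 := hc.nonneg (insert i S) i w
          rw [← abs_of_nonneg h1, ← abs_mul]
          conv_rhs => rw [← abs_of_nonneg h2]
          rw [← abs_mul, abs_of_nonneg h1, abs_of_nonneg h2]
          refine le_trans (le_of_eq ?_) (abs_add_le _ _)
          congr 1
          ring
      _ ≤ localError X c (insert i S) i v
            + ∑ j ∈ F, localError X c (lowerClass ρ κ F j) j v := by
          rw [sumOver_add]
          refine add_le_add ?_ ?_
          · have := sumOver_cFactor_mul_le X hρ hdiSY (fun w => abs_nonneg _)
              (dependsOn_localError X hc) v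
            rw [insert_union, hSY] at this
            unfold localError
            rwa [erase_insert hiS]
          · refine le_trans (le_of_eq ?_) (ih fun x hx y hy =>
              hκ x (mem_insert_of_mem hx) y (mem_insert_of_mem hy))
            exact sumOver_insert_kernel_mul hc hi hmax hQu v

/-! ### Conditional distributions obtained by normalising positive weights. -/

/-- The conditional distribution of the last vertex `i` of `S` that belongs to the weights `h`. -/
noncomputable def condOf (h : Finset V → (V → A) → ℝ) (S : Finset V) (i : V) (v : V → A) : ℝ :=
  h S v / ∑ a, h S (Function.update v i a)

/-- Positivity excludes 0/0, which would break normalisation at assignments never sampled; smoothing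
by one supplies it. -/
theorem isKernelFamily_condOf [Nonempty A] {h : Finset V → (V → A) → ℝ}
    (hpos : ∀ S v, 0 < h S v)
    (hdep : ∀ S, DependsOn (h S) ((S ∪ G.pa S : Finset V) : Set V)) :
    IsKernelFamily G ρ (condOf h) where
  nonneg S i v := div_nonneg (hpos _ _).le (sum_nonneg fun _ _ => (hpos _ _).le)
  sum_update S i v _ _ := by
    unfold condOf
    simp_rw [Function.update_idem]
    rw [← sum_div]
    exact div_self (sum_pos (fun _ _ => hpos _ _) univ_nonempty).ne'
  dependsOn S i := by
    intro v w hvw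
    unfold condOf
    congr 1
    · exact hdep S hvw
    · refine sum_congr rfl fun a _ => hdep S fun j hj => ?_
      by_cases hji : j = i
      · subst hji; simp
      · simpa [hji] using hvw j hj

/-- With H the sum of h over the values of i, Q_S − Q_{S∖i}·h/H = (Q_S − h) + (h/H)(H − Q_{S∖i}). In
the second term h/H sums to 1 over i. Since i is last in S, Q_{S∖i} is the marginal of Q_S, so H −
Q_{S∖i} is again a sum of errors h − Q_S. Hence the factor 2, with no division by a small
probability. -/
theorem localError_condOf_le (X : SMBN G A) (hρ : G.IsTopological ρ) [Nonempty A]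
    {h : Finset V → (V → A) → ℝ} (hpos : ∀ S v, 0 < h S v) {S : Finset V} {i : V} (hi : i ∈ S)
    (hmax : ∀ j ∈ S, ρ j ≤ ρ i) (v : V → A) :
    localError X (condOf h) S i v
      ≤ 2 * sumOver (S ∪ G.pa S) (fun w => |h S w - X.cFactor S w|) v := by
  set H : (V → A) → ℝ := fun w => ∑ a, h S (Function.update w i a) with hH
  have hHpos : ∀ w, 0 < H w := fun w => sum_pos (fun _ _ => hpos _ _) univ_nonempty
  have hHu : ∀ w a, H (Function.update w i a) = H w := by
    intro w a
    simp [hH]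
  have hQ : ∀ w, ∑ a, X.cFactor S (Function.update w i a) = X.cFactor (S.erase i) w := by
    intro w
    conv_lhs => rw [← insert_erase hi]
    refine X.sum_cFactor_update (by simp) (fun x hx he => ?_) w
    exact absurd (hρ.2 _ _ he) (not_lt.2 (hmax x (mem_of_mem_erase hx)))
  have hQu : ∀ w a, X.cFactor (S.erase i) (Function.update w i a) = X.cFactor (S.erase i) w := by
    intro w a
    rw [← hQ, ← hQ]
    simp
  obtain ⟨R, hiR, hR⟩ : ∃ R, i ∉ R ∧ insert i R = S ∪ G.pa S :=
    ⟨(S ∪ G.pa S).erase i, by simp, insert_erase (by simp [hi])⟩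
  unfold localError
  rw [← hR, two_mul]
  calc sumOver (insert i R)
        (fun w => |X.cFactor S w - X.cFactor (S.erase i) w * condOf h S i w|) v
      ≤ sumOver (insert i R) (fun w => |h S w - X.cFactor S w|
          + h S w / H w * |H w - X.cFactor (S.erase i) w|) v := by
        refine sumOver_mono fun w _ => ?_
        have h1 : 0 ≤ h S w / H w := div_nonneg (hpos _ _).le (hHpos _).le
        have h2 : h S w = h S w / H w * H w := (div_mul_cancel₀ _ (hHpos w).ne').symm
        rw [abs_sub_comm (h S w)]
        conv_rhs => rw [← abs_of_nonneg h1]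
        rw [← abs_mul]
        refine le_trans (le_of_eq ?_) (abs_add_le _ _)
        congr 1
        change X.cFactor S w - X.cFactor (S.erase i) w * (h S w / H w) = _
        linear_combination h2
    _ = sumOver (insert i R) (fun w => |h S w - X.cFactor S w|) v
          + sumOver R (fun w => |H w - X.cFactor (S.erase i) w|) v := by
        rw [sumOver_add]
        congr 1
        rw [sumOver_insert hiR]
        refine sumOver_congr fun w _ => ?_
        simp_rw [hHu, hQu]
        rw [← sum_mul, ← sum_div, div_self (hHpos w).ne', one_mul]
    _ ≤ _ := by
        refine add_le_add le_rfl ?_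
        rw [sumOver_insert hiR]
        refine sumOver_mono fun w _ => ?_
        rw [← hQ, hH, ← sum_sub_distrib]
        exact abs_sum_le_sum_abs _ _

/-- Cauchy–Schwarz is used over the vertices of F (factor at most |V|) and over the assignments to
each set and its parents (factor at most |A|^D); the 4 is the square of the 2 in
`localError_condOf_le`. The sets `lowerClass` of different vertices differ, each having its vertex
as last element, so the sum over F is at most the sum over 𝒮, which does not depend on F. -/
theorem sq_sumOver_abs_cFactor_sub_le (X : SMBN G A) (hρ : G.IsTopological ρ) [Nonempty A]
    {h : Finset V → (V → A) → ℝ} (hpos : ∀ S v, 0 < h S v)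
    (hdep : ∀ S, DependsOn (h S) ((S ∪ G.pa S : Finset V) : Set V)) (F : Finset V)
    (hκ : ∀ x ∈ F, ∀ y ∈ F, G.Bidirected x y → κ x = κ y) {𝒮 : Finset (Finset V)} {D : ℕ}
    (hF : ∀ i ∈ F, lowerClass ρ κ F i ∈ 𝒮)
    (hD : ∀ S ∈ 𝒮, (S ∪ G.pa S).card ≤ D) (v : V → A) :
    sumOver F (fun w => |X.cFactor F w - kernelProd ρ κ (condOf h) F w|) v ^ 2
      ≤ 4 * (Fintype.card V * (Fintype.card A : ℝ) ^ D)
        * ∑ S ∈ 𝒮, sumOver (S ∪ G.pa S) (fun w => (h S w - X.cFactor S w) ^ 2) v := by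
  set T : V → Finset V := lowerClass ρ κ F with hT
  have hA : (1 : ℝ) ≤ Fintype.card A := by exact_mod_cast Fintype.card_pos
  have hinj : Set.InjOn T F := by
    intro i hi j hj hij
    have h1 : i ∈ T j := hij ▸ self_mem_lowerClass hi
    have h2 : j ∈ T i := hij ▸ self_mem_lowerClass hj
    exact hρ.1 (le_antisymm (le_of_mem_lowerClass h1) (le_of_mem_lowerClass h2))
  have h0 : 0 ≤ sumOver F (fun w => |X.cFactor F w - kernelProd ρ κ (condOf h) F w|) v :=
    sumOver_nonneg fun _ => abs_nonneg _
  have h1 : sumOver F (fun w => |X.cFactor F w - kernelProd ρ κ (condOf h) F w|) v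
      ≤ 2 * ∑ i ∈ F, sumOver (T i ∪ G.pa (T i)) (fun w => |h (T i) w - X.cFactor (T i) w|) v := by
    refine (sumOver_abs_cFactor_sub_kernelProd_le X hρ (isKernelFamily_condOf hpos hdep)
      F hκ v).trans ?_
    rw [mul_sum]
    exact sum_le_sum fun i hi => localError_condOf_le X hρ hpos (self_mem_lowerClass hi)
      (fun j hj => le_of_mem_lowerClass hj) v
  have h2 := sq_sum_le_card_mul_sum_sq (s := F)
    (f := fun i => sumOver (T i ∪ G.pa (T i)) (fun w => |h (T i) w - X.cFactor (T i) w|) v)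
  have h3 : ∑ i ∈ F, sumOver (T i ∪ G.pa (T i)) (fun w => |h (T i) w - X.cFactor (T i) w|) v ^ 2
      ≤ (Fintype.card A : ℝ) ^ D * ∑ S ∈ 𝒮,
          sumOver (S ∪ G.pa S) (fun w => (h S w - X.cFactor S w) ^ 2) v := by
    calc _ ≤ ∑ i ∈ F, (Fintype.card A : ℝ) ^ D *
          sumOver (T i ∪ G.pa (T i)) (fun w => (h (T i) w - X.cFactor (T i) w) ^ 2) v := by
            refine sum_le_sum fun i hi => (sq_sumOver_abs_le _ _ _).trans ?_
            exact mul_le_mul_of_nonneg_right (pow_le_pow_right₀ hA (hD _ (hF i hi)))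
              (sumOver_nonneg fun _ => sq_nonneg _)
      _ = (Fintype.card A : ℝ) ^ D * ∑ S ∈ F.image T,
          sumOver (S ∪ G.pa S) (fun w => (h S w - X.cFactor S w) ^ 2) v := by
            rw [sum_image hinj, mul_sum]
      _ ≤ _ := by
            refine mul_le_mul_of_nonneg_left (sum_le_sum_of_subset_of_nonneg ?_ ?_) (by positivity)
            · intro S hS
              obtain ⟨i, hi, rfl⟩ := mem_image.1 hS
              exact hF i hi
            · exact fun _ _ _ => sumOver_nonneg fun _ => sq_nonneg _
  have hcard : (F.card : ℝ) ≤ Fintype.card V := by exact_mod_cast card_le_univ F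
  have h4 := sum_nonneg (s := 𝒮) fun S _ =>
    sumOver_nonneg (F := S ∪ G.pa S) (f := fun w => (h S w - X.cFactor S w) ^ 2) (v := v)
      fun _ => sq_nonneg _
  calc _ ≤ (2 * ∑ i ∈ F,
        sumOver (T i ∪ G.pa (T i)) (fun w => |h (T i) w - X.cFactor (T i) w|) v) ^ 2 :=
          pow_le_pow_left₀ h0 h1 2
    _ ≤ 4 * (F.card * ((Fintype.card A : ℝ) ^ D * ∑ S ∈ 𝒮,
          sumOver (S ∪ G.pa S) (fun w => (h S w - X.cFactor S w) ^ 2) v)) := by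
          have := h2.trans (mul_le_mul_of_nonneg_left h3 (Nat.cast_nonneg _))
          linarith [this, mul_pow 2 (∑ i ∈ F,
            sumOver (T i ∪ G.pa (T i)) (fun w => |h (T i) w - X.cFactor (T i) w|) v) 2]
    _ ≤ 4 * (Fintype.card V * ((Fintype.card A : ℝ) ^ D * ∑ S ∈ 𝒮,
          sumOver (S ∪ G.pa S) (fun w => (h S w - X.cFactor S w) ^ 2) v)) := by
          gcongr
    _ = _ := by ring

end Estimate

/-! ### Independent samples -/

section Independent

variable {ι Ω : Type*} [Fintype ι] [DecidableEq ι] [Fintype Ω]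

theorem sum_prod_eq_one {w : ι → Ω → ℝ} (hw : ∀ i, ∑ x, w i x = 1) :
    ∑ ω : ι → Ω, ∏ i, w i (ω i) = 1 := by
  rw [← Fintype.piFinset_univ, ← Finset.prod_univ_sum (fun _ => univ) w]
  simp [hw]

theorem sum_prod_mul_apply {w : ι → Ω → ℝ} (hw : ∀ i, ∑ x, w i x = 1) (i₀ : ι) (g : Ω → ℝ) :
    ∑ ω : ι → Ω, (∏ i, w i (ω i)) * g (ω i₀) = ∑ x, w i₀ x * g x := by
  have h : ∀ ω : ι → Ω, (∏ i, w i (ω i)) * g (ω i₀)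
      = ∏ i, w i (ω i) * if i = i₀ then g (ω i) else 1 := by
    intro ω
    rw [prod_mul_distrib, prod_ite_eq' univ i₀ (fun i => g (ω i)), if_pos (mem_univ _)]
  simp_rw [h]
  rw [← Fintype.piFinset_univ,
    ← Finset.prod_univ_sum (fun _ => univ) fun i x => w i x * if i = i₀ then g x else 1]
  rw [prod_eq_single i₀]
  · simp
  · intro i _ hi
    simp [hi, hw]
  · simp

/-- Variances of independent centred variables add up. The offset b is arbitrary so that the
induction can absorb the first sample into it; later it carries the bias of the smoothing. -/
theorem sum_prod_sq_sum_add {P f : Ω → ℝ} {σ : ℝ} (hP : ∑ x, P x = 1) (hf : ∑ x, P x * f x = 0)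
    (hσ : ∑ x, P x * f x ^ 2 = σ) (m : ℕ) (b : ℝ) :
    ∑ ω : Fin m → Ω, (∏ s, P (ω s)) * (∑ s, f (ω s) + b) ^ 2 = m * σ + b ^ 2 := by
  induction m generalizing b with
  | zero => simp
  | succ m ih =>
    rw [← (Fin.consEquiv fun _ : Fin (m + 1) => Ω).sum_comp, Fintype.sum_prod_type]
    simp only [Fin.consEquiv, Equiv.coe_fn_mk, Fin.prod_univ_succ, Fin.sum_univ_succ,
      Fin.cons_zero, Fin.cons_succ]
    have : ∀ x, ∑ ω : Fin m → Ω,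
        P x * (∏ s, P (ω s)) * (f x + ∑ s, f (ω s) + b) ^ 2
          = P x * (m * σ + b ^ 2) + 2 * b * (P x * f x) + P x * f x ^ 2 := by
      intro x
      have h := ih (f x + b)
      calc _ = P x * ∑ ω : Fin m → Ω, (∏ s, P (ω s)) * (∑ s, f (ω s) + (f x + b)) ^ 2 := by
            rw [mul_sum]
            refine sum_congr rfl fun ω _ => ?_
            ring
        _ = _ := by rw [h]; ring
    simp_rw [this, sum_add_distrib, ← sum_mul, ← mul_sum]
    rw [hP, hf, hσ]
    push_cast
    ring

/-- The mean square error of the smoothed empirical frequency of an event. -/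
theorem sum_prod_sq_frequency {P : Ω → ℝ} (hP : ∑ x, P x = 1) (E : Ω → Prop) [DecidablePred E]
    {q : ℝ}
    (hq : ∑ x, P x * (if E x then 1 else 0) = q) (m : ℕ) {k : ℝ} (hk : 0 < k) :
    ∑ ω : Fin m → Ω, (∏ s, P (ω s)) *
        ((((univ.filter fun s => E (ω s)).card : ℝ) + 1) / (m + k) - q) ^ 2
      = (m * (q - q ^ 2) + (1 - k * q) ^ 2) / (m + k) ^ 2 := by
  have hmk : (m : ℝ) + k ≠ 0 := by positivity
  -- The numerator of the error is count + 1 − q(m + k) = Σ (1_E − q) + (1 − kq): a centred sum plus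
  -- the bias 1 − kq.
  have h := sum_prod_sq_sum_add (P := P) (f := fun x => (if E x then 1 else 0) - q)
    (σ := q - q ^ 2) hP
    (by simp_rw [mul_sub, sum_sub_distrib, ← sum_mul]; rw [hq, hP]; ring)
    (by
      have : ∀ x, P x * ((if E x then 1 else 0) - q) ^ 2
          = (1 - 2 * q) * (P x * (if E x then 1 else 0)) + q ^ 2 * P x := by
        intro x
        split_ifs <;> ring
      simp_rw [this, sum_add_distrib, ← mul_sum]
      rw [hq, hP]; ring) m (1 - k * q)
  rw [← h, sum_div]
  refine sum_congr rfl fun ω _ => ?_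
  have hc : ((univ.filter fun s => E (ω s)).card : ℝ)
      = ∑ s, ((if E (ω s) then (1 : ℝ) else 0) - q) + m * q := by
    simp [sum_sub_distrib]
  rw [hc]
  field_simp
  ring

open Classical in
/-- Markov's inequality. -/
theorem two_thirds_le_of_expectation_le {W Z : Ω → ℝ} (hW : ∀ ω, 0 ≤ W ω) (hW1 : ∑ ω, W ω = 1)
    (hZ : ∀ ω, 0 ≤ Z ω) {θ : ℝ} (hθ : 0 < θ) (h : ∑ ω, W ω * Z ω ≤ θ / 3) {E : Ω → Prop}
    (hE : ∀ ω, Z ω < θ → E ω) : 2 / 3 ≤ ∑ ω ∈ univ.filter E, W ω := by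
  have h1 : ∑ ω, W ω - ∑ ω, W ω * Z ω / θ ≤ ∑ ω ∈ univ.filter E, W ω := by
    rw [← sum_sub_distrib, sum_filter]
    refine sum_le_sum fun ω _ => ?_
    split_ifs with hω
    · have : 0 ≤ W ω * Z ω / θ := div_nonneg (mul_nonneg (hW _) (hZ _)) hθ.le
      linarith
    · have : θ ≤ Z ω := not_lt.1 fun h => hω (hE ω h)
      have : W ω ≤ W ω * Z ω / θ := by
        rw [le_div_iff₀ hθ]
        exact mul_le_mul_of_nonneg_left this (hW _)
      linarith
  rw [hW1, ← sum_div] at h1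
  have h2 : (∑ ω, W ω * Z ω) / θ ≤ 1 / 3 := by
    rw [div_le_iff₀ hθ]
    linarith
  linarith

end Independent

/-! ### Interventional samples -/

namespace CBN

variable {V U A : Type*} [Fintype V] [DecidableEq V] [Fintype U] [Fintype A] {G : SMCG V U}
  {ρ : V → ℕ}

theorem doProb_nonneg (X : SMBN G A) (I : Intervention V A) (v : V → A) : 0 ≤ X.doProb I v := by
  by_cases h : ∀ i a, I i = some a → v i = a
  · rw [X.doProb_eq I v h]
    exact X.cFactor_nonneg _ _
  · rw [CBN.doProb, if_neg h]

theorem sum_doProb_mul (X : SMBN G A) (I : Intervention V A) {v : V → A}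
    (hv : ∀ i a, I i = some a → v i = a) (g : (V → A) → ℝ) :
    ∑ x, X.doProb I x * g x = sumOver I.free (fun x => X.cFactor I.free x * g x) v := by
  classical
  unfold sumOver
  rw [sum_filter]
  refine sum_congr rfl fun x _ => ?_
  have hiff : (∀ i, i ∉ I.free → x i = v i) ↔ ∀ i a, I i = some a → x i = a := by
    constructor
    · intro h i a hia
      rw [h i (by simp [Intervention.free, hia]), hv i a hia]
    · intro h i hi
      simp only [Intervention.free, mem_filter, mem_univ, true_and, Option.isNone_iff_eq_none] at hi
      obtain ⟨a, ha⟩ := Option.ne_none_iff_exists'.1 hi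
      rw [h i a ha, hv i a ha]
  by_cases h : ∀ i a, I i = some a → x i = a
  · rw [X.doProb_eq I x h, if_pos (hiff.2 h)]
  · rw [CBN.doProb, if_neg h, if_neg (fun h' => h (hiff.1 h')), zero_mul]

theorem sum_doProb (X : SMBN G A) (hρ : G.IsTopological ρ) [Nonempty A] (I : Intervention V A) :
    ∑ x, X.doProb I x = 1 := by
  obtain ⟨a⟩ := ‹Nonempty A›
  have := X.sum_doProb_mul I (v := fun i => (I i).getD a) (fun i b h => by simp [h]) (fun _ => 1)
  simp only [mul_one] at this
  rw [this, X.sumOver_cFactor_self hρ]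

/-- If all parents of `S` and no vertices of `S` are intervened on, then the marginal distribution
of `S` is its c-factor. -/
theorem sum_doProb_mul_indicator [DecidableEq A] (X : SMBN G A) (hρ : G.IsTopological ρ)
    {I : Intervention V A}
    {S : Finset V} {v : V → A} (hS : ∀ i ∈ S, I i = none)
    (hpa : ∀ i ∈ G.pa S, I i = some (v i)) :
    ∑ x, X.doProb I x * (if ∀ i ∈ S, x i = v i then 1 else 0) = X.cFactor S v := by
  -- `v₀` agrees with v on S ∪ Pa(S) and obeys the intervention everywhere, as `sum_doProb_mul`
  -- demands; v itself need not.
  let v₀ : V → A := fun i => (I i).getD (v i)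
  have hv₀ : ∀ i ∈ S ∪ G.pa S, v₀ i = v i := by
    intro i hi
    rcases mem_union.1 hi with hi | hi
    · simp [v₀, hS i hi]
    · simp [v₀, hpa i hi]
  have hfree : S ∪ I.free \ S = I.free := union_sdiff_of_subset fun i hi => by
    simp [Intervention.free, hS i hi]
  have hd : Disjoint S (I.free \ S) := disjoint_sdiff
  have hg : DependsOn (fun x : V → A => if ∀ i ∈ S, x i = v i then (1 : ℝ) else 0)
      (S : Set V) := by
    intro x y hxy
    have : (∀ i ∈ S, x i = v i) ↔ ∀ i ∈ S, y i = v i :=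
      forall₂_congr fun i hi => by rw [hxy i hi]
    simp only [this]
  rw [X.sum_doProb_mul I (v := v₀) (fun i a h => by simp [v₀, h])]
  calc sumOver I.free (fun x => X.cFactor I.free x * if ∀ i ∈ S, x i = v i then 1 else 0) v₀
      = sumOver S (sumOver (I.free \ S) fun x =>
          (if ∀ i ∈ S, x i = v i then 1 else 0) * X.cFactor (S ∪ I.free \ S) x) v₀ := by
        rw [← sumOver_union hd, hfree]
        exact sumOver_congr fun w _ => mul_comm _ _
    _ = sumOver S (fun x => (if ∀ i ∈ S, x i = v i then 1 else 0) * X.cFactor S x) v₀ := by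
        refine sumOver_congr fun w _ => ?_
        rw [sumOver_mul_left hg hd, X.sumOver_cFactor hρ hd]
        intro i hi x hx he
        simp only [mem_sdiff, Intervention.free, mem_filter, mem_univ, true_and,
          Option.isNone_iff_eq_none] at hi
        have := hpa i (by
          simp only [SMCG.pa, mem_filter, mem_univ, true_and]
          exact ⟨hi.2, x, hx, he⟩)
        rw [hi.1] at this
        cases this
    _ = X.cFactor S v₀ := by
        rw [sumOver_eq_single, if_pos fun i hi => hv₀ i (mem_union_left _ hi), one_mul]
        intro w hw hne
        rw [if_neg, zero_mul]
        intro h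
        refine hne (funext fun i => ?_)
        by_cases hi : i ∈ S
        · rw [h i hi, hv₀ i (mem_union_left _ hi)]
        · exact hw i hi
    _ = X.cFactor S v := X.dependsOn_cFactor S fun i hi => hv₀ i hi

end CBN

/-! ### Estimated c-factors -/

section Counts

variable {V U A : Type*} [Fintype V] [DecidableEq V] [Fintype U] [Fintype A] [DecidableEq A]
  {G : SMCG V U} {ρ : V → ℕ} {N m : ℕ}

/-- The number of samples in which the vertices of `R` have their values in `v`, among those drawn
under the intervention that is chosen for `S` and `v`. -/
def sampleCount (pick : Finset V → (V → A) → Fin N) (ω : Fin N → Fin m → V → A) (S R : Finset V)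
    (v : V → A) : ℕ :=
  (univ.filter fun t => ∀ j ∈ R, ω (pick S v) t j = v j).card

/-- The smoothed empirical estimate of the c-factor of `S`. -/
noncomputable def smoothedFactor (pick : Finset V → (V → A) → Fin N) (ω : Fin N → Fin m → V → A)
    (S : Finset V) (v : V → A) : ℝ :=
  (sampleCount pick ω S S v + 1) / (m + (Fintype.card A : ℝ) ^ S.card)

/-- The interventions chosen by `pick` isolate the sets of `𝒮`: they set the parents and leave
the set itself free. -/
structure Isolates (G : SMCG V U) (I : Fin N → Intervention V A) (𝒮 : Finset (Finset V))
    (pick : Finset V → (V → A) → Fin N) : Prop where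
  dependsOn : ∀ S, DependsOn (pick S) (G.pa S : Set V)
  free : ∀ S ∈ 𝒮, ∀ v, ∀ i ∈ S, I (pick S v) i = none
  set : ∀ S ∈ 𝒮, ∀ v, ∀ i ∈ G.pa S, I (pick S v) i = some (v i)

variable {I : Fin N → Intervention V A} {𝒮 : Finset (Finset V)} {pick : Finset V → (V → A) → Fin N}

theorem smoothedFactor_pos [Nonempty A] (ω : Fin N → Fin m → V → A) (S : Finset V) (v : V → A) :
    0 < smoothedFactor pick ω S v := by
  have : 0 < Fintype.card A := Fintype.card_pos
  unfold smoothedFactor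
  positivity

theorem dependsOn_smoothedFactor (hI : Isolates G I 𝒮 pick) (ω : Fin N → Fin m → V → A)
    (S : Finset V) :
    DependsOn (smoothedFactor pick ω S) ((S ∪ G.pa S : Finset V) : Set V) := by
  intro v w h
  have hp : pick S v = pick S w := hI.dependsOn S fun i hi => h i (by
    rw [mem_coe] at hi
    simp [hi])
  have hc : sampleCount pick ω S S v = sampleCount pick ω S S w := by
    unfold sampleCount
    rw [hp]
    congr 1
    refine filter_congr fun t _ => forall₂_congr fun j hj => ?_
    rw [h j (by simp [hj])]
  rw [smoothedFactor, smoothedFactor, hc]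

/-- As i ∈ S is no parent of S, changing its value does not change the chosen intervention. The
counts for the different values of i thus come from the same samples and partition those counted for
S∖i. -/
theorem sum_smoothedFactor_update (hI : Isolates G I 𝒮 pick) (ω : Fin N → Fin m → V → A)
    {S : Finset V} {i : V} (hi : i ∈ S) (v : V → A) :
    ∑ a, smoothedFactor pick ω S (Function.update v i a)
      = (sampleCount pick ω S (S.erase i) v + Fintype.card A)
          / (m + (Fintype.card A : ℝ) ^ S.card) := by
  unfold smoothedFactor
  rw [← sum_div]
  congr 1
  rw [sum_add_distrib, sum_const, nsmul_eq_mul, mul_one, card_univ]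
  congr 1
  rw [← Nat.cast_sum]
  congr 1
  have hp : ∀ a, pick S (Function.update v i a) = pick S v := fun a =>
    hI.dependsOn S fun j hj => Function.update_of_ne (by
      rintro rfl
      exact disjoint_left.1 (disjoint_pa G S) hi hj) _ _
  unfold sampleCount
  simp_rw [hp]
  rw [card_eq_sum_card_fiberwise (f := fun t => ω (pick S v) t i) (t := univ) (by simp)]
  refine sum_congr rfl fun a _ => ?_
  congr 1
  ext t
  simp only [mem_filter, mem_univ, true_and]
  constructor
  · intro h
    refine ⟨fun j hj => ?_, by simpa using h i hi⟩
    simpa [(mem_erase.1 hj).1] using h j (mem_erase.1 hj).2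
  · rintro ⟨h1, h2⟩ j hj
    by_cases hji : j = i
    · subst hji; simpa using h2
    · simpa [hji] using h1 j (mem_erase.2 ⟨hji, hj⟩)

/-- The normalisation of the frequencies cancels and leaves a ratio of integers, which the machine
can compute exactly. -/
theorem condOf_smoothedFactor [Nonempty A] (hI : Isolates G I 𝒮 pick) (ω : Fin N → Fin m → V → A)
    {S : Finset V} {i : V} (hi : i ∈ S) (v : V → A) :
    condOf (smoothedFactor pick ω) S i v
      = (sampleCount pick ω S S v + 1 : ℕ) /
          (sampleCount pick ω S (S.erase i) v + Fintype.card A : ℕ) := by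
  have : 0 < Fintype.card A := Fintype.card_pos
  rw [condOf, sum_smoothedFactor_update hI ω hi, smoothedFactor, div_div_div_cancel_right₀]
  · push_cast; rfl
  · positivity

/-- The expected square error of the estimated c-factor. -/
theorem expectation_sq_smoothedFactor_sub (X : SMBN G A) (hρ : G.IsTopological ρ) [Nonempty A]
    (hI : Isolates G I 𝒮 pick) {S : Finset V} (hS : S ∈ 𝒮) (v : V → A) :
    ∑ ω : Fin N → Fin m → V → A, (∏ j, ∏ s, X.doProb (I j) (ω j s))
        * (smoothedFactor pick ω S v - X.cFactor S v) ^ 2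
      = (m * (X.cFactor S v - X.cFactor S v ^ 2)
          + (1 - (Fintype.card A : ℝ) ^ S.card * X.cFactor S v) ^ 2)
          / (m + (Fintype.card A : ℝ) ^ S.card) ^ 2 := by
  have hA : (0 : ℝ) < Fintype.card A := by exact_mod_cast Fintype.card_pos
  rw [← sum_prod_sq_frequency (X.sum_doProb hρ (I (pick S v))) (fun x => ∀ i ∈ S, x i = v i)
    (X.sum_doProb_mul_indicator hρ (hI.free S hS v) (hI.set S hS v)) m (pow_pos hA S.card)]
  have := sum_prod_mul_apply (ι := Fin N) (Ω := Fin m → V → A)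
    (w := fun j r => ∏ s, X.doProb (I j) (r s))
    (fun j => sum_prod_eq_one fun _ => X.sum_doProb hρ _) (pick S v)
    (fun r => ((((univ.filter fun s => ∀ i ∈ S, r s i = v i).card : ℝ) + 1)
      / (m + (Fintype.card A : ℝ) ^ S.card) - X.cFactor S v) ^ 2)
  refine Eq.trans ?_ (this.trans ?_)
  · refine sum_congr rfl fun ω _ => ?_
    congr 1
  · refine sum_congr rfl fun r _ => ?_
    congr! 7

/-- For fixed values of the parents the square errors are summed over all values of S. Since the
c-factor q sums to 1, the variances q − q² contribute at most m, and with k = |A|^|S| the total is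
at most (m + k² − k)/m². The hypothesis k² ≤ m brings this below 2/m, whatever the size of S; the
parents only multiply the number of terms. -/
theorem sumOver_expectation_le (X : SMBN G A) (hρ : G.IsTopological ρ) [Nonempty A]
    (hI : Isolates G I 𝒮 pick) {S : Finset V} (hS : S ∈ 𝒮)
    (hm : ((Fintype.card A : ℝ) ^ S.card) ^ 2 ≤ m) (v : V → A) :
    ∑ ω : Fin N → Fin m → V → A, (∏ j, ∏ s, X.doProb (I j) (ω j s))
        * sumOver (S ∪ G.pa S) (fun w => (smoothedFactor pick ω S w - X.cFactor S w) ^ 2) v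
      ≤ (Fintype.card A : ℝ) ^ (G.pa S).card * (2 / m) := by
  have hA : (0 : ℝ) < Fintype.card A := by exact_mod_cast Fintype.card_pos
  set k : ℝ := (Fintype.card A : ℝ) ^ S.card with hk
  have hk0 : 0 < k := by positivity
  have hm0 : (0 : ℝ) < m := lt_of_lt_of_le (by positivity) hm
  have h1 : ∑ ω : Fin N → Fin m → V → A, (∏ j, ∏ s, X.doProb (I j) (ω j s))
        * sumOver (S ∪ G.pa S) (fun w => (smoothedFactor pick ω S w - X.cFactor S w) ^ 2) v
      = sumOver (S ∪ G.pa S) (fun w => (m * (X.cFactor S w - X.cFactor S w ^ 2)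
          + (1 - k * X.cFactor S w) ^ 2) / (m + k) ^ 2) v := by
    calc _ = sumOver (S ∪ G.pa S) (fun w => ∑ ω : Fin N → Fin m → V → A,
            (∏ j, ∏ s, X.doProb (I j) (ω j s))
              * (smoothedFactor pick ω S w - X.cFactor S w) ^ 2) v := by
          rw [sumOver_sum]
          refine sum_congr rfl fun ω _ => ?_
          unfold sumOver
          rw [mul_sum]
      _ = _ := sumOver_congr fun w _ => expectation_sq_smoothedFactor_sub X hρ hI hS w
  rw [h1, union_comm, sumOver_union (disjoint_pa G S).symm, ← sumOver_const _ _ v]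
  refine sumOver_mono fun w _ => ?_
  calc sumOver S (fun w => (m * (X.cFactor S w - X.cFactor S w ^ 2)
          + (1 - k * X.cFactor S w) ^ 2) / (m + k) ^ 2) w
      ≤ sumOver S (fun w => X.cFactor S w * ((m + k ^ 2 - 2 * k) / m ^ 2) + 1 / m ^ 2) w := by
        refine sumOver_mono fun w _ => ?_
        have hq0 := X.cFactor_nonneg S w
        have hq1 := X.cFactor_le_one hρ S w
        set q := X.cFactor S w
        have hqq : 0 ≤ q - q ^ 2 := by nlinarith
        have h0 : 0 ≤ m * (q - q ^ 2) + (1 - k * q) ^ 2 := by positivity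
        calc (m * (q - q ^ 2) + (1 - k * q) ^ 2) / (m + k) ^ 2
            ≤ (m * (q - q ^ 2) + (1 - k * q) ^ 2) / m ^ 2 :=
              div_le_div_of_nonneg_left h0 (by positivity) (by gcongr; linarith)
          _ ≤ (q * (m + k ^ 2 - 2 * k) + 1) / m ^ 2 := by
              refine div_le_div_of_nonneg_right ?_ (by positivity)
              have h1 : 0 ≤ k ^ 2 * (q - q ^ 2) := by positivity
              have h2 : 0 ≤ m * q ^ 2 := by positivity
              nlinarith
          _ = _ := by ring
    _ = (m + k ^ 2 - 2 * k) / m ^ 2 + k * (1 / m ^ 2) := by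
        rw [sumOver_add, sumOver_const]
        congr 1
        have := X.sumOver_cFactor_self hρ S w
        unfold sumOver at this ⊢
        rw [← sum_mul, this, one_mul]
    _ = (m + k ^ 2 - k) / m ^ 2 := by ring
    _ ≤ (2 * m) / m ^ 2 := by
        refine div_le_div_of_nonneg_right ?_ (by positivity)
        linarith
    _ = 2 / m := by
        field_simp

end Counts

/-! ### c-components -/

namespace SMCG

variable {V U : Type*} [Fintype V]

open Classical in
/-- The c-component of `a` in `G[X]`. -/
noncomputable def componentIn (G : SMCG V U) (X : Finset V) (a : V) : Finset V :=
  X.filter fun b => G.ConnectedIn X a b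

open Classical in
/-- The subsets of the c-components of `G`. -/
noncomputable def districtSubsets (G : SMCG V U) : Finset (Finset V) :=
  (G.cComponents univ).biUnion powerset

variable {G : SMCG V U}

theorem ConnectedIn.symm {X : Finset V} {a b : V} (h : G.ConnectedIn X a b) :
    G.ConnectedIn X b a := by
  induction h with
  | refl => exact .refl
  | tail _ h ih =>
    obtain ⟨hx, hy, hne, u, hux, huy⟩ := h
    exact .head ⟨hy, hx, hne.symm, u, huy, hux⟩ ih

theorem ConnectedIn.mono {X Y : Finset V} (hXY : X ⊆ Y) {a b : V} (h : G.ConnectedIn X a b) :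
    G.ConnectedIn Y a b := by
  induction h with
  | refl => exact .refl
  | tail _ h ih => exact ih.tail ⟨hXY h.1, hXY h.2.1, h.2.2⟩

theorem mem_componentIn {X : Finset V} {a b : V} :
    b ∈ G.componentIn X a ↔ b ∈ X ∧ G.ConnectedIn X a b := by
  simp [componentIn]

theorem componentIn_eq_iff {X : Finset V} {a b : V} (hb : b ∈ X) :
    G.componentIn X a = G.componentIn X b ↔ G.ConnectedIn X a b := by
  constructor
  · intro h
    have : b ∈ G.componentIn X a := by
      rw [h, mem_componentIn]
      exact ⟨hb, .refl⟩
    exact (mem_componentIn.1 this).2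
  · intro h
    ext x
    rw [mem_componentIn, mem_componentIn]
    exact and_congr_right fun _ => ⟨fun hx => h.symm.trans hx, fun hx => h.trans hx⟩

theorem componentIn_eq_of_bidirected {X : Finset V} {a b : V} (ha : a ∈ X) (hb : b ∈ X)
    (h : G.Bidirected a b) : G.componentIn X a = G.componentIn X b :=
  (componentIn_eq_iff hb).2 (.single ⟨ha, hb, h⟩)

theorem componentIn_subset_of_subset {X Y : Finset V} (hXY : X ⊆ Y) (a : V) :
    G.componentIn X a ⊆ G.componentIn Y a := fun b hb => by
  rw [mem_componentIn] at hb ⊢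
  exact ⟨hXY hb.1, hb.2.mono hXY⟩

theorem mem_districtSubsets {S : Finset V} :
    S ∈ G.districtSubsets ↔ ∃ a, S ⊆ G.componentIn univ a := by
  simp [districtSubsets, cComponents, componentIn]

theorem componentIn_mem_districtSubsets (X : Finset V) (a : V) :
    G.componentIn X a ∈ G.districtSubsets :=
  mem_districtSubsets.2 ⟨a, componentIn_subset_of_subset (subset_univ _) a⟩

variable {d l : ℕ}

theorem InClass.card_componentIn_le (hG : G.InClass d l) (a : V) :
    (G.componentIn univ a).card ≤ l := by
  classical
  exact hG.2 _ (mem_image.2 ⟨a, mem_univ _, rfl⟩)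

theorem InClass.card_le (hG : G.InClass d l) {S : Finset V} (hS : S ∈ G.districtSubsets) :
    S.card ≤ l := by
  obtain ⟨a, ha⟩ := mem_districtSubsets.1 hS
  exact (card_le_card ha).trans (hG.card_componentIn_le a)

theorem InClass.one_le [Nonempty V] (hG : G.InClass d l) : 1 ≤ l := by
  obtain ⟨a⟩ := ‹Nonempty V›
  refine le_trans ?_ (hG.card_componentIn_le a)
  exact card_pos.2 ⟨a, mem_componentIn.2 ⟨mem_univ _, .refl⟩⟩

theorem InClass.card_pa_le_mul (hG : G.InClass d l) (S : Finset V) :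
    (G.pa S).card ≤ S.card * d := by
  classical
  have : G.pa S ⊆ S.biUnion fun x => univ.filter fun y : V => G.edge (Sum.inl y) (Sum.inl x) := by
    intro y hy
    simp only [pa, mem_filter, mem_univ, true_and] at hy
    obtain ⟨_, x, hx, he⟩ := hy
    simp only [mem_biUnion, mem_filter, mem_univ, true_and]
    exact ⟨x, hx, he⟩
  refine (card_le_card this).trans (card_biUnion_le_card_mul _ _ _ fun x _ => ?_)
  refine le_trans (le_of_eq ?_) (hG.1 x)
  unfold inDegree
  congr!

theorem InClass.card_pa_le (hG : G.InClass d l) {S : Finset V} (hS : S ∈ G.districtSubsets) :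
    (G.pa S).card ≤ l * d :=
  (hG.card_pa_le_mul S).trans (Nat.mul_le_mul_right d (hG.card_le hS))

theorem InClass.card_districtSubsets_le (hG : G.InClass d l) :
    G.districtSubsets.card ≤ Fintype.card V * 2 ^ l := by
  classical
  unfold districtSubsets
  refine (card_biUnion_le_card_mul _ _ (2 ^ l) fun S hS => ?_).trans ?_
  · rw [card_powerset]
    exact Nat.pow_le_pow_right (by norm_num) (hG.2 S hS)
  · exact Nat.mul_le_mul_right _ card_image_le

end SMCG

/-! ### Accuracy of the oracle -/

section Accuracy

variable {V U A : Type*} [Fintype V] [DecidableEq V] [Fintype U] [Fintype A] {G : SMCG V U}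

namespace Intervention

theorem fill_of_eq_some {I : Intervention V A} {w : {i // i ∈ I.free} → A} {i : V} {a : A}
    (h : I i = some a) : I.fill w i = a := by
  unfold fill
  split
  · next b hb => rw [h] at hb; exact (Option.some.inj hb).symm
  · next hb => rw [h] at hb; cases hb

theorem fill_of_mem_free {I : Intervention V A} {w : {i // i ∈ I.free} → A} {i : V}
    (h : i ∈ I.free) : I.fill w i = w ⟨i, h⟩ := by
  have h' : I i = none := by simpa [free] using h
  unfold fill
  split
  · next b hb => rw [h'] at hb; cases hb
  · rfl

theorem sum_fill (I : Intervention V A) {v : V → A} (hv : ∀ i a, I i = some a → v i = a)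
    (f : (V → A) → ℝ) : ∑ w, f (I.fill w) = sumOver I.free f v := by
  classical
  unfold sumOver
  refine sum_bij' (fun w _ => I.fill w) (fun x _ i => x i.1) ?_ (by simp) ?_ ?_ (by simp)
  · intro w _
    simp only [mem_filter, mem_univ, true_and]
    intro i hi
    simp only [free, mem_filter, mem_univ, true_and, Option.isNone_iff_eq_none] at hi
    obtain ⟨a, ha⟩ := Option.ne_none_iff_exists'.1 hi
    rw [fill_of_eq_some ha, hv i a ha]
  · intro w _
    funext i
    exact fill_of_mem_free i.2
  · intro x hx
    simp only [mem_filter, mem_univ, true_and] at hx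
    funext i
    by_cases hi : i ∈ I.free
    · exact fill_of_mem_free hi
    · have hi' := hi
      simp only [free, mem_filter, mem_univ, true_and, Option.isNone_iff_eq_none] at hi'
      obtain ⟨a, ha⟩ := Option.ne_none_iff_exists'.1 hi'
      rw [fill_of_eq_some ha, hx i hi, hv i a ha]

end Intervention

theorem CBN.doProbFree_eq (X : SMBN G A) (I : Intervention V A) (w : {i // i ∈ I.free} → A) :
    X.doProbFree I w = X.cFactor I.free (I.fill w) :=
  X.doProb_eq I _ fun _ _ h => Intervention.fill_of_eq_some h

/-- The table `q` multiplies the conditional distributions `c` along the order `ρ`. -/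
def LocalTable.IsProductOf (q : LocalTable G A) (ρ : V → ℕ) (c : Finset V → V → (V → A) → ℝ) :
    Prop :=
  ∀ S ∈ G.districtSubsets, ∀ v : V → A,
    q S (fun y => v y.1) (fun x => v x.1) = ∏ i ∈ S, c (S.filter fun j => ρ j ≤ ρ i) i v

variable {ρ : V → ℕ}

/-- Grouping the free vertices by their component in G[V∖T] turns the oracle's product over
components into one product over vertices. Inside a component the predecessors of a vertex are
exactly its `lowerClass`. -/
theorem LocalTable.oracle_eq {q : LocalTable G A} {c : Finset V → V → (V → A) → ℝ}
    (hq : q.IsProductOf ρ c) (I : Intervention V A) (w : {i // i ∈ I.free} → A) :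
    q.oracle I w = kernelProd ρ (G.componentIn I.free) c I.free (I.fill w) := by
  classical
  unfold LocalTable.oracle kernelProd
  have hcc : G.cComponents I.free = I.free.image (G.componentIn I.free) := by
    ext S
    simp [SMCG.cComponents, SMCG.componentIn]
  rw [hcc]
  have hfib : ∀ i ∈ I.free, (I.free.filter fun j => G.componentIn I.free j = G.componentIn I.free i)
      = G.componentIn I.free i := by
    intro i hi
    ext j
    rw [SMCG.mem_componentIn, mem_filter]
    refine and_congr_right fun hj => ?_
    rw [SMCG.componentIn_eq_iff hi]
    exact ⟨fun h => h.symm, fun h => h.symm⟩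
  refine prod_image' _ fun i hi => ?_
  rw [hq _ (SMCG.componentIn_mem_districtSubsets _ _), hfib i hi]
  refine prod_congr rfl fun j hj => ?_
  have hj' := mem_filter.1 ((hfib i hi).symm ▸ hj)
  congr 1
  unfold lowerClass
  rw [← hfib i hi, filter_filter, ← hj'.2]

/-- The assumption does not mention the intervention, so one event covers all of them. The sets that
occur are subsets of components of G[V∖T], hence of c-components of G. -/
theorem LocalTable.isAccurate_of_sum_sq_lt (X : SMBN G A) (hρ : G.IsTopological ρ) [Nonempty A]
    {h : Finset V → (V → A) → ℝ} (hpos : ∀ S v, 0 < h S v)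
    (hdep : ∀ S, DependsOn (h S) ((S ∪ G.pa S : Finset V) : Set V))
    {q : LocalTable G A} (hq : q.IsProductOf ρ (condOf h)) {D : ℕ}
    (hD : ∀ S ∈ G.districtSubsets, (S ∪ G.pa S).card ≤ D) {ε : ℝ} (hε : 0 < ε)
    (hZ : ∀ v, (Fintype.card V * (Fintype.card A : ℝ) ^ D) * ∑ S ∈ G.districtSubsets,
      sumOver (S ∪ G.pa S) (fun w => (h S w - X.cFactor S w) ^ 2) v < ε ^ 2) :
    q.IsAccurate X ε := by
  classical
  intro I
  obtain ⟨v, hv⟩ : ∃ v : V → A, ∀ i a, I i = some a → v i = a := by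
    obtain ⟨a⟩ := ‹Nonempty A›
    exact ⟨fun i => (I i).getD a, fun i b h => by simp [h]⟩
  have hc : IsKernelFamily G ρ (condOf h) := isKernelFamily_condOf hpos hdep
  have ho := funext (LocalTable.oracle_eq hq I)
  refine ⟨⟨fun w => ?_, ?_⟩, ?_⟩
  · rw [LocalTable.oracle_eq hq]
    exact kernelProd_nonneg hc _ _
  · rw [ho]
    have := I.sum_fill hv (kernelProd ρ (G.componentIn I.free) (condOf h) I.free)
    rw [sumOver_kernelProd hρ hc] at this
    convert this
  · have h1 : tvDist (X.doProbFree I) (q.oracle I) = 1 / 2 * sumOver I.free (fun x =>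
        |X.cFactor I.free x - kernelProd ρ (G.componentIn I.free) (condOf h) I.free x|) v := by
      rw [← I.sum_fill hv, ho, tvDist]
      congr 1
      refine sum_congr (by congr!) fun w _ => ?_
      rw [CBN.doProbFree_eq]
    suffices hlt : tvDist (X.doProbFree I) (q.oracle I) < ε by convert hlt
    rw [h1]
    have h2 := sq_sumOver_abs_cFactor_sub_le X hρ hpos hdep I.free
      (κ := G.componentIn I.free) (𝒮 := G.districtSubsets)
      (fun x hx y hy hxy => SMCG.componentIn_eq_of_bidirected hx hy hxy)
      (fun i hi => SMCG.mem_districtSubsets.2 ⟨i, fun j hj => ?_⟩) hD v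
    · have h3 := hZ v
      refine lt_of_pow_lt_pow_left₀ 2 hε.le ?_
      -- The square of the 1/2 in the total variation distance cancels the factor 4.
      rw [mul_pow]
      linarith
    · have := (mem_filter.1 hj)
      rw [SMCG.componentIn_eq_iff hi] at this
      exact SMCG.mem_componentIn.2 ⟨mem_univ _, this.2.1.symm.mono (subset_univ _)⟩

end Accuracy

/-! ### Straight-line programs -/

namespace RAM

/-- The instruction is not a jump. -/
def Instr.IsStraight (i : Instr) : Prop := ∀ m pc, newPc m pc i = pc + 1

/-- The memory after a straight-line program. -/
def runMem (m : ℕ → ℕ) : List Instr → ℕ → ℕ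
  | [] => m
  | i :: p => runMem (newMem m i) p

/-- The cost of a straight-line program. -/
def runCost (m : ℕ → ℕ) : List Instr → ℕ
  | [] => 0
  | i :: p => cost m i + runCost (newMem m i) p

theorem runMem_append (m : ℕ → ℕ) (p q : List Instr) :
    runMem m (p ++ q) = runMem (runMem m p) q := by
  induction p generalizing m with
  | nil => rfl
  | cons i p ih => exact ih _

theorem runCost_append (m : ℕ → ℕ) (p q : List Instr) :
    runCost m (p ++ q) = runCost m p + runCost (runMem m p) q := by
  induction p generalizing m with
  | nil => simp [runCost, runMem]
  | cons i p ih => simp [runCost, runMem, ih, add_assoc]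

/-- The instructions already executed are kept as a prefix p, so that the induction can advance the
program counter within one fixed program. -/
theorem iterate_step (p q : List Instr) (hq : ∀ i ∈ q, i.IsStraight) (m : ℕ → ℕ) (t : ℕ) :
    (step (p ++ q))^[q.length] ⟨p.length, m, t⟩
      = ⟨p.length + q.length, runMem m q, t + runCost m q⟩ := by
  induction q generalizing p m t with
  | nil => simp [runMem, runCost]
  | cons i q ih =>
    have hs : step (p ++ i :: q) ⟨p.length, m, t⟩
        = ⟨p.length + 1, newMem m i, t + cost m i⟩ := by
      simp [step, hq i (by simp) m p.length]
    rw [List.length_cons, Function.iterate_succ_apply, hs]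
    have := ih (p ++ [i]) (fun j hj => hq j (by simp [hj])) (newMem m i) (t + cost m i)
    simp only [List.append_assoc, List.singleton_append, List.length_append, List.length_cons,
      List.length_nil, zero_add] at this
    rw [this]
    simp only [runMem, runCost, Config.mk.injEq, true_and]
    omega

/-- Without jumps every instruction runs exactly once, so termination is automatic. Unrolling all
loops is affordable because storing the program costs only one unit per instruction. -/
theorem haltsAt_of_straight {p : List Instr} (hp : ∀ i ∈ p, i.IsStraight) (m : ℕ → ℕ) :
    HaltsAt p ⟨0, m, 0⟩ ⟨p.length, runMem m p, runCost m p⟩ := by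
  refine ⟨le_rfl, p.length, ?_⟩
  have := iterate_step [] p hp m 0
  simpa using this

/-! ### Arithmetic expressions -/

/-- Arithmetic expressions over the memory cells. -/
inductive Expr where
  | cell (a : ℕ)
  | const (c : ℕ)
  | add (e f : Expr)
  | sub (e f : Expr)
  | mul (e f : Expr)

namespace Expr

/-- The value of an expression. -/
def eval (m : ℕ → ℕ) : Expr → ℕ
  | cell a => m a
  | const c => c
  | add e f => eval m e + eval m f
  | sub e f => eval m e - eval m f
  | mul e f => eval m e * eval m f

/-- A straight-line program that writes the value of the expression to the cell `dst`, with the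
cells after `dst` as a stack. -/
def compile : Expr → ℕ → List Instr
  -- There is no move instruction: the target is cleared and the source added. This needs a ≠ `dst`,
  -- which `CellsLT` guarantees.
  | cell a, dst => [.const dst 0, .add dst a dst]
  | const c, dst => [.const dst c]
  | add e f, dst => compile e dst ++ (compile f (dst + 1) ++ [.add dst dst (dst + 1)])
  | sub e f, dst => compile e dst ++ (compile f (dst + 1) ++ [.sub dst dst (dst + 1)])
  | mul e f, dst => compile e dst ++ (compile f (dst + 1) ++ [.mul dst dst (dst + 1)])

/-- The number of instructions of the compiled expression. -/
def length : Expr → ℕ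
  | cell _ => 2
  | const _ => 1
  | add e f => length e + length f + 1
  | sub e f => length e + length f + 1
  | mul e f => length e + length f + 1

/-- All cells of the expression lie below `b`. -/
def CellsLT (b : ℕ) : Expr → Prop
  | cell a => a < b
  | const _ => True
  | add e f => CellsLT b e ∧ CellsLT b f
  | sub e f => CellsLT b e ∧ CellsLT b f
  | mul e f => CellsLT b e ∧ CellsLT b f

/-- All intermediate results in the evaluation of the expression are at most `B`. -/
def Bounded (m : ℕ → ℕ) (B : ℕ) : Expr → Prop
  | cell a => m a ≤ B
  | const c => c ≤ B
  | add e f => Bounded m B e ∧ Bounded m B f ∧ eval m e + eval m f ≤ B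
  | sub e f => Bounded m B e ∧ Bounded m B f
  | mul e f => Bounded m B e ∧ Bounded m B f ∧ eval m e * eval m f ≤ B

theorem length_compile (e : Expr) (dst : ℕ) : (e.compile dst).length = e.length := by
  induction e generalizing dst <;> simp [compile, length, *] <;> ring

theorem length_pos (e : Expr) : 0 < e.length := by
  cases e <;> simp [length]

theorem Bounded.eval_le {m : ℕ → ℕ} {B : ℕ} {e : Expr} (h : Bounded m B e) : eval m e ≤ B := by
  induction e with
  | cell a => exact h
  | const c => exact h
  | add e f _ _ => exact h.2.2
  | sub e f he _ => exact (Nat.sub_le _ _).trans (he h.1)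
  | mul e f _ _ => exact h.2.2

theorem CellsLT.mono {b b' : ℕ} (hb : b ≤ b') {e : Expr} (h : CellsLT b e) : CellsLT b' e := by
  induction e with
  | cell a => exact lt_of_lt_of_le h hb
  | const c => trivial
  | add e f he hf => exact ⟨he h.1, hf h.2⟩
  | sub e f he hf => exact ⟨he h.1, hf h.2⟩
  | mul e f he hf => exact ⟨he h.1, hf h.2⟩

theorem eval_congr {b : ℕ} {m m' : ℕ → ℕ} (hm : ∀ a < b, m a = m' a) {e : Expr}
    (h : CellsLT b e) : eval m e = eval m' e := by
  induction e with
  | cell a => exact hm a h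
  | const c => rfl
  | add e f he hf => simp [eval, he h.1, hf h.2]
  | sub e f he hf => simp [eval, he h.1, hf h.2]
  | mul e f he hf => simp [eval, he h.1, hf h.2]

theorem bounded_congr {b B : ℕ} {m m' : ℕ → ℕ} (hm : ∀ a < b, m a = m' a) {e : Expr}
    (h : CellsLT b e) (hB : Bounded m B e) : Bounded m' B e := by
  induction e with
  | cell a =>
    have := hm a h
    simp only [Bounded] at hB ⊢
    omega
  | const c => exact hB
  | add e f he hf =>
    refine ⟨he h.1 hB.1, hf h.2 hB.2.1, ?_⟩
    rw [← eval_congr hm h.1, ← eval_congr hm h.2]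
    exact hB.2.2
  | sub e f he hf => exact ⟨he h.1 hB.1, hf h.2 hB.2⟩
  | mul e f he hf =>
    refine ⟨he h.1 hB.1, hf h.2 hB.2.1, ?_⟩
    rw [← eval_congr hm h.1, ← eval_congr hm h.2]
    exact hB.2.2

theorem isStraight_of_mem_compile {e : Expr} {dst : ℕ} {i : Instr} (hi : i ∈ e.compile dst) :
    i.IsStraight := by
  induction e generalizing dst with
  | cell a =>
    simp only [compile, List.mem_cons, List.not_mem_nil, or_false] at hi
    rcases hi with rfl | rfl <;> exact fun _ _ => rfl
  | const c =>
    simp only [compile, List.mem_cons, List.not_mem_nil, or_false] at hi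
    subst hi
    exact fun _ _ => rfl
  | add e f he hf | sub e f he hf | mul e f he hf =>
    simp only [compile, List.mem_append, List.mem_cons, List.not_mem_nil, or_false] at hi
    rcases hi with hi | hi | rfl
    · exact he hi
    · exact hf hi
    · exact fun _ _ => rfl

/-- The effect of a binary operation after its operands have been computed. -/
theorem runMem_binary {e f : Expr} {dst : ℕ} {m : ℕ → ℕ} (hf : CellsLT dst f)
    (he1 : runMem m (e.compile dst) dst = eval m e)
    (he2 : ∀ a < dst, runMem m (e.compile dst) a = m a)
    (hf1 : ∀ m' : ℕ → ℕ, (∀ a < dst, m' a = m a) →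
      runMem m' (f.compile (dst + 1)) (dst + 1) = eval m' f)
    (hf2 : ∀ m' : ℕ → ℕ, ∀ a < dst + 1, runMem m' (f.compile (dst + 1)) a = m' a) :
    let m₂ := runMem (runMem m (e.compile dst)) (f.compile (dst + 1))
    m₂ dst = eval m e ∧ m₂ (dst + 1) = eval m f ∧ ∀ a < dst, m₂ a = m a := by
  refine ⟨?_, ?_, fun a ha => ?_⟩
  · rw [hf2 _ _ (Nat.lt_succ_self _), he1]
  · rw [hf1 _ he2]
    exact eval_congr he2 hf
  · rw [hf2 _ _ (ha.trans (Nat.lt_succ_self _)), he2 a ha]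

theorem runMem_compile_of_lt {e : Expr} {dst : ℕ} (m : ℕ → ℕ) {a : ℕ} (ha : a < dst) :
    runMem m (e.compile dst) a = m a := by
  induction e generalizing dst m with
  | cell b => simp [compile, runMem, newMem, ha.ne]
  | const c => simp [compile, runMem, newMem, ha.ne]
  | add e f he hf | sub e f he hf | mul e f he hf =>
    simp only [compile, runMem_append, runMem, newMem, Function.update_of_ne ha.ne]
    rw [hf _ (ha.trans (Nat.lt_succ_self _)), he _ ha]

theorem runMem_compile_self {e : Expr} {dst : ℕ} (m : ℕ → ℕ) (h : CellsLT dst e) :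
    runMem m (e.compile dst) dst = eval m e := by
  induction e generalizing dst m with
  | cell b =>
    have hb : b ≠ dst := ne_of_lt h
    simp [compile, runMem, newMem, hb, eval]
  | const c => simp [compile, runMem, newMem, eval]
  | add e f he hf | sub e f he hf | mul e f he hf =>
    have := runMem_binary (e := e) (m := m) h.2 (he m h.1) (fun a ha => runMem_compile_of_lt m ha)
      (fun m' _ => hf m' (h.2.mono (Nat.le_succ _))) (fun m' a ha => runMem_compile_of_lt m' ha)
    simp only [compile, runMem_append, runMem, newMem, Function.update_self, eval]
    rw [this.1, this.2.1]

/-- An instruction handles at most six numbers (three addresses, two operands and the result), each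
at most B, and costs one more unit. -/
theorem runCost_compile_le {e : Expr} {dst B : ℕ} {m : ℕ → ℕ} (h : CellsLT dst e)
    (hB : Bounded m B e) (hdst : dst + e.length ≤ B) :
    runCost m (e.compile dst) ≤ e.length * (1 + 6 * B.size) := by
  induction e generalizing dst m with
  | cell a =>
    simp only [length] at hdst
    have ha : a ≠ dst := ne_of_lt h
    have h1 : dst.size ≤ B.size := Nat.size_le_size (by omega)
    have h2 : a.size ≤ B.size := Nat.size_le_size (by have : a < dst := h; omega)
    have h3 : (m a).size ≤ B.size := Nat.size_le_size hB
    simp only [compile, runCost, cost, newMem, Function.update_self, Function.update_of_ne ha,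
      length, Nat.size_zero, add_zero]
    omega
  | const c =>
    simp only [length] at hdst
    have h1 : dst.size ≤ B.size := Nat.size_le_size (by omega)
    have h3 : c.size ≤ B.size := Nat.size_le_size hB
    simp only [compile, runCost, cost, length]
    omega
  | add e f he hf | mul e f he hf =>
    simp only [length] at hdst
    have hm := fun a (ha : a < dst) => runMem_compile_of_lt (e := e) m ha
    have := runMem_binary (e := e) (m := m) h.2 (runMem_compile_self m h.1) hm
      (fun m' _ => runMem_compile_self m' (h.2.mono (Nat.le_succ _)))
      (fun m' a ha => runMem_compile_of_lt m' ha)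
    have c1 := he h.1 hB.1 (by omega)
    have c2 := hf (dst := dst + 1) (m := runMem m (e.compile dst)) (h.2.mono (Nat.le_succ _))
      (bounded_congr (fun a ha => (hm a ha).symm) h.2 hB.2.1) (by omega)
    have h1 : dst.size ≤ B.size := Nat.size_le_size (by omega)
    have h2 : (dst + 1).size ≤ B.size := Nat.size_le_size (by have := length_pos f; omega)
    have h3 := Nat.size_le_size hB.1.eval_le
    have h4 := Nat.size_le_size hB.2.1.eval_le
    have h5 := Nat.size_le_size hB.2.2
    simp only [compile, runCost_append, runCost, cost, length]
    rw [this.1, this.2.1]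
    have : (e.length + f.length + 1) * (1 + 6 * B.size) = e.length * (1 + 6 * B.size)
      + f.length * (1 + 6 * B.size) + (1 + 6 * B.size) := by ring
    omega
  | sub e f he hf =>
    simp only [length] at hdst
    have hm := fun a (ha : a < dst) => runMem_compile_of_lt (e := e) m ha
    have := runMem_binary (e := e) (m := m) h.2 (runMem_compile_self m h.1) hm
      (fun m' _ => runMem_compile_self m' (h.2.mono (Nat.le_succ _)))
      (fun m' a ha => runMem_compile_of_lt m' ha)
    have c1 := he h.1 hB.1 (by omega)
    have c2 := hf (dst := dst + 1) (m := runMem m (e.compile dst)) (h.2.mono (Nat.le_succ _))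
      (bounded_congr (fun a ha => (hm a ha).symm) h.2 hB.2) (by omega)
    have h1 : dst.size ≤ B.size := Nat.size_le_size (by omega)
    have h2 : (dst + 1).size ≤ B.size := Nat.size_le_size (by have := length_pos f; omega)
    have h3 := Nat.size_le_size hB.1.eval_le
    have h4 := Nat.size_le_size hB.2.eval_le
    have h5 : (eval m e - eval m f).size ≤ B.size :=
      Nat.size_le_size ((Nat.sub_le _ _).trans hB.1.eval_le)
    simp only [compile, runCost_append, runCost, cost, length]
    rw [this.1, this.2.1]
    have : (e.length + f.length + 1) * (1 + 6 * B.size) = e.length * (1 + 6 * B.size)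
      + f.length * (1 + 6 * B.size) + (1 + 6 * B.size) := by ring
    omega

/-! ### Lists of expressions -/

/-- A program that writes the values of the expressions to consecutive cells from `dst` on. -/
def compileAll : List Expr → ℕ → List Instr
  | [], _ => []
  | e :: es, dst => e.compile dst ++ compileAll es (dst + 1)

theorem length_compileAll (es : List Expr) (dst : ℕ) :
    (compileAll es dst).length = (es.map length).sum := by
  induction es generalizing dst with
  | nil => rfl
  | cons e es ih => simp [compileAll, length_compile, ih]

theorem isStraight_of_mem_compileAll {es : List Expr} {dst : ℕ} {i : Instr}
    (hi : i ∈ compileAll es dst) : i.IsStraight := by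
  induction es generalizing dst with
  | nil => simp [compileAll] at hi
  | cons e es ih =>
    rcases List.mem_append.1 hi with hi | hi
    · exact isStraight_of_mem_compile hi
    · exact ih hi

theorem runMem_compileAll_of_lt (es : List Expr) {dst : ℕ} (m : ℕ → ℕ) {a : ℕ} (ha : a < dst) :
    runMem m (compileAll es dst) a = m a := by
  induction es generalizing dst m with
  | nil => rfl
  | cons e es ih =>
    rw [compileAll, runMem_append, ih _ (ha.trans (Nat.lt_succ_self _)), runMem_compile_of_lt m ha]

/-- Inputs lie below b and finished results below the current target, while an expression writes
only from its target upwards. So scratch values never damage anything that is still needed. -/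
theorem runMem_compileAll {es : List Expr} {b dst : ℕ} (hb : b ≤ dst) (m : ℕ → ℕ)
    (h : ∀ e ∈ es, CellsLT b e) (k : ℕ) (hk : k < es.length) :
    runMem m (compileAll es dst) (dst + k) = eval m es[k] := by
  induction es generalizing dst m k with
  | nil => simp at hk
  | cons e es ih =>
    have he : CellsLT b e := h e (by simp)
    have hm : ∀ a < b, runMem m (e.compile dst) a = m a := fun a ha =>
      runMem_compile_of_lt m (lt_of_lt_of_le ha hb)
    rw [compileAll, runMem_append]
    cases k with
    | zero =>
      rw [add_zero, runMem_compileAll_of_lt _ _ (Nat.lt_succ_self _),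
        runMem_compile_self m (he.mono hb)]
      rfl
    | succ k =>
      have hk' : k < es.length := by simpa using hk
      have := ih (hb.trans (Nat.le_succ _)) (runMem m (e.compile dst))
        (fun e he => h e (by simp [he])) k hk'
      rw [show dst + (k + 1) = dst + 1 + k by ring, this]
      exact eval_congr hm (h _ (by simp))

theorem runCost_compileAll_le {es : List Expr} {b dst B : ℕ} (hb : b ≤ dst) {m : ℕ → ℕ}
    (h : ∀ e ∈ es, CellsLT b e) (hB : ∀ e ∈ es, Bounded m B e)
    (hdst : dst + (es.map length).sum ≤ B) :
    runCost m (compileAll es dst) ≤ (es.map length).sum * (1 + 6 * B.size) := by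
  induction es generalizing dst m with
  | nil => simp [compileAll, runCost]
  | cons e es ih =>
    have he : CellsLT b e := h e (by simp)
    have hm : ∀ a < b, m a = runMem m (e.compile dst) a := fun a ha =>
      (runMem_compile_of_lt m (lt_of_lt_of_le ha hb)).symm
    simp only [List.map_cons, List.sum_cons] at hdst ⊢
    have hpos := length_pos e
    rw [compileAll, runCost_append, add_mul]
    refine add_le_add (runCost_compile_le (he.mono hb) (hB e (by simp)) (by omega)) ?_
    exact ih (hb.trans (Nat.le_succ _)) (fun e he => h e (by simp [he]))
      (fun f hf => bounded_congr hm (h f (by simp [hf])) (hB f (by simp [hf]))) (by omega)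

/-- The sum of a list of expressions. -/
def listSum (L : List Expr) : Expr := L.foldr add (const 0)

/-- The product of a list of expressions. -/
def listProd (L : List Expr) : Expr := L.foldr mul (const 1)

/-- The indicator of the event that the cell `a` holds the value `c`. -/
def indicator (a c : ℕ) : Expr :=
  sub (const 1) (add (sub (cell a) (const c)) (sub (const c) (cell a)))

theorem eval_listSum (m : ℕ → ℕ) (L : List Expr) :
    eval m (listSum L) = (L.map (eval m)).sum := by
  induction L with
  | nil => rfl
  | cons e L ih => simp [listSum, eval, ← ih]

theorem eval_listProd (m : ℕ → ℕ) (L : List Expr) :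
    eval m (listProd L) = (L.map (eval m)).prod := by
  induction L with
  | nil => rfl
  | cons e L ih => simp [listProd, eval, ← ih]

/-- With truncated subtraction (x − c) + (c − x) is |x − c|, and 1 − |x − c| truncates to the
indicator. Equality is thus tested without a jump. -/
theorem eval_indicator (m : ℕ → ℕ) (a c : ℕ) :
    eval m (indicator a c) = if m a = c then 1 else 0 := by
  simp only [indicator, eval]
  split_ifs <;> omega

theorem length_listSum_le {L : List Expr} {s : ℕ} (h : ∀ e ∈ L, e.length ≤ s) :
    (listSum L).length ≤ L.length * (s + 1) + 1 := by
  induction L with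
  | nil => simp [listSum, length]
  | cons e L ih =>
    have h1 := ih fun e he => h e (by simp [he])
    have h2 := h e (by simp)
    simp only [listSum, List.foldr_cons, length, List.length_cons] at h1 ⊢
    rw [add_mul]
    omega

theorem length_listProd_le {L : List Expr} {s : ℕ} (h : ∀ e ∈ L, e.length ≤ s) :
    (listProd L).length ≤ L.length * (s + 1) + 1 := by
  induction L with
  | nil => simp [listProd, length]
  | cons e L ih =>
    have h1 := ih fun e he => h e (by simp [he])
    have h2 := h e (by simp)
    simp only [listProd, List.foldr_cons, length, List.length_cons] at h1 ⊢
    rw [add_mul]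
    omega

theorem cellsLT_listSum {b : ℕ} {L : List Expr} (h : ∀ e ∈ L, CellsLT b e) :
    CellsLT b (listSum L) := by
  induction L with
  | nil => trivial
  | cons e L ih => exact ⟨h e (by simp), ih fun e he => h e (by simp [he])⟩

theorem cellsLT_listProd {b : ℕ} {L : List Expr} (h : ∀ e ∈ L, CellsLT b e) :
    CellsLT b (listProd L) := by
  induction L with
  | nil => trivial
  | cons e L ih => exact ⟨h e (by simp), ih fun e he => h e (by simp [he])⟩

theorem bounded_indicator {m : ℕ → ℕ} {B a c : ℕ} (h1 : 1 ≤ B) (ha : m a ≤ B) (hc : c ≤ B) :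
    Bounded m B (indicator a c) := by
  refine ⟨h1, ⟨ha, hc⟩, ⟨hc, ha⟩, ?_⟩
  simp only [eval]
  omega

theorem bounded_listSum {m : ℕ → ℕ} {B : ℕ} {L : List Expr} (h : ∀ e ∈ L, Bounded m B e)
    (h1 : ∀ e ∈ L, eval m e ≤ 1) (hL : L.length ≤ B) :
    Bounded m B (listSum L) ∧ eval m (listSum L) ≤ L.length := by
  induction L with
  | nil => exact ⟨Nat.zero_le _, le_rfl⟩
  | cons e L ih =>
    rw [List.length_cons] at hL
    have h2 := ih (fun e he => h e (by simp [he])) (fun e he => h1 e (by simp [he])) (by omega)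
    have h3 := h1 e (by simp)
    have h4 : eval m e + eval m (listSum L) ≤ L.length + 1 := by omega
    exact ⟨⟨h e (by simp), h2.1, h4.trans hL⟩, h4⟩

theorem bounded_listProd {m : ℕ → ℕ} {B b : ℕ} (hb : 1 ≤ b) {L : List Expr}
    (h : ∀ e ∈ L, Bounded m B e) (h1 : ∀ e ∈ L, eval m e ≤ b) (hL : b ^ L.length ≤ B) :
    Bounded m B (listProd L) ∧ eval m (listProd L) ≤ b ^ L.length := by
  induction L with
  | nil => exact ⟨by simpa [listProd, Bounded] using hL, by simp [listProd, eval]⟩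
  | cons e L ih =>
    rw [List.length_cons] at hL ⊢
    have h2 := ih (fun e he => h e (by simp [he])) (fun e he => h1 e (by simp [he]))
      ((Nat.pow_le_pow_right hb (Nat.le_succ _)).trans hL)
    have h4 : eval m e * eval m (listProd L) ≤ b ^ (L.length + 1) := by
      rw [pow_succ']
      exact Nat.mul_le_mul (h1 e (by simp)) h2.2
    exact ⟨⟨h e (by simp), h2.1, h4.trans hL⟩, h4⟩

end Expr

end RAM

/-! ### The learning algorithm -/

namespace RAM.Expr

variable {n K N m : ℕ}

/-- The cell with the value of vertex `i` in the sample `t` of the intervention `j`. -/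
def sampleCell (j : Fin N) (t : Fin m) (i : Fin n) : ℕ :=
  (finProdFinEquiv (finProdFinEquiv (j, t), i) : Fin (N * m * n))

theorem sampleCell_lt (j : Fin N) (t : Fin m) (i : Fin n) : sampleCell j t i < N * m * n :=
  Fin.is_lt _

/-- The number of samples in which the vertices of `R` have their values in `v`. -/
noncomputable def count (m : ℕ) (pick : Finset (Fin n) → (Fin n → Fin K) → Fin N)
    (S R : Finset (Fin n)) (v : Fin n → Fin K) : Expr :=
  listSum ((univ : Finset (Fin m)).toList.map fun t =>
    listProd (R.toList.map fun i => indicator (sampleCell (pick S v) t i) (v i)))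

/-- The numerator of an entry of the table. -/
noncomputable def numerator (m : ℕ) (ρ : Fin n → ℕ)
    (pick : Finset (Fin n) → (Fin n → Fin K) → Fin N)
    (S : Finset (Fin n)) (v : Fin n → Fin K) : Expr :=
  listProd (S.toList.map fun i => add
    (count m pick (S.filter fun j => ρ j ≤ ρ i) (S.filter fun j => ρ j ≤ ρ i) v) (const 1))

/-- The denominator of an entry of the table. -/
noncomputable def denominator (m : ℕ) (ρ : Fin n → ℕ)
    (pick : Finset (Fin n) → (Fin n → Fin K) → Fin N)
    (S : Finset (Fin n)) (v : Fin n → Fin K) : Expr :=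
  listProd (S.toList.map fun i => add
    (count m pick (S.filter fun j => ρ j ≤ ρ i) ((S.filter fun j => ρ j ≤ ρ i).erase i) v)
    (const K))

variable {pick : Finset (Fin n) → (Fin n → Fin K) → Fin N} {ρ : Fin n → ℕ}

theorem eval_count {mem : ℕ → ℕ} {ω : Fin N → Fin m → Fin n → Fin K}
    (h : ∀ j t i, mem (sampleCell j t i) = ω j t i) (S R : Finset (Fin n)) (v : Fin n → Fin K) :
    eval mem (count m pick S R v) = sampleCount pick ω S R v := by
  simp only [count, eval_listSum, eval_listProd, List.map_map, Function.comp_def, eval_indicator, h,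
    sum_map_toList, prod_map_toList, Fin.val_inj, sampleCount, card_filter]
  refine sum_congr rfl fun t _ => ?_
  rw [prod_ite_zero]
  simp

theorem eval_numerator {mem : ℕ → ℕ} {ω : Fin N → Fin m → Fin n → Fin K}
    (h : ∀ j t i, mem (sampleCell j t i) = ω j t i) (S : Finset (Fin n)) (v : Fin n → Fin K) :
    eval mem (numerator m ρ pick S v) = ∏ i ∈ S, (sampleCount pick ω
      (S.filter fun j => ρ j ≤ ρ i) (S.filter fun j => ρ j ≤ ρ i) v + 1) := by
  simp only [numerator, eval_listProd, List.map_map, Function.comp_def, prod_map_toList, eval,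
    eval_count h]

theorem eval_denominator {mem : ℕ → ℕ} {ω : Fin N → Fin m → Fin n → Fin K}
    (h : ∀ j t i, mem (sampleCell j t i) = ω j t i) (S : Finset (Fin n)) (v : Fin n → Fin K) :
    eval mem (denominator m ρ pick S v) = ∏ i ∈ S, (sampleCount pick ω
      (S.filter fun j => ρ j ≤ ρ i) ((S.filter fun j => ρ j ≤ ρ i).erase i) v + K) := by
  simp only [denominator, eval_listProd, List.map_map, Function.comp_def, prod_map_toList, eval,
    eval_count h]

theorem cellsLT_count (S R : Finset (Fin n)) (v : Fin n → Fin K) :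
    CellsLT (N * m * n) (count m pick S R v) := by
  refine cellsLT_listSum fun e he => ?_
  obtain ⟨t, -, rfl⟩ := List.mem_map.1 he
  refine cellsLT_listProd fun e he => ?_
  obtain ⟨i, -, rfl⟩ := List.mem_map.1 he
  exact ⟨trivial, ⟨sampleCell_lt _ _ _, trivial⟩, trivial, sampleCell_lt _ _ _⟩

theorem cellsLT_numerator (S : Finset (Fin n)) (v : Fin n → Fin K) :
    CellsLT (N * m * n) (numerator m ρ pick S v) := by
  refine cellsLT_listProd fun e he => ?_
  obtain ⟨i, -, rfl⟩ := List.mem_map.1 he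
  exact ⟨cellsLT_count _ _ _, trivial⟩

theorem cellsLT_denominator (S : Finset (Fin n)) (v : Fin n → Fin K) :
    CellsLT (N * m * n) (denominator m ρ pick S v) := by
  refine cellsLT_listProd fun e he => ?_
  obtain ⟨i, -, rfl⟩ := List.mem_map.1 he
  exact ⟨cellsLT_count _ _ _, trivial⟩

/-- An indicator compiles to 11 instructions and the product takes one more per factor, whence 12
per vertex; one addition per sample completes the count. -/
theorem length_count_le {l : ℕ} (S : Finset (Fin n)) {R : Finset (Fin n)} (hR : R.card ≤ l)
    (v : Fin n → Fin K) : (count m pick S R v).length ≤ m * (12 * l + 2) + 1 := by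
  refine (length_listSum_le (s := 12 * l + 1) fun e he => ?_).trans (by simp)
  obtain ⟨t, -, rfl⟩ := List.mem_map.1 he
  refine (length_listProd_le (s := 11) fun e he => ?_).trans ?_
  · obtain ⟨i, -, rfl⟩ := List.mem_map.1 he
    simp [indicator, length]
  · simp only [List.length_map, length_toList]
    omega

theorem length_numerator_le {l : ℕ} {S : Finset (Fin n)} (hS : S.card ≤ l) (v : Fin n → Fin K) :
    (numerator m ρ pick S v).length ≤ l * (m * (12 * l + 2) + 4) + 1 := by
  refine (length_listProd_le (s := m * (12 * l + 2) + 3) fun e he => ?_).trans ?_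
  · obtain ⟨i, -, rfl⟩ := List.mem_map.1 he
    have := length_count_le (m := m) (pick := pick) (S.filter fun j => ρ j ≤ ρ i)
      ((card_le_card (filter_subset (fun j => ρ j ≤ ρ i) S)).trans hS) v
    simp only [length]
    omega
  · simp only [List.length_map, length_toList]
    gcongr

theorem length_denominator_le {l : ℕ} {S : Finset (Fin n)} (hS : S.card ≤ l) (v : Fin n → Fin K) :
    (denominator m ρ pick S v).length ≤ l * (m * (12 * l + 2) + 4) + 1 := by
  refine (length_listProd_le (s := m * (12 * l + 2) + 3) fun e he => ?_).trans ?_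
  · obtain ⟨i, -, rfl⟩ := List.mem_map.1 he
    have := length_count_le (m := m) (pick := pick) (S.filter fun j => ρ j ≤ ρ i)
      (((card_le_card (erase_subset i (S.filter fun j => ρ j ≤ ρ i))).trans
        (card_le_card (filter_subset (fun j => ρ j ≤ ρ i) S))).trans hS) v
    simp only [length]
    omega
  · simp only [List.length_map, length_toList]
    gcongr

theorem bounded_count {mem : ℕ → ℕ} {B : ℕ} (hmem : ∀ j t i, mem (sampleCell (N := N) (m := m)
      (n := n) j t i) ≤ K) (hK : 1 ≤ K) (hB : m + K ≤ B) (S R : Finset (Fin n))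
    (v : Fin n → Fin K) :
    Bounded mem B (count m pick S R v) ∧ eval mem (count m pick S R v) ≤ m := by
  have key : ∀ t : Fin m, Bounded mem B
      (listProd (R.toList.map fun i => indicator (sampleCell (pick S v) t i) (v i))) ∧
      eval mem (listProd (R.toList.map fun i => indicator (sampleCell (pick S v) t i) (v i)))
        ≤ 1 := by
    intro t
    have := bounded_listProd (m := mem) (B := B) le_rfl
      (L := R.toList.map fun i => indicator (sampleCell (pick S v) t i) (v i)) ?_ ?_ ?_
    · simpa using this
    · intro e he
      obtain ⟨i, -, rfl⟩ := List.mem_map.1 he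
      exact bounded_indicator (by omega) ((hmem _ _ _).trans (by omega))
        ((v i).2.le.trans (by omega))
    · intro e he
      obtain ⟨i, -, rfl⟩ := List.mem_map.1 he
      rw [eval_indicator]
      split_ifs <;> omega
    · simp
      omega
  have := bounded_listSum (m := mem) (B := B) (L := (univ : Finset (Fin m)).toList.map fun t =>
    listProd (R.toList.map fun i => indicator (sampleCell (pick S v) t i) (v i))) ?_ ?_ ?_
  · simpa [count] using this
  · intro e he
    obtain ⟨t, -, rfl⟩ := List.mem_map.1 he
    exact (key t).1
  · intro e he
    obtain ⟨t, -, rfl⟩ := List.mem_map.1 he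
    exact (key t).2
  · simp
    omega

theorem bounded_numerator {mem : ℕ → ℕ} {B l : ℕ} (hmem : ∀ j t i, mem (sampleCell (N := N)
      (m := m) (n := n) j t i) ≤ K) (hK : 1 ≤ K) (hl : 1 ≤ l) (hB : (m + K) ^ l ≤ B)
    {S : Finset (Fin n)} (hS : S.card ≤ l) (v : Fin n → Fin K) :
    Bounded mem B (numerator m ρ pick S v) := by
  have hB' : m + K ≤ B := (Nat.le_self_pow (by omega) _).trans hB
  refine (bounded_listProd (b := m + K) (by omega) ?_ ?_ ?_).1
  · intro e he
    obtain ⟨i, -, rfl⟩ := List.mem_map.1 he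
    have := bounded_count (pick := pick) hmem hK hB' (S.filter fun j => ρ j ≤ ρ i)
      (S.filter fun j => ρ j ≤ ρ i) v
    refine ⟨this.1, by simp only [Bounded]; omega, ?_⟩
    simp only [eval]
    omega
  · intro e he
    obtain ⟨i, -, rfl⟩ := List.mem_map.1 he
    have := bounded_count (pick := pick) hmem hK hB' (S.filter fun j => ρ j ≤ ρ i)
      (S.filter fun j => ρ j ≤ ρ i) v
    simp only [eval]
    omega
  · rw [List.length_map, length_toList]
    exact (Nat.pow_le_pow_right (by omega) hS).trans hB

theorem bounded_denominator {mem : ℕ → ℕ} {B l : ℕ} (hmem : ∀ j t i, mem (sampleCell (N := N)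
      (m := m) (n := n) j t i) ≤ K) (hK : 1 ≤ K) (hl : 1 ≤ l) (hB : (m + K) ^ l ≤ B)
    {S : Finset (Fin n)} (hS : S.card ≤ l) (v : Fin n → Fin K) :
    Bounded mem B (denominator m ρ pick S v) := by
  have hB' : m + K ≤ B := (Nat.le_self_pow (by omega) _).trans hB
  refine (bounded_listProd (b := m + K) (by omega) ?_ ?_ ?_).1
  · intro e he
    obtain ⟨i, -, rfl⟩ := List.mem_map.1 he
    have := bounded_count (pick := pick) hmem hK hB' (S.filter fun j => ρ j ≤ ρ i)
      ((S.filter fun j => ρ j ≤ ρ i).erase i) v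
    refine ⟨this.1, by simp only [Bounded]; omega, ?_⟩
    simp only [eval]
    omega
  · intro e he
    obtain ⟨i, -, rfl⟩ := List.mem_map.1 he
    have := bounded_count (pick := pick) hmem hK hB' (S.filter fun j => ρ j ≤ ρ i)
      ((S.filter fun j => ρ j ≤ ρ i).erase i) v
    simp only [eval]
    omega
  · rw [List.length_map, length_toList]
    exact (Nat.pow_le_pow_right (by omega) hS).trans hB

end RAM.Expr

section TableLearner

variable {n K N : ℕ} {U : Type*} (G : SMCG (Fin n) U)

/-- The entries of the table that are computed. -/
abbrev TableEntry (K : ℕ) :=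
  Σ S : {S // S ∈ G.districtSubsets},
    ({y // y ∈ G.pa S.1} → Fin K) × ({x // x ∈ S.1} → Fin K)

variable {G}

theorem card_tableEntry_le {d l : ℕ} (hG : G.InClass d l) (hK : 1 ≤ K) :
    Fintype.card (TableEntry G K) ≤ n * 2 ^ l * (K ^ (l * d) * K ^ l) := by
  rw [Fintype.card_sigma]
  refine (sum_le_card_nsmul univ _ (K ^ (l * d) * K ^ l) fun S _ => ?_).trans ?_
  · rw [Fintype.card_prod, Fintype.card_fun, Fintype.card_fun, Fintype.card_coe, Fintype.card_coe,
      Fintype.card_fin]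
    exact Nat.mul_le_mul (Nat.pow_le_pow_right hK (hG.card_pa_le S.2))
      (Nat.pow_le_pow_right hK (hG.card_le S.2))
  · rw [card_univ, Fintype.card_coe, smul_eq_mul]
    have := hG.card_districtSubsets_le
    rw [Fintype.card_fin] at this
    exact Nat.mul_le_mul_right _ this

/-- The assignment with the values `s` on `S`, `p` on the parents of `S`, and `a` elsewhere. -/
noncomputable def glue (a : Fin K) (S : Finset (Fin n)) (p : {y // y ∈ G.pa S} → Fin K)
    (s : {x // x ∈ S} → Fin K) (i : Fin n) : Fin K :=
  if h : i ∈ S then s ⟨i, h⟩ else if h : i ∈ G.pa S then p ⟨i, h⟩ else a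

theorem glue_restrict (a : Fin K) (S : Finset (Fin n)) (v : Fin n → Fin K) {i : Fin n}
    (hi : i ∈ S ∪ G.pa S) : glue (G := G) a S (fun y => v y.1) (fun x => v x.1) i = v i := by
  unfold glue
  split_ifs with h1 h2
  · rfl
  · rfl
  · simp [h1, h2] at hi

/-- The numerator or the denominator of an entry. -/
noncomputable def entryExpr (m : ℕ) (ρ : Fin n → ℕ)
    (pick : Finset (Fin n) → (Fin n → Fin K) → Fin N) (a : Fin K) (e : TableEntry G K)
    (b : Fin 2) : RAM.Expr :=
  if b = 0 then RAM.Expr.numerator m ρ pick e.1.1 (glue a e.1.1 e.2.1 e.2.2)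
  else RAM.Expr.denominator m ρ pick e.1.1 (glue a e.1.1 e.2.1 e.2.2)

/-- The expression in the output cell `k`: numerators and denominators alternate. -/
noncomputable def tableExpr (m : ℕ) (ρ : Fin n → ℕ)
    (pick : Finset (Fin n) → (Fin n → Fin K) → Fin N) (a : Fin K)
    (k : Fin (Fintype.card (TableEntry G K) * 2)) : RAM.Expr :=
  entryExpr m ρ pick a ((Fintype.equivFin (TableEntry G K)).symm (finProdFinEquiv.symm k).1)
    (finProdFinEquiv.symm k).2

open Classical in
/-- The algorithm that estimates all conditional distributions by smoothed frequencies. -/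
noncomputable def tableLearner (m : ℕ) (ρ : Fin n → ℕ) (I : Fin N ↪ Intervention (Fin n) (Fin K))
    (pick : Finset (Fin n) → (Fin n → Fin K) → Fin N) (a : Fin K) : Learner G K where
  numInterventions := N
  intervention := I
  numSamples := m
  program := RAM.Expr.compileAll (List.ofFn (tableExpr (G := G) m ρ pick a)) (N * m * n)
  -- Entries take two consecutive cells behind the samples. Sets that are not subsets of a
  -- c-component are never looked up by the oracle, so cell 0 is an arbitrary value.
  layout S p s := if h : S ∈ G.districtSubsets then
      N * m * n + 2 * (Fintype.equivFin (TableEntry G K) ⟨⟨S, h⟩, p, s⟩ : ℕ) else 0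

variable {m : ℕ} {ρ : Fin n → ℕ} {I : Fin N ↪ Intervention (Fin n) (Fin K)}
  {pick : Finset (Fin n) → (Fin n → Fin K) → Fin N} {a : Fin K}

/-- The memory that holds the samples. -/
def sampleMem (ω : Fin N → Fin m → Fin n → Fin K) (x : ℕ) : ℕ :=
  if h : x < N * m * n then
    let y := finProdFinEquiv.symm (⟨x, h⟩ : Fin (N * m * n))
    let z := finProdFinEquiv.symm y.1
    (ω z.1 z.2 y.2 : ℕ)
  else 0

theorem sampleMem_sampleCell (ω : Fin N → Fin m → Fin n → Fin K) (j : Fin N)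
    (t : Fin m) (i : Fin n) : sampleMem ω (RAM.Expr.sampleCell j t i) = ω j t i := by
  have h := RAM.Expr.sampleCell_lt j t i
  have : (⟨RAM.Expr.sampleCell j t i, h⟩ : Fin (N * m * n))
      = finProdFinEquiv (finProdFinEquiv (j, t), i) := Fin.ext rfl
  simp only [sampleMem, dif_pos h, this, Equiv.symm_apply_apply]

theorem cellsLT_tableExpr (k : Fin (Fintype.card (TableEntry G K) * 2)) :
    RAM.Expr.CellsLT (N * m * n) (tableExpr (G := G) m ρ pick a k) := by
  unfold tableExpr entryExpr
  split_ifs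
  · exact RAM.Expr.cellsLT_numerator _ _
  · exact RAM.Expr.cellsLT_denominator _ _

theorem length_tableExpr_le {d l : ℕ} (hG : G.InClass d l)
    (k : Fin (Fintype.card (TableEntry G K) * 2)) :
    (tableExpr (G := G) m ρ pick a k).length ≤ l * (m * (12 * l + 2) + 4) + 1 := by
  unfold tableExpr entryExpr
  split_ifs
  · exact RAM.Expr.length_numerator_le (hG.card_le (Subtype.prop _)) _
  · exact RAM.Expr.length_denominator_le (hG.card_le (Subtype.prop _)) _

theorem bounded_tableExpr {d l B : ℕ} (hG : G.InClass d l) (hl : 1 ≤ l)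
    (hB : (m + K) ^ l ≤ B) {mem : ℕ → ℕ}
    (hmem : ∀ j t i, mem (RAM.Expr.sampleCell (N := N) (m := m) (n := n) j t i) ≤ K)
    (k : Fin (Fintype.card (TableEntry G K) * 2)) :
    RAM.Expr.Bounded mem B (tableExpr (G := G) m ρ pick a k) := by
  have hK : 1 ≤ K := Nat.one_le_of_lt a.2
  unfold tableExpr entryExpr
  split_ifs
  · exact RAM.Expr.bounded_numerator hmem hK hl hB (hG.card_le (Subtype.prop _)) _
  · exact RAM.Expr.bounded_denominator hmem hK hl hB (hG.card_le (Subtype.prop _)) _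

theorem tableLearner_haltsAt (ω : Fin N → Fin m → Fin n → Fin K) :
    RAM.HaltsAt (tableLearner (G := G) m ρ I pick a).program
      ((tableLearner (G := G) m ρ I pick a).start ω)
      ⟨(tableLearner (G := G) m ρ I pick a).program.length,
        RAM.runMem (sampleMem ω)
          (tableLearner (G := G) m ρ I pick a).program,
        RAM.runCost (sampleMem ω)
          (tableLearner (G := G) m ρ I pick a).program⟩ :=
  RAM.haltsAt_of_straight (fun _ hi => RAM.Expr.isStraight_of_mem_compileAll hi) _

/-- P bounds the length of the program, hence also the number of executed instructions. B bounds
every address, including the scratch cells, and every intermediate result: a product of at most l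
factors, each at most m + K. -/
theorem tableLearner_runsInTime {d l : ℕ} (hG : G.InClass d l) (hl : 1 ≤ l) {P B : ℕ}
    (hP : n * 2 ^ l * (K ^ (l * d) * K ^ l) * 2 * (l * (m * (12 * l + 2) + 4) + 1) ≤ P)
    (hB : N * m * n + P + (m + K) ^ l ≤ B) {T : ℝ}
    (hT : ((N * n + N * m * n + P + P * (1 + 6 * B.size) : ℕ) : ℝ) ≤ T) :
    (tableLearner (G := G) m ρ I pick a).RunsInTime T := by
  intro ω
  refine ⟨_, tableLearner_haltsAt ω, le_trans ?_ hT⟩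
  have hK : 1 ≤ K := Nat.one_le_of_lt a.2
  set es := List.ofFn (tableExpr (G := G) m ρ pick a) with hes
  have hmem : ∀ e ∈ es, ∃ k, tableExpr (G := G) m ρ pick a k = e := by
    intro e he
    exact List.mem_ofFn.1 he
  have hlen : (es.map RAM.Expr.length).sum ≤ P := by
    refine le_trans ?_ hP
    refine (List.sum_le_card_nsmul _ (l * (m * (12 * l + 2) + 4) + 1) ?_).trans ?_
    · intro x hx
      obtain ⟨e, he, rfl⟩ := List.mem_map.1 hx
      obtain ⟨k, rfl⟩ := hmem e he
      exact length_tableExpr_le hG k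
    · rw [smul_eq_mul]
      refine Nat.mul_le_mul_right _ ?_
      simp only [hes, List.length_map, List.length_ofFn]
      exact Nat.mul_le_mul_right _ (card_tableEntry_le hG hK)
  have hcost : RAM.runCost (sampleMem (m := m) (N := N) ω)
      (RAM.Expr.compileAll es (N * m * n)) ≤ P * (1 + 6 * B.size) := by
    refine (RAM.Expr.runCost_compileAll_le (B := B) le_rfl ?_ ?_ ?_).trans
      (Nat.mul_le_mul_right _ hlen)
    · intro e he
      obtain ⟨k, rfl⟩ := hmem e he
      exact cellsLT_tableExpr k
    · intro e he
      obtain ⟨k, rfl⟩ := hmem e he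
      refine bounded_tableExpr hG hl (by omega) (fun j t i => ?_) k
      rw [sampleMem_sampleCell (m := m) (N := N) ω]
      exact (Fin.is_lt _).le
    · omega
  have hplen : (RAM.Expr.compileAll es (N * m * n)).length ≤ P := by
    rwa [RAM.Expr.length_compileAll]
  exact_mod_cast add_le_add (add_le_add le_rfl hplen) hcost

theorem tableLearner_table [Fintype U] (hI : Isolates G I G.districtSubsets pick)
    (ω : Fin N → Fin m → Fin n → Fin K) :
    ((tableLearner (G := G) m ρ I pick a).table (RAM.runMem (sampleMem ω)
      (tableLearner (G := G) m ρ I pick a).program)).IsProductOf ρ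
        (condOf (smoothedFactor pick ω)) := by
  intro S hS v
  have : Nonempty (Fin K) := ⟨a⟩
  set es := List.ofFn (tableExpr (G := G) m ρ pick a) with hes
  let ent : TableEntry G K := ⟨⟨S, hS⟩, fun y => v y.1, fun x => v x.1⟩
  set k := Fintype.equivFin (TableEntry G K) ent with hk
  set v' := glue (G := G) a S (fun y => v y.1) (fun x => v x.1) with hv'
  have hlay : (tableLearner (G := G) m ρ I pick a).layout S (fun y => v y.1) (fun x => v x.1)
      = N * m * n + 2 * (k : ℕ) := dif_pos hS
  have hcell : ∀ b : Fin 2, RAM.runMem (sampleMem ω) (RAM.Expr.compileAll es (N * m * n))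
        (N * m * n + 2 * (k : ℕ) + b)
      = RAM.Expr.eval (sampleMem ω) (tableExpr (G := G) m ρ pick a (finProdFinEquiv (k, b))) := by
    intro b
    have hlt := (finProdFinEquiv (k, b)).2
    have := RAM.Expr.runMem_compileAll (es := es) (b := N * m * n) le_rfl (sampleMem ω) (by
      intro e he
      obtain ⟨k, rfl⟩ := List.mem_ofFn.1 he
      exact cellsLT_tableExpr k) (finProdFinEquiv (k, b)) (by rw [hes, List.length_ofFn]; exact hlt)
    -- The equivalence puts (k, b) at position 2k + b, so numerator and denominator of one entry are
    -- neighbours, as the output format requires.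
    have hval : ((finProdFinEquiv (k, b) : Fin _) : ℕ) = b + 2 * k := rfl
    rw [show N * m * n + 2 * (k : ℕ) + b
      = N * m * n + ((finProdFinEquiv (k, b) : Fin _) : ℕ) by rw [hval]; omega]
    rw [this]
    simp only [hes, List.getElem_ofFn, Fin.eta]
  have h0 := hcell 0
  have h1 := hcell 1
  have hn : tableExpr (G := G) m ρ pick a (finProdFinEquiv (k, 0))
      = RAM.Expr.numerator m ρ pick S v' := by
    rw [tableExpr, Equiv.symm_apply_apply, hk, Equiv.symm_apply_apply]
    rfl
  have hd : tableExpr (G := G) m ρ pick a (finProdFinEquiv (k, 1))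
      = RAM.Expr.denominator m ρ pick S v' := by
    rw [tableExpr, Equiv.symm_apply_apply, hk, Equiv.symm_apply_apply]
    rfl
  rw [Fin.val_zero, add_zero, hn, RAM.Expr.eval_numerator (sampleMem_sampleCell ω)] at h0
  rw [Fin.val_one, hd, RAM.Expr.eval_denominator (sampleMem_sampleCell ω)] at h1
  rw [Learner.table, hlay]
  change ((RAM.runMem (sampleMem ω) (RAM.Expr.compileAll es (N * m * n)) _ : ℕ) : ℝ)
    / (RAM.runMem (sampleMem ω) (RAM.Expr.compileAll es (N * m * n)) _ : ℕ) = _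
  rw [h0, h1, Nat.cast_prod, Nat.cast_prod, ← prod_div_distrib]
  refine prod_congr rfl fun i hi => ?_
  set S' := S.filter fun j => ρ j ≤ ρ i
  have hi' : i ∈ S' := mem_filter.2 ⟨hi, le_rfl⟩
  -- The program sees v only through the glued assignment. This suffices: the kernel on S' reads
  -- only S' ∪ Pa(S'), which lies in S ∪ Pa(S), where both assignments agree.
  have hvv : condOf (smoothedFactor pick ω) S' i v = condOf (smoothedFactor pick ω) S' i v' := by
    refine (isKernelFamily_condOf (G := G) (ρ := ρ) (smoothedFactor_pos ω)
      (dependsOn_smoothedFactor hI ω)).dependsOn S' i fun j hj => ?_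
    refine (glue_restrict a S v ?_).symm
    simp only [SMCG.pa, coe_union, Set.mem_union, mem_coe, mem_filter, mem_univ, true_and,
      mem_union] at hj ⊢
    rcases hj with hj | ⟨-, x, hx, he⟩
    · exact Or.inl (mem_filter.1 hj).1
    · by_cases hjS : j ∈ S
      · exact Or.inl hjS
      · exact Or.inr ⟨hjS, x, (mem_filter.1 hx).1, he⟩
  rw [hvv, condOf_smoothedFactor hI ω hi', Fintype.card_fin]

end TableLearner

/-! ### Correctness of the learning algorithm -/

section Learns

variable {n K N m : ℕ} {U : Type*} [Fintype U] {G : SMCG (Fin n) U} {ρ : Fin n → ℕ}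
  {I : Fin N ↪ Intervention (Fin n) (Fin K)} {pick : Finset (Fin n) → (Fin n → Fin K) → Fin N}
  {a : Fin K}

/-- Every set of `𝒮` is isolated by some intervention, whatever the values of its parents. -/
def Covers (G : SMCG (Fin n) U) (I : Fin N → Intervention (Fin n) (Fin K))
    (𝒮 : Finset (Finset (Fin n))) : Prop :=
  ∀ S ∈ 𝒮, ∀ v : Fin n → Fin K, ∃ j,
    (∀ i ∈ S, I j i = none) ∧ ∀ i ∈ G.pa S, I j i = some (v i)

/-- The choice is made from the values on the parents alone, through `Q`, so that assignments
agreeing on Pa(S) get the same intervention; `j₀` serves where nothing isolates S. -/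
theorem Covers.exists_isolates {I : Fin N → Intervention (Fin n) (Fin K)}
    {𝒮 : Finset (Finset (Fin n))} (h : Covers G I 𝒮) (j₀ : Fin N) :
    ∃ pick, Isolates G I 𝒮 pick := by
  classical
  let Q : (S : Finset (Fin n)) → ({y // y ∈ G.pa S} → Fin K) → Fin N → Prop := fun S p j =>
    (∀ i ∈ S, I j i = none) ∧ ∀ i : {y // y ∈ G.pa S}, I j i.1 = some (p i)
  let pick : Finset (Fin n) → (Fin n → Fin K) → Fin N := fun S v =>
    if h : ∃ j, Q S (fun y => v y.1) j then h.choose else j₀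
  have hp : ∀ S ∈ 𝒮, ∀ v, Q S (fun y => v y.1) (pick S v) := by
    intro S hS v
    have hex : ∃ j, Q S (fun y => v y.1) j := by
      obtain ⟨j, h1, h2⟩ := h S hS v
      exact ⟨j, h1, fun i => h2 i.1 i.2⟩
    simp only [pick, dif_pos hex]
    exact hex.choose_spec
  refine ⟨pick, ⟨fun S v w hvw => ?_, fun S hS v => (hp S hS v).1,
    fun S hS v i hi => (hp S hS v).2 ⟨i, hi⟩⟩⟩
  have : (fun y : {y // y ∈ G.pa S} => v y.1) = fun y => w y.1 := funext fun y => hvw y.1 y.2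
  simp only [pick, this]

/-- The total square error has mean at most n·2^l·K^{ld}·2/m and must be at most a third of the
threshold ε²/(n·K^{ld+l}). This is `hm'`, with 6 = 2·3, the 3 coming from Markov's inequality. -/
theorem tableLearner_learns {d l : ℕ} (hG : G.InClass d l) (hρ : G.IsTopological ρ)
    (hI : Isolates G I G.districtSubsets pick) (hn : 1 ≤ n) {ε : ℝ} (hε : 0 < ε)
    (hm : ((K : ℝ) ^ l) ^ 2 ≤ m)
    (hm' : 6 * (n : ℝ) ^ 2 * 2 ^ l * ((K : ℝ) ^ (l * d)) ^ 2 * K ^ l ≤ m * ε ^ 2) :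
    (tableLearner (G := G) m ρ I pick a).Learns ε := by
  intro X
  have : Nonempty (Fin K) := ⟨a⟩
  have hK : (1 : ℝ) ≤ K := by exact_mod_cast Nat.one_le_of_lt a.2
  have hn' : (0 : ℝ) < n := by exact_mod_cast hn
  set L := tableLearner (G := G) m ρ I pick a
  -- Any base point would do: each summand depends only on S ∪ Pa(S), and all these coordinates are
  -- summed over.
  let v₀ : Fin n → Fin K := fun _ => a
  let Z : (Fin N → Fin m → Fin n → Fin K) → ℝ := fun ω => ∑ S ∈ G.districtSubsets,
    sumOver (S ∪ G.pa S) (fun w => (smoothedFactor pick ω S w - X.cFactor S w) ^ 2) v₀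
  let θ : ℝ := ε ^ 2 / (n * (K : ℝ) ^ (l * d + l))
  have hc : (0 : ℝ) < n * (K : ℝ) ^ (l * d + l) := by positivity
  have hθ : 0 < θ := by positivity
  have hm0 : (0 : ℝ) < m := lt_of_lt_of_le (by positivity) hm
  refine two_thirds_le_of_expectation_le (Ω := Fin N → Fin m → Fin n → Fin K)
    (W := fun ω => ∏ j, ∏ s, X.doProb (I j) (ω j s)) (Z := Z) (θ := θ)
    (fun ω => prod_nonneg fun _ _ => prod_nonneg fun _ _ => X.doProb_nonneg _ _) ?_
    (fun ω => sum_nonneg fun _ _ => sumOver_nonneg fun _ => sq_nonneg _) hθ ?_ ?_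
  · exact sum_prod_eq_one fun j => sum_prod_eq_one fun _ => X.sum_doProb hρ _
  · simp only [Z, mul_sum]
    rw [sum_comm]
    have h1 : ∀ S ∈ G.districtSubsets, ∑ ω : Fin N → Fin m → Fin n → Fin K,
        (∏ j, ∏ s, X.doProb (I j) (ω j s)) * sumOver (S ∪ G.pa S)
          (fun w => (smoothedFactor pick ω S w - X.cFactor S w) ^ 2) v₀
        ≤ (K : ℝ) ^ (l * d) * (2 / m) := by
      intro S hS
      have := sumOver_expectation_le (m := m) X hρ hI hS (by
        rw [Fintype.card_fin]
        refine le_trans ?_ hm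
        gcongr
        exact hG.card_le hS) v₀
      refine this.trans ?_
      rw [Fintype.card_fin]
      gcongr
      exact hG.card_pa_le hS
    refine (sum_le_sum h1).trans ?_
    rw [sum_const, nsmul_eq_mul]
    have h2 : (G.districtSubsets.card : ℝ) ≤ n * 2 ^ l := by
      have := hG.card_districtSubsets_le
      rw [Fintype.card_fin] at this
      exact_mod_cast this
    calc (G.districtSubsets.card : ℝ) * ((K : ℝ) ^ (l * d) * (2 / m))
        ≤ (n * 2 ^ l) * ((K : ℝ) ^ (l * d) * (2 / m)) := by gcongr
      _ = 6 * (n : ℝ) ^ 2 * 2 ^ l * ((K : ℝ) ^ (l * d)) ^ 2 * K ^ l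
            / (m * (3 * (n * (K : ℝ) ^ (l * d + l)))) := by
          rw [pow_add]
          field_simp
          ring
      _ ≤ m * ε ^ 2 / (m * (3 * (n * (K : ℝ) ^ (l * d + l)))) := by gcongr
      _ = θ / 3 := by
          simp only [θ]
          field_simp
  · intro ω hω
    refine ⟨_, tableLearner_haltsAt ω, ?_⟩
    refine LocalTable.isAccurate_of_sum_sq_lt (D := l * d + l) X hρ
      (smoothedFactor_pos (pick := pick) ω) (dependsOn_smoothedFactor hI ω)
      (tableLearner_table hI ω) (fun S hS => ?_) hε fun v => ?_
    · rw [add_comm]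
      exact (card_union_le _ _).trans (add_le_add (hG.card_le hS) (hG.card_pa_le hS))
    · rw [Fintype.card_fin, Fintype.card_fin]
      have hZ : ∑ S ∈ G.districtSubsets, sumOver (S ∪ G.pa S)
          (fun w => (smoothedFactor pick ω S w - X.cFactor S w) ^ 2) v = Z ω := by
        refine sum_congr rfl fun S _ => ?_
        have hdep : DependsOn (fun w => (smoothedFactor pick ω S w - X.cFactor S w) ^ 2)
            ((S ∪ G.pa S : Finset (Fin n)) : Set (Fin n)) := by
          intro x y hxy
          dsimp only
          rw [dependsOn_smoothedFactor hI ω S hxy, X.dependsOn_cFactor S hxy]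
        exact hdep.sumOver (S ∪ G.pa S) fun i hi => by simp at hi
      rw [hZ]
      have := (lt_div_iff₀ hc).1 hω
      linarith

end Learns

/-! ### Greedy covers -/

section Greedy

variable {P Ω : Type*} [Fintype P] [Fintype Ω]

-- By double counting, some ω covers at least a fraction r of the elements still uncovered, so each
-- round multiplies their number by at most 1 − r.
open Classical in
theorem exists_greedy_cover [Nonempty Ω] (cov : Ω → P → Prop) {r : ℝ} (hr : r ≤ 1)
    (h : ∀ p, r * Fintype.card Ω ≤ (univ.filter fun ω => cov ω p).card) (N : ℕ) :
    ∃ T : Finset Ω, T.card ≤ N ∧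
      ((univ.filter fun p => ∀ ω ∈ T, ¬ cov ω p).card : ℝ) ≤ Fintype.card P * (1 - r) ^ N := by
  induction N with
  | zero => exact ⟨∅, by simp, by simp⟩
  | succ N ih =>
    obtain ⟨T, hT, hrem⟩ := ih
    set R := univ.filter fun p => ∀ ω ∈ T, ¬ cov ω p with hR
    have hex : R.Nonempty → ∃ ω : Ω, r * R.card ≤ (R.filter fun p => cov ω p).card := by
      intro hne
      by_contra! hlt
      have h1 : ∑ ω : Ω, ((R.filter fun p => cov ω p).card : ℝ)
          = ∑ p ∈ R, ((univ.filter fun ω => cov ω p).card : ℝ) := by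
        simp only [card_filter, Nat.cast_sum]
        exact sum_comm
      have h2 : R.card * (r * Fintype.card Ω)
          ≤ ∑ p ∈ R, ((univ.filter fun ω => cov ω p).card : ℝ) := by
        rw [← nsmul_eq_mul]
        exact card_nsmul_le_sum _ _ _ fun p _ => h p
      have h3 : ∑ ω : Ω, ((R.filter fun p => cov ω p).card : ℝ)
          < ∑ _ω : Ω, r * R.card := sum_lt_sum_of_nonempty univ_nonempty fun ω _ => hlt ω
      rw [sum_const, card_univ, nsmul_eq_mul, h1] at h3
      linarith
    rcases R.eq_empty_or_nonempty with hemp | hne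
    · refine ⟨T, hT.trans (Nat.le_succ _), ?_⟩
      rw [← hR, hemp, card_empty, Nat.cast_zero]
      exact mul_nonneg (Nat.cast_nonneg _) (pow_nonneg (sub_nonneg.2 hr) _)
    · obtain ⟨ω, hω⟩ := hex hne
      refine ⟨insert ω T, (card_insert_le _ _).trans (Nat.succ_le_succ hT), ?_⟩
      have hsub : (univ.filter fun p => ∀ ω' ∈ insert ω T, ¬ cov ω' p)
          = R.filter fun p => ¬ cov ω p := by
        ext p
        simp [hR, and_comm]
      have hsplit := card_filter_add_card_filter_not (s := R) (fun p => cov ω p)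
      have hsplit' : ((R.filter fun p => cov ω p).card : ℝ)
          + (R.filter fun p => ¬ cov ω p).card = R.card := by exact_mod_cast hsplit
      rw [hsub, pow_succ]
      calc ((R.filter fun p => ¬ cov ω p).card : ℝ) ≤ R.card * (1 - r) := by linarith
        _ ≤ (Fintype.card P * (1 - r) ^ N) * (1 - r) :=
            mul_le_mul_of_nonneg_right hrem (sub_nonneg.2 hr)
        _ = _ := by ring

/-- If every `p` is covered by a fraction `r` of all `ω`, then few `ω` cover all `p`. -/
theorem exists_small_cover (cov : Ω → P → Prop) {r : ℝ} (hr0 : 0 < r) (hr : r ≤ 1) [Nonempty Ω]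
    (h : ∀ p, ∃ s : Finset Ω, (∀ ω ∈ s, cov ω p) ∧ r * Fintype.card Ω ≤ s.card) (N : ℕ) :
    ∃ T : Finset Ω, (∀ p, ∃ ω ∈ T, cov ω p) ∧
      (T.card : ℝ) ≤ N + Fintype.card P * Real.exp (-(r * N)) := by
  classical
  obtain ⟨T, hT, hrem⟩ := exists_greedy_cover cov hr (fun p => by
    obtain ⟨s, hs, hs'⟩ := h p
    refine hs'.trans ?_
    exact_mod_cast card_le_card fun ω hω => mem_filter.2 ⟨mem_univ _, hs ω hω⟩) N
  have hcov : ∀ p, ∃ ω, cov ω p := by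
    intro p
    obtain ⟨s, hs, hs'⟩ := h p
    have : (0 : ℝ) < s.card := lt_of_lt_of_le (mul_pos hr0 (by exact_mod_cast Fintype.card_pos)) hs'
    obtain ⟨ω, hω⟩ := card_pos.1 (by exact_mod_cast this)
    exact ⟨ω, hs ω hω⟩
  choose f hf using hcov
  set R := univ.filter fun p => ∀ ω ∈ T, ¬ cov ω p with hR
  -- After N greedy rounds, each leftover p gets an ω of its own.
  refine ⟨T ∪ R.image f, fun p => ?_, ?_⟩
  · by_cases hp : ∃ ω ∈ T, cov ω p
    · obtain ⟨ω, hω, hc⟩ := hp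
      exact ⟨ω, mem_union_left _ hω, hc⟩
    · refine ⟨f p, mem_union_right _ (mem_image_of_mem _ ?_), hf p⟩
      push Not at hp
      simpa [hR] using hp
  · have h1 : ((T ∪ R.image f).card : ℝ) ≤ T.card + R.card := by
      exact_mod_cast (card_union_le _ _).trans (Nat.add_le_add_left card_image_le _)
    have h2 : (T.card : ℝ) ≤ N := by exact_mod_cast hT
    have h3 : (1 - r) ^ N ≤ Real.exp (-(r * N)) := by
      calc (1 - r) ^ N ≤ Real.exp (-r) ^ N :=
            pow_le_pow_left₀ (sub_nonneg.2 hr) (Real.one_sub_le_exp_neg r) N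
        _ = _ := by rw [← Real.exp_nat_mul]; congr 1; ring
    have h4 := mul_le_mul_of_nonneg_left h3 (Nat.cast_nonneg (α := ℝ) (Fintype.card P))
    linarith

/-- Independence in counting form: a uniformly random function meets constraints at distinct
coordinates with the product of their probabilities, and unconstrained coordinates contribute 1. -/
theorem prod_mul_card_le_card_piFinset {ι β : Type*} [Fintype ι] [DecidableEq ι] [Fintype β]
    {A : ι → Finset β} {E : Finset ι} {r : ι → ℝ} (hr : ∀ i, 0 ≤ r i)
    (hE : ∀ i ∉ E, A i = univ) (hA : ∀ i ∈ E, r i * Fintype.card β ≤ (A i).card) :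
    (∏ i ∈ E, r i) * Fintype.card (ι → β) ≤ (Fintype.piFinset A).card := by
  rw [Fintype.card_piFinset, Fintype.card_fun, Nat.cast_prod, Nat.cast_pow]
  have h1 : ∏ i ∈ E, r i = ∏ i, if i ∈ E then r i else 1 := by
    rw [prod_ite_mem, univ_inter]
  rw [h1, ← card_univ (α := ι), ← prod_const, ← prod_mul_distrib]
  refine prod_le_prod (fun i _ => ?_) fun i _ => ?_
  · split_ifs
    · exact mul_nonneg (hr i) (Nat.cast_nonneg _)
    · positivity
  · split_ifs with hi
    · exact hA i hi
    · rw [hE i hi, one_mul, card_univ]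

end Greedy

/-- The reciprocal is (1 + 1/D)^D ≤ e < 3. It is used for the event that up to D components are all
inactive, each with probability D/(D+1). -/
theorem one_third_le_div_pow {D : ℕ} (hD : 1 ≤ D) : 1 / 3 ≤ ((D : ℝ) / (D + 1)) ^ D := by
  have hD' : (0 : ℝ) < D := by exact_mod_cast hD
  have h1 : (1 + 1 / (D : ℝ)) ^ D ≤ 3 := by
    calc (1 + 1 / (D : ℝ)) ^ D ≤ Real.exp (1 / D) ^ D := by
          refine pow_le_pow_left₀ (by positivity) ?_ _
          rw [add_comm]
          exact Real.add_one_le_exp _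
      _ = Real.exp 1 := by
          rw [← Real.exp_nat_mul]
          congr 1
          field_simp
      _ ≤ 3 := Real.exp_one_lt_three.le
  have h2 : ((D : ℝ) / (D + 1)) ^ D = 1 / (1 + 1 / (D : ℝ)) ^ D := by
    rw [one_div, ← inv_pow]
    congr 1
    field_simp
  rw [h2]
  exact one_div_le_one_div_of_le (by positivity) h1

/-! ### Covering interventions for graphs of bounded in-degree -/

section CoverInDegree

variable {n K : ℕ} {U : Type*} [Fintype U] {G : SMCG (Fin n) U}

/-- In the active components, i.e. those with `f = 0`, the vertices with `b = true` are
left free; all other vertices are set to the values of `g`. -/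
noncomputable def randomIntervention (G : SMCG (Fin n) U) {D : ℕ}
    (x : (Finset (Fin n) → Fin (D + 1)) × (Fin n → Bool) × (Fin n → Fin K)) :
    Intervention (Fin n) (Fin K) := fun i =>
  if x.1 (G.componentIn univ i) = 0 ∧ x.2.1 i = true then none else some (x.2.2 i)

theorem componentIn_eq_of_mem {a i : Fin n} (h : i ∈ G.componentIn univ a) :
    G.componentIn univ i = G.componentIn univ a :=
  ((SMCG.componentIn_eq_iff (mem_univ i)).2 (SMCG.mem_componentIn.1 h).2).symm

/-- Let C be the component containing S and D = ld. Three independent requirements suffice. C is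
active while the at most D other components meeting Pa(S) are not: probability at least 1/(3(D+1)).
The coins in C select exactly S: at least 2^{-l}. The parents receive the prescribed values: at
least K^{-D}. Parents inside C are then set by their coins, the others because their components are
inactive. Activity is decided per component, so it costs 1/(D+1) only once. -/
theorem exists_isolating_randomInterventions {d l : ℕ} (hG : G.InClass d l) (hK : 1 ≤ K)
    (hD : 1 ≤ l * d) {S : Finset (Fin n)} (hS : S ∈ G.districtSubsets) (v : Fin n → Fin K) :
    ∃ s : Finset ((Finset (Fin n) → Fin (l * d + 1)) × (Fin n → Bool) × (Fin n → Fin K)),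
      (∀ x ∈ s, (∀ i ∈ S, randomIntervention G x i = none) ∧
        ∀ i ∈ G.pa S, randomIntervention G x i = some (v i)) ∧
      1 / (3 * (l * d + 1) * 2 ^ l * (K : ℝ) ^ (l * d)) * Fintype.card
        ((Finset (Fin n) → Fin (l * d + 1)) × (Fin n → Bool) × (Fin n → Fin K)) ≤ s.card := by
  obtain ⟨a, ha⟩ := SMCG.mem_districtSubsets.1 hS
  set C := G.componentIn univ a with hC
  set D := l * d with hDdef
  have hDK : (0 : ℝ) < K := by exact_mod_cast hK
  have hD0 : (0 : ℝ) < D := by exact_mod_cast hD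
  have hcast : ((l : ℝ) * d) = (D : ℝ) := by simp [hDdef]
  let E := ((G.pa S).image (G.componentIn univ)).erase C
  let A₁ : Finset (Fin n) → Finset (Fin (D + 1)) := fun c =>
    if c = C then {0} else if c ∈ E then {0}ᶜ else univ
  let A₂ : Fin n → Finset Bool := fun i => if i ∈ C then {decide (i ∈ S)} else univ
  let A₃ : Fin n → Finset (Fin K) := fun i => if i ∈ G.pa S then {v i} else univ
  have hE : E.card ≤ D :=
    (card_le_card (erase_subset _ _)).trans (card_image_le.trans (hG.card_pa_le hS))
  have h₁ : 1 / (3 * ((D : ℝ) + 1)) * Fintype.card (Finset (Fin n) → Fin (D + 1))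
      ≤ (Fintype.piFinset A₁).card := by
    have := prod_mul_card_le_card_piFinset (A := A₁) (E := insert C E)
      (r := fun c => if c = C then 1 / ((D : ℝ) + 1) else D / (D + 1))
      (fun c => by split_ifs <;> positivity)
      (fun c hc => by
        rw [mem_insert, not_or] at hc
        simp [A₁, hc.1, hc.2])
      (fun c hc => by
        by_cases hcC : c = C
        · simp only [A₁, hcC, if_true, card_singleton, Fintype.card_fin]
          push_cast
          rw [one_div, inv_mul_cancel₀ (by positivity)]
        · have hcE : c ∈ E := (mem_insert.1 hc).resolve_left hcC
          simp only [A₁, hcC, if_false, hcE, if_true, card_compl, card_singleton, Fintype.card_fin]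
          push_cast
          rw [div_mul_cancel₀ _ (by positivity)])
    refine le_trans (mul_le_mul_of_nonneg_right ?_ (Nat.cast_nonneg _)) this
    rw [prod_insert (by simp [E]), if_pos rfl]
    have hprod : ∏ c ∈ E, (if c = C then 1 / ((D : ℝ) + 1) else D / (D + 1))
        = ((D : ℝ) / (D + 1)) ^ E.card := by
      rw [← prod_const]
      exact prod_congr rfl fun c hc => if_neg (mem_erase.1 hc).1
    rw [hprod]
    have hpow : 1 / 3 ≤ ((D : ℝ) / (D + 1)) ^ E.card :=
      (one_third_le_div_pow hD).trans (pow_le_pow_of_le_one (by positivity)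
        ((div_le_one (by positivity)).2 (by linarith)) hE)
    calc 1 / (3 * ((D : ℝ) + 1)) = 1 / ((D : ℝ) + 1) * (1 / 3) := by field_simp
      _ ≤ _ := mul_le_mul_of_nonneg_left hpow (by positivity)
  have h₂ : 1 / 2 ^ l * (Fintype.card (Fin n → Bool) : ℝ) ≤ (Fintype.piFinset A₂).card := by
    have := prod_mul_card_le_card_piFinset (A := A₂) (E := C) (r := fun _ => (1 / 2 : ℝ))
      (fun _ => by norm_num) (fun i hi => by simp [A₂, hi])
      (fun i hi => by simp [A₂, hi])
    refine le_trans (mul_le_mul_of_nonneg_right ?_ (Nat.cast_nonneg _)) this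
    rw [prod_const, ← one_div_pow]
    exact pow_le_pow_of_le_one (by norm_num) (by norm_num) (hG.card_componentIn_le a)
  have h₃ : 1 / (K : ℝ) ^ D * (Fintype.card (Fin n → Fin K) : ℝ) ≤ (Fintype.piFinset A₃).card := by
    have := prod_mul_card_le_card_piFinset (A := A₃) (E := G.pa S) (r := fun _ => (1 / K : ℝ))
      (fun _ => by positivity) (fun i hi => by simp [A₃, hi])
      (fun i hi => by
        simp only [A₃, hi, if_true, card_singleton, Fintype.card_fin]
        rw [one_div, inv_mul_cancel₀ hDK.ne', Nat.cast_one])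
    refine le_trans (mul_le_mul_of_nonneg_right ?_ (Nat.cast_nonneg _)) this
    rw [prod_const, ← one_div_pow]
    refine pow_le_pow_of_le_one (by positivity) ?_ (hG.card_pa_le hS)
    rw [div_le_one hDK]
    exact_mod_cast hK
  refine ⟨Fintype.piFinset A₁ ×ˢ (Fintype.piFinset A₂ ×ˢ Fintype.piFinset A₃), ?_, ?_⟩
  · rintro ⟨f, b, g⟩ hx
    simp only [mem_product, Fintype.mem_piFinset] at hx
    obtain ⟨hf, hb, hg⟩ := hx
    have hfC : f C = 0 := by simpa [A₁] using hf C
    have hbC : ∀ i ∈ C, b i = decide (i ∈ S) := fun i hi => by simpa [A₂, hi] using hb i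
    constructor
    · intro i hi
      have := ha hi
      simp [randomIntervention, componentIn_eq_of_mem this, ← hC, hfC, hbC i this, hi]
    · intro i hi
      have hgi : g i = v i := by simpa [A₃, hi] using hg i
      have hiS : i ∉ S := disjoint_right.1 (disjoint_pa G S) hi
      unfold randomIntervention
      rw [if_neg]
      · exact congrArg some hgi
      rintro ⟨h0, hbi⟩
      by_cases hiC : G.componentIn univ i = C
      · have : i ∈ C := hiC ▸ SMCG.mem_componentIn.2 ⟨mem_univ _, .refl⟩
        have hbi' := (hbC i this).symm.trans hbi
        simp [hiS] at hbi'
      · have hiE : G.componentIn univ i ∈ E := mem_erase.2 ⟨hiC, mem_image_of_mem _ hi⟩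
        have := hf (G.componentIn univ i)
        simp only [A₁, hiC, if_false, hiE, if_true, mem_compl, mem_singleton] at this
        exact this h0
  · rw [card_product, card_product, Fintype.card_prod, Fintype.card_prod, hcast]
    push_cast
    have h23 := mul_le_mul h₂ h₃ (by positivity) (by positivity)
    have h123 := mul_le_mul h₁ h23 (by positivity) (by positivity)
    refine le_trans (le_of_eq ?_) h123
    field_simp

theorem exists_covers_of_card {T : Finset (Intervention (Fin n) (Fin K))}
    {𝒮 : Finset (Finset (Fin n))}
    (h : ∀ S ∈ 𝒮, ∀ v : Fin n → Fin K, ∃ J ∈ T,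
      (∀ i ∈ S, J i = none) ∧ ∀ i ∈ G.pa S, J i = some (v i)) :
    ∃ I : Fin T.card ↪ Intervention (Fin n) (Fin K), Covers G I 𝒮 := by
  refine ⟨T.equivFin.symm.toEmbedding.trans (Function.Embedding.subtype _), fun S hS v => ?_⟩
  obtain ⟨J, hJ, h1, h2⟩ := h S hS v
  refine ⟨T.equivFin ⟨J, hJ⟩, ?_⟩
  simpa using ⟨h1, h2⟩

/-- There are at most n·Q pairs of a set and parent values, with Q = 2^l K^{ld}. After ⌈M log n⌉
greedy rounds, 1/M being the isolation probability, at most Q pairs remain, so only log n enters and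
not the logarithm of Q. As n ≥ 2 gives log n ≥ 1/2, the terms M log n, Q and the rounding contribute
6 + 2 + 2 = 10. -/
theorem exists_covers_of_inClass {d l : ℕ} (hG : G.InClass d l) (hK : 1 ≤ K)
    (hl : 1 ≤ l) (hd : 1 ≤ d) (hn : 2 ≤ n) :
    ∃ (N : ℕ) (I : Fin N ↪ Intervention (Fin n) (Fin K)), Covers G I G.districtSubsets ∧
      (N : ℝ) ≤ 10 * (2 ^ l * (K : ℝ) ^ (l * d) * (l * d) * Real.log n) := by
  classical
  let Ω := (Finset (Fin n) → Fin (l * d + 1)) × (Fin n → Bool) × (Fin n → Fin K)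
  let P := Σ S : {S // S ∈ G.districtSubsets}, ({y // y ∈ G.pa S.1} → Fin K)
  have : Nonempty (Fin K) := ⟨⟨0, hK⟩⟩
  have : Nonempty Ω := inferInstance
  have hD : 1 ≤ l * d := Nat.mul_le_mul hl hd
  have hD' : (1 : ℝ) ≤ l * d := by exact_mod_cast hD
  have hK' : (1 : ℝ) ≤ K := by exact_mod_cast hK
  have hn' : (0 : ℝ) < n := by positivity
  have hKD : (1 : ℝ) ≤ (K : ℝ) ^ (l * d) := one_le_pow₀ hK'
  have h2l : (1 : ℝ) ≤ 2 ^ l := one_le_pow₀ (by norm_num)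
  have hlog : 1 / 2 ≤ Real.log n := by
    have h1 : Real.log 2 ≤ Real.log n := Real.log_le_log (by norm_num) (by exact_mod_cast hn)
    have := Real.log_two_gt_d9
    linarith
  set M : ℝ := 3 * (l * d + 1) * 2 ^ l * (K : ℝ) ^ (l * d) with hM
  have hM1 : 1 ≤ M := by
    have : (1 : ℝ) ≤ 3 * (l * d + 1) := by linarith
    exact one_le_mul_of_one_le_of_one_le (one_le_mul_of_one_le_of_one_le this h2l) hKD
  let cov : Ω → P → Prop := fun x p =>
    (∀ i ∈ p.1.1, randomIntervention G x i = none) ∧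
      ∀ i : {y // y ∈ G.pa p.1.1}, randomIntervention G x i.1 = some (p.2 i)
  set N := ⌈M * Real.log n⌉₊ with hN
  have hfrac : ∀ p : P, ∃ s : Finset Ω, (∀ x ∈ s, cov x p) ∧
      1 / M * Fintype.card Ω ≤ s.card := by
    rintro ⟨S, p⟩
    let v : Fin n → Fin K := fun i => if h : i ∈ G.pa S.1 then p ⟨i, h⟩ else ⟨0, hK⟩
    obtain ⟨s, hs, hcard⟩ := exists_isolating_randomInterventions hG hK hD S.2 v
    refine ⟨s, fun x hx => ⟨(hs x hx).1, fun i => ?_⟩, hcard⟩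
    rw [(hs x hx).2 i.1 i.2]
    simp [v]
  obtain ⟨T, hT, hTcard⟩ := exists_small_cover cov (by positivity)
    ((div_le_one (by linarith)).2 hM1) hfrac N
  obtain ⟨I, hI⟩ := exists_covers_of_card (G := G) (T := T.image (randomIntervention G))
    (𝒮 := G.districtSubsets) (fun S hS v => by
      obtain ⟨x, hx, h1, h2⟩ := hT ⟨⟨S, hS⟩, fun y => v y.1⟩
      exact ⟨_, mem_image_of_mem _ hx, h1, fun i hi => h2 ⟨i, hi⟩⟩)
  refine ⟨_, I, hI, ?_⟩
  have hP : (Fintype.card P : ℝ) ≤ n * (2 ^ l * (K : ℝ) ^ (l * d)) := by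
    have h1 : Fintype.card P ≤ n * 2 ^ l * K ^ (l * d) := by
      rw [Fintype.card_sigma]
      refine (sum_le_card_nsmul univ _ (K ^ (l * d)) fun S _ => ?_).trans ?_
      · rw [Fintype.card_fun, Fintype.card_coe, Fintype.card_fin]
        exact Nat.pow_le_pow_right hK (hG.card_pa_le S.2)
      · rw [card_univ, Fintype.card_coe, smul_eq_mul]
        have := hG.card_districtSubsets_le
        rw [Fintype.card_fin] at this
        exact Nat.mul_le_mul_right _ this
    calc (Fintype.card P : ℝ) ≤ ((n * 2 ^ l * K ^ (l * d) : ℕ) : ℝ) := by exact_mod_cast h1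
      _ = _ := by push_cast; ring
  have hexp : Real.exp (-(1 / M * N)) ≤ 1 / n := by
    have h1 : Real.log n ≤ 1 / M * N := by
      have := Nat.le_ceil (M * Real.log n)
      rw [one_div, ← div_eq_inv_mul, le_div_iff₀ (by linarith)]
      linarith
    calc Real.exp (-(1 / M * N)) ≤ Real.exp (-Real.log n) := Real.exp_le_exp.2 (by linarith)
      _ = 1 / n := by rw [Real.exp_neg, Real.exp_log hn', one_div]
  have hprod := mul_le_mul hP hexp (Real.exp_pos _).le (by positivity)
  have hceil : (N : ℝ) < M * Real.log n + 1 := Nat.ceil_lt_add_one (by positivity)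
  have himg : ((T.image (randomIntervention G)).card : ℝ) ≤ T.card := by
    exact_mod_cast card_image_le
  set Q : ℝ := 2 ^ l * (K : ℝ) ^ (l * d) with hQ
  have hQ1 : 1 ≤ Q := one_le_mul_of_one_le_of_one_le h2l hKD
  have hsimp : (n : ℝ) * Q * (1 / n) = Q := by field_simp
  rw [hsimp] at hprod
  have hM' : M = 3 * (l * d + 1) * Q := by rw [hM, hQ]; ring
  have hML : M * Real.log n ≤ 6 * (Q * (l * d) * Real.log n) := by
    rw [hM']
    have : 0 ≤ Q * Real.log n := by positivity
    nlinarith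
  have hQL : Q ≤ 2 * (Q * (l * d) * Real.log n) := by
    have h1 : 1 / 2 ≤ (l * d) * Real.log n := by nlinarith
    nlinarith
  linarith

end CoverInDegree

/-! ### Covering interventions for graphs of bounded degree -/

open Classical in
/-- Greedy colouring. -/
theorem exists_coloring {α : Type*} [Fintype α] {R : α → α → Prop} (hR : ∀ x y, R x y → R y x)
    {Δ : ℕ} (h : ∀ x, (univ.filter fun y => R x y).card ≤ Δ) :
    ∃ χ : α → Fin (Δ + 1), ∀ x y, x ≠ y → R x y → χ x ≠ χ y := by
  suffices H : ∀ s : Finset α, ∃ χ : α → Fin (Δ + 1),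
      ∀ x ∈ s, ∀ y ∈ s, x ≠ y → R x y → χ x ≠ χ y by
    obtain ⟨χ, hχ⟩ := H univ
    exact ⟨χ, fun x y => hχ x (mem_univ _) y (mem_univ _)⟩
  intro s
  induction s using Finset.induction_on with
  | empty => exact ⟨fun _ => 0, by simp⟩
  | insert a s ha ih =>
    obtain ⟨χ, hχ⟩ := ih
    obtain ⟨k, hk⟩ : ∃ k, k ∉ (univ.filter fun y => R a y).image χ := by
      by_contra! hall
      have h1 : (univ : Finset (Fin (Δ + 1))).card ≤ ((univ.filter fun y => R a y).image χ).card :=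
        card_le_card fun k _ => hall k
      rw [card_univ, Fintype.card_fin] at h1
      have := h1.trans (card_image_le.trans (h a))
      omega
    have hk' : ∀ y, R a y → χ y ≠ k := fun y hy hyk =>
      hk (mem_image.2 ⟨y, mem_filter.2 ⟨mem_univ _, hy⟩, hyk⟩)
    refine ⟨Function.update χ a k, fun x hx y hy hxy hRxy => ?_⟩
    rcases mem_insert.1 hx with rfl | hx
    · rw [Function.update_self, Function.update_of_ne hxy.symm]
      exact (hk' y hRxy).symm
    · have hxa : x ≠ a := fun h => ha (h ▸ ‹x ∈ s›)
      rw [Function.update_of_ne hxa]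
      by_cases hya : y = a
      · subst hya
        rw [Function.update_self]
        exact hk' x (hR _ _ hRxy)
      · rw [Function.update_of_ne hya]
        exact hχ x hx y ((mem_insert.1 hy).resolve_left hya) hxy hRxy

theorem exists_injOn_fin {α : Type*} {k : ℕ} (hk : 1 ≤ k) (s : Finset α) (h : s.card ≤ k) :
    ∃ f : α → Fin k, Set.InjOn f s := by
  classical
  refine ⟨fun x => if hx : x ∈ s then Fin.castLE h (s.equivFin ⟨x, hx⟩) else ⟨0, hk⟩, ?_⟩
  intro x hx y hy hxy
  simp only [mem_coe] at hx hy
  simpa [hx, hy] using hxy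

section CoverDegree

variable {n K : ℕ} {U : Type*} [Fintype U] {G : SMCG (Fin n) U}

/-- `c` and `c'` are c-components of `G`, and `c` together with its parents meets `c'` together with
its parents. -/
def Touches (G : SMCG (Fin n) U) (c c' : Finset (Fin n)) : Prop :=
  (∃ i, c = G.componentIn univ i) ∧ (∃ i, c' = G.componentIn univ i) ∧
    ∃ y, y ∈ c ∪ G.pa c ∧ y ∈ c' ∪ G.pa c'

theorem Touches.symm {c c' : Finset (Fin n)} (h : Touches G c c') : Touches G c' c := by
  obtain ⟨h1, h2, y, h3, h4⟩ := h
  exact ⟨h2, h1, y, h4, h3⟩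

-- A component touching c shares with it a vertex y of c ∪ Pa(c), of which there are at most l + ld.
-- Given y, it is the component of y or that of a child of y. The bound on the number of children
-- enters here.
open Classical in
theorem card_touches_le {d l : ℕ} (hG : G.InClass d l) (hd : G.MaxDegreeLE d)
    (c : Finset (Fin n)) :
    (univ.filter fun c' => Touches G c c').card ≤ (l * d + l) * (1 + d) := by
  by_cases hc : ∃ i, c = G.componentIn univ i
  · obtain ⟨a, rfl⟩ := hc
    set c := G.componentIn univ a
    have hgood : c ∈ G.districtSubsets := SMCG.componentIn_mem_districtSubsets _ _
    let F : Fin n → Finset (Finset (Fin n)) := fun y => insert (G.componentIn univ y)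
      ((univ.filter fun z : Fin n => G.edge (Sum.inl y) (Sum.inl z)).image (G.componentIn univ))
    have hsub : (univ.filter fun c' => Touches G c c') ⊆ (c ∪ G.pa c).biUnion F := by
      intro c' hc'
      obtain ⟨-, ⟨i, rfl⟩, y, hy, hy'⟩ := (mem_filter.1 hc').2
      refine mem_biUnion.2 ⟨y, hy, ?_⟩
      rcases mem_union.1 hy' with hy' | hy'
      · exact mem_insert.2 (Or.inl (componentIn_eq_of_mem hy').symm)
      · simp only [SMCG.pa, mem_filter, mem_univ, true_and] at hy'
        obtain ⟨-, z, hz, he⟩ := hy'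
        exact mem_insert.2 (Or.inr (mem_image.2 ⟨z, by simpa using he, componentIn_eq_of_mem hz⟩))
    refine (card_le_card hsub).trans ((card_biUnion_le_card_mul _ _ (1 + d) fun y _ => ?_).trans
      (Nat.mul_le_mul_right _ ?_))
    · refine (card_insert_le _ _).trans ?_
      rw [add_comm]
      refine Nat.add_le_add_left (card_image_le.trans ?_) _
      refine le_trans (le_of_eq ?_) ((Nat.le_add_left _ _).trans (hd y))
      unfold SMCG.outDegree
      congr!
    · rw [add_comm]
      exact (card_union_le _ _).trans (add_le_add (hG.card_le hgood) (hG.card_pa_le hgood))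
  · have : (univ.filter fun c' => Touches G c c') = ∅ := by
      ext c'
      simp only [mem_filter, mem_univ, true_and, notMem_empty, iff_false]
      exact fun h => hc h.1
    rw [this]
    exact Nat.zero_le _

theorem subset_union_pa {S c : Finset (Fin n)} (h : S ⊆ c) : G.pa S ⊆ c ∪ G.pa c := by
  intro y hy
  simp only [SMCG.pa, mem_union, mem_filter, mem_univ, true_and] at hy ⊢
  obtain ⟨-, x, hx, he⟩ := hy
  by_cases hyc : y ∈ c
  · exact Or.inl hyc
  · exact Or.inr ⟨hyc, x, h hx, he⟩

open Classical in
/-- In every component `c` of colour `k` the vertices selected by `σ` are left free, and their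
parents are set to values that are read off from `g`. -/
noncomputable def colourIntervention (G : SMCG (Fin n) U) {q l D : ℕ}
    (χ : Finset (Fin n) → Fin q) (pos : Fin n → Fin l) (idx : Finset (Fin n) → Fin n → Fin D)
    (a₀ : Fin K) (x : Fin q × (Fin l → Bool) × (Fin D → Fin K)) : Intervention (Fin n) (Fin K) :=
  fun i =>
    if χ (G.componentIn univ i) = x.1 ∧ x.2.1 (pos i) = true then none
    -- The chosen b may be ambiguous here. For the colourings used later its component is unique,
    -- since touching components have different colours. `pos` and `idx` translate patterns of fixed
    -- length, shared by all components, into choices of vertices and values of parents.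
    else if h : ∃ b, χ (G.componentIn univ b) = x.1 ∧
        i ∈ G.pa ((G.componentIn univ b).filter fun j => x.2.1 (pos j) = true) then
      some (x.2.2 (idx ((G.componentIn univ h.choose).filter fun j => x.2.1 (pos j) = true) i))
    else some a₀

/-- Components of one colour have pairwise disjoint sets c ∪ Pa(c), so a single intervention can
treat all of them with the same pattern. Running through all colours, selections in {0,1}^l and
values in Σ^{ld} isolates everything, and the number of these does not depend on n. -/
theorem exists_covers_of_maxDegreeLE {d l : ℕ} (hG : G.InClass d l) (hdeg : G.MaxDegreeLE d)
    (hK : 1 ≤ K) (hl : 1 ≤ l) (hd : 1 ≤ d) :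
    ∃ (N : ℕ) (I : Fin N ↪ Intervention (Fin n) (Fin K)), Covers G I G.districtSubsets ∧
      (N : ℝ) ≤ 5 * (2 ^ l * (K : ℝ) ^ (l * d) * (l * d ^ 2)) := by
  classical
  obtain ⟨Δ, hΔ⟩ : ∃ Δ, Δ = (l * d + l) * (1 + d) := ⟨_, rfl⟩
  obtain ⟨χ, hχ⟩ := exists_coloring (R := Touches G) (Δ := Δ) (fun _ _ h => h.symm)
    (fun c => hΔ ▸ card_touches_le hG hdeg c)
  have hpos : ∃ pos : Fin n → Fin l, ∀ a, Set.InjOn pos (G.componentIn univ a) := by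
    choose e he using fun c : {c : Finset (Fin n) // c.card ≤ l} => exists_injOn_fin hl c.1 c.2
    refine ⟨fun i => e ⟨G.componentIn univ i, hG.card_componentIn_le i⟩ i, ?_⟩
    intro a i hi j hj hij
    have hi' := componentIn_eq_of_mem hi
    have hj' := componentIn_eq_of_mem hj
    simp only [hi', hj'] at hij
    exact he ⟨G.componentIn univ a, hG.card_componentIn_le a⟩ hi hj hij
  obtain ⟨pos, hpos⟩ := hpos
  have hidx : ∃ idx : Finset (Fin n) → Fin n → Fin (l * d), ∀ S ∈ G.districtSubsets,
      Set.InjOn (idx S) (G.pa S) := by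
    choose e he using fun S : {S // S ∈ G.districtSubsets} =>
      exists_injOn_fin (Nat.mul_le_mul hl hd) (G.pa S.1) (hG.card_pa_le S.2)
    refine ⟨fun S => if h : S ∈ G.districtSubsets then e ⟨S, h⟩ else fun _ =>
      ⟨0, Nat.mul_le_mul hl hd⟩, fun S hS => ?_⟩
    simp only [dif_pos hS]
    exact he ⟨S, hS⟩
  obtain ⟨idx, hidx⟩ := hidx
  let Ω := Fin (Δ + 1) × (Fin l → Bool) × (Fin (l * d) → Fin K)
  let J : Ω → Intervention (Fin n) (Fin K) := colourIntervention G χ pos idx ⟨0, hK⟩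
  obtain ⟨I, hI⟩ := exists_covers_of_card (G := G) (T := univ.image J) (𝒮 := G.districtSubsets) (by
    intro S hS v
    obtain ⟨a, ha⟩ := SMCG.mem_districtSubsets.1 hS
    set c := G.componentIn univ a with hc
    -- The patterns that isolate S in its component c: σ selects the positions of S, and g lists the
    -- values of v on Pa(S) in the order of `idx S`.
    let σ : Fin l → Bool := fun t => decide (∃ i ∈ S, pos i = t)
    let g : Fin (l * d) → Fin K := fun t =>
      if h : ∃ y, y ∈ G.pa S ∧ idx S y = t then v h.choose else ⟨0, hK⟩
    have hσ : ∀ i ∈ c, (σ (pos i) = true ↔ i ∈ S) := by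
      intro i hi
      simp only [σ, decide_eq_true_eq]
      exact ⟨fun ⟨j, hj, hji⟩ => hpos a (ha hj) hi hji ▸ hj, fun h => ⟨i, h, rfl⟩⟩
    have hfilter : (c.filter fun j => σ (pos j) = true) = S := by
      ext i
      rw [mem_filter]
      exact ⟨fun h => (hσ i h.1).1 h.2, fun h => ⟨ha h, (hσ i (ha h)).2 h⟩⟩
    -- Two components of the same colour that share a vertex of their closed parent sets coincide,
    -- because they touch.
    have huniq : ∀ b y, χ (G.componentIn univ b) = χ c →
        y ∈ G.componentIn univ b ∪ G.pa (G.componentIn univ b) → y ∈ c ∪ G.pa c →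
        G.componentIn univ b = c := by
      intro b y hb hy hy'
      by_contra hne
      exact hχ _ _ hne ⟨⟨b, rfl⟩, ⟨a, hc⟩, y, hy, hy'⟩ hb
    refine ⟨J (χ c, σ, g), mem_image_of_mem _ (mem_univ _), fun i hi => ?_, fun y hy => ?_⟩
    · refine if_pos ⟨?_, (hσ i (ha hi)).2 hi⟩
      rw [componentIn_eq_of_mem (ha hi)]
    · have hyc : y ∈ c ∪ G.pa c := subset_union_pa ha hy
      have hyS : y ∉ S := disjoint_right.1 (disjoint_pa G S) hy
      have hex : ∃ b, χ (G.componentIn univ b) = χ c ∧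
          y ∈ G.pa ((G.componentIn univ b).filter fun j => σ (pos j) = true) := by
        refine ⟨a, rfl, ?_⟩
        rw [← hc, hfilter]
        exact hy
      have hch : G.componentIn univ hex.choose = c :=
        huniq _ y hex.choose_spec.1
          (subset_union_pa (filter_subset _ _) hex.choose_spec.2) hyc
      -- A parent of S left free would lie in a component of colour χ c meeting c ∪ Pa(c), that is,
      -- in c itself; but there σ frees only S.
      have hnot : ¬ (χ (G.componentIn univ y) = χ c ∧ σ (pos y) = true) := by
        rintro ⟨h1, h2⟩
        have hself : y ∈ G.componentIn univ y := SMCG.mem_componentIn.2 ⟨mem_univ _, .refl⟩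
        have h3 := huniq y y h1 (mem_union_left _ hself) hyc
        exact hyS ((hσ y (h3 ▸ hself)).1 h2)
      have hgy : g (idx S y) = v y := by
        have hex' : ∃ z, z ∈ G.pa S ∧ idx S z = idx S y := ⟨y, hy, rfl⟩
        simp only [g, dif_pos hex']
        rw [hidx S hS hex'.choose_spec.1 hy hex'.choose_spec.2]
      refine (if_neg hnot).trans ((dif_pos hex).trans ?_)
      dsimp only
      rw [hch, hfilter, hgy])
  refine ⟨_, I, hI, ?_⟩
  have hcard : (univ.image J).card ≤ (Δ + 1) * (2 ^ l * K ^ (l * d)) := by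
    refine card_image_le.trans ?_
    simp [Ω, card_univ]
  -- Δ + 1 = ld² + 2ld + l + 1, five terms each at most ld².
  have hΔ' : Δ + 1 ≤ 5 * (l * d ^ 2) := by
    have h1 : l ≤ l * d := Nat.le_mul_of_pos_right l hd
    have h2 : 1 ≤ l * d ^ 2 := Nat.mul_le_mul hl (Nat.one_le_pow _ _ hd)
    have h3 : l * d ≤ l * d ^ 2 := Nat.mul_le_mul_left _ (Nat.le_self_pow (by norm_num) _)
    have : Δ = l * d + l * d ^ 2 + l + l * d := by rw [hΔ]; ring
    omega
  calc ((univ.image J).card : ℝ) ≤ ((5 * (l * d ^ 2) * (2 ^ l * K ^ (l * d)) : ℕ) : ℝ) := by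
        exact_mod_cast hcard.trans (Nat.mul_le_mul_right _ hΔ')
    _ = _ := by push_cast; ring

end CoverDegree

/-! ### A one-letter alphabet -/

section OneLetter

variable {n : ℕ} {U : Type*} {G : SMCG (Fin n) U}

/-- The algorithm for an alphabet with one letter: all entries of the table are `1`. -/
def oneLetterLearner (G : SMCG (Fin n) U) : Learner G 1 where
  numInterventions := 0
  intervention := Function.Embedding.ofIsEmpty
  numSamples := 0
  program := [.const 0 1, .const 1 1]
  layout _ _ _ := 0

theorem oneLetterLearner_haltsAt (ω : (oneLetterLearner G).Samples) :
    RAM.HaltsAt (oneLetterLearner G).program ((oneLetterLearner G).start ω)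
      ⟨2, RAM.runMem ((oneLetterLearner G).startMem ω) (oneLetterLearner G).program, 5⟩ := by
  refine RAM.haltsAt_of_straight (p := (oneLetterLearner G).program) (fun i hi => ?_) _
  simp only [oneLetterLearner, List.mem_cons, List.not_mem_nil, or_false] at hi
  rcases hi with rfl | rfl <;> exact fun _ _ => rfl

/-- Two units for storing the program and 2 + 3 for running it. -/
theorem oneLetterLearner_runsInTime {T : ℝ} (hT : 7 ≤ T) :
    (oneLetterLearner G).RunsInTime T := by
  intro ω
  refine ⟨_, oneLetterLearner_haltsAt ω, le_trans (le_of_eq ?_) hT⟩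
  simp [oneLetterLearner]

theorem oneLetterLearner_learns [Fintype U] {ε : ℝ} (hε : 0 < ε) :
    (oneLetterLearner G).Learns ε := by
  intro X
  obtain ⟨ρ, hρ⟩ := G.exists_isTopological
  refine two_thirds_le_of_expectation_le (Ω := Fin 0 → Fin 0 → Fin n → Fin 1)
    (W := fun ω => ∏ j, ∏ s, X.doProb ((oneLetterLearner G).intervention j) (ω j s))
    (Z := fun _ => 0) (θ := 1)
    (fun ω => prod_nonneg fun _ _ => prod_nonneg fun _ _ => X.doProb_nonneg _ _) ?_
    (fun _ => le_rfl) one_pos (by simp) ?_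
  · exact sum_prod_eq_one fun j => sum_prod_eq_one fun _ => X.sum_doProb hρ _
  · intro ω _
    refine ⟨_, oneLetterLearner_haltsAt ω, fun I => ?_⟩
    have ho : ∀ w, LocalTable.oracle ((oneLetterLearner G).table
        (RAM.runMem ((oneLetterLearner G).startMem ω) (oneLetterLearner G).program)) I w = 1 := by
      intro w
      refine prod_eq_one fun S _ => ?_
      simp [Learner.table, oneLetterLearner, RAM.runMem, RAM.newMem]
    have hX : ∀ w, X.doProbFree I w = 1 := by
      intro w
      have := I.sum_fill (v := fun _ => 0) (fun _ _ _ => Subsingleton.elim _ _)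
        (X.cFactor I.free)
      rw [X.sumOver_cFactor_self hρ, Fintype.sum_unique] at this
      rw [X.doProbFree_eq, ← this]
      congr 1
      exact Subsingleton.elim _ _
    refine ⟨⟨fun w => by rw [ho]; exact zero_le_one, ?_⟩, ?_⟩
    · simp only [ho]
      simp
    · simp only [tvDist, ho, hX]
      simpa using hε

end OneLetter

/-! ### Numerical estimates -/

/-- The bit length is at most 1 + log₂ B, and 1/log 2 < 3/2. -/
theorem size_le_log {B : ℕ} (hB : 1 ≤ B) : (B.size : ℝ) ≤ 1 + 3 / 2 * Real.log B := by
  have h1 : 1 ≤ B.size := Nat.size_pos.2 hB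
  have h2 : 2 ^ (B.size - 1) ≤ B := Nat.lt_size.1 (by omega)
  have h3 : ((2 : ℝ) ^ (B.size - 1)) ≤ B := by exact_mod_cast h2
  have h4 := Real.log_le_log (by positivity) h3
  rw [Real.log_pow, Nat.cast_sub h1, Nat.cast_one] at h4
  have h5 := Real.log_two_gt_d9
  have h6 : (1 : ℝ) ≤ B.size := by exact_mod_cast h1
  nlinarith

/-- All numbers handled by the algorithm have polylogarithmic length. -/
theorem size_bound {n l K m N P B : ℕ} {T Λ : ℝ} (hT : 128 ≤ T) (hΛ : Λ = Real.log T)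
    (hΛ4 : 4 ≤ Λ) (hlΛ : (l : ℝ) ≤ 2 * Λ) (hK : 1 ≤ K)
    (hS : (N : ℝ) * m * n ≤ 240 * Λ ^ 3 * T) (hP : (P : ℝ) ≤ 1824 * Λ ^ 2 * T)
    (hm : (m : ℝ) ≤ 12 * T) (hKT : (K : ℝ) ≤ T) (hB : B = N * m * n + P + (m + K) ^ l) :
    (B.size : ℝ) ≤ 10 * Λ ^ 2 := by
  have hT1 : 1 ≤ T := by linarith
  have hT0 : 0 ≤ T := by linarith
  have hΛ0 : 0 ≤ Λ := by linarith
  have hTT : 128 * T ≤ T ^ 2 := by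
    rw [sq]
    exact mul_le_mul_of_nonneg_right hT hT0
  have hΛT : Λ ≤ T := by
    rw [hΛ]
    exact Real.log_le_self hT0
  have h1 : (N : ℝ) * m * n + P ≤ T ^ 6 := by
    have h2 : Λ ^ 3 ≤ T ^ 3 := pow_le_pow_left₀ hΛ0 hΛT 3
    have h3 : Λ ^ 2 ≤ T ^ 3 := (pow_le_pow_left₀ hΛ0 hΛT 2).trans
      (pow_le_pow_right₀ hT1 (by norm_num))
    calc (N : ℝ) * m * n + P ≤ 240 * Λ ^ 3 * T + 1824 * Λ ^ 2 * T := by linarith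
      _ ≤ 240 * T ^ 3 * T + 1824 * T ^ 3 * T := by gcongr
      _ = T ^ 4 * 2064 := by ring
      _ ≤ T ^ 4 * T ^ 2 := by
          gcongr
          linarith
      _ = T ^ 6 := by ring
  -- m + K ≤ 13T ≤ T² because T ≥ 128. As l is at most 2 log T, the exponent 2l makes log B
  -- quadratic in log T.
  have h2 : ((m : ℝ) + K) ^ l ≤ T ^ (2 * l) := by
    rw [pow_mul]
    gcongr
    linarith
  have h3 : (1 : ℝ) ≤ T ^ 6 := one_le_pow₀ hT1
  have h4 : (1 : ℝ) ≤ T ^ (2 * l) := one_le_pow₀ hT1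
  have hBc : (B : ℝ) = N * m * n + P + (m + K) ^ l := by rw [hB]; push_cast; ring
  have hBT : (B : ℝ) ≤ T ^ (2 * l + 8) := by
    rw [hBc]
    calc (N : ℝ) * m * n + P + (m + K) ^ l ≤ T ^ 6 * T ^ (2 * l) + T ^ 6 * T ^ (2 * l) :=
          add_le_add (h1.trans (le_mul_of_one_le_right (by linarith) h4))
            (h2.trans (le_mul_of_one_le_left (by linarith) h3))
      _ = (T ^ (2 * l) * T ^ 6) * 2 := by ring
      _ ≤ (T ^ (2 * l) * T ^ 6) * T ^ 2 := by
          gcongr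
          linarith
      _ = _ := by ring
  have hB1 : 1 ≤ B := by
    have : 0 < (m + K) ^ l := Nat.pow_pos (by omega)
    omega
  have h5 := Real.log_le_log (by exact_mod_cast hB1) hBT
  rw [Real.log_pow, ← hΛ] at h5
  push_cast at h5
  have h6 := size_le_log hB1
  have h7 : (2 * (l : ℝ) + 8) * Λ ≤ (6 * Λ) * Λ := mul_le_mul_of_nonneg_right (by linarith) hΛ0
  have h8 : 4 * 4 ≤ Λ * Λ := mul_le_mul hΛ4 hΛ4 (by norm_num) hΛ0
  rw [sq]
  linarith

/-- The bounds on the numbers of samples and on the running time. `k`, `q` and `w` stand for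
`K ^ (l * d)`, `K ^ l` and `2 ^ l`, and `H` for `1 / ε ^ 2`. -/
theorem time_bound {n l K m N P B : ℕ} {k q w H E T Λ D : ℝ} (hn : 1 ≤ n) (hl : 1 ≤ l)
    (hK : 2 ≤ K) (hk : 1 ≤ k) (hw : 1 ≤ w) (hwq : w ≤ q) (hKq : K ≤ q) (hH : 1 ≤ H)
    (hEH : E ≤ 2 * H) (hm1 : 1 ≤ m) (hm : (m : ℝ) = 6 * n ^ 2 * w * k ^ 2 * q * E)
    (hT : T = w * (k * q) ^ 3 * n ^ 3 * H ^ 2) (hT128 : 128 ≤ T) (hΛ : Λ = Real.log T)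
    (hΛ4 : 4 ≤ Λ) (hlΛ : (l : ℝ) ≤ 2 * Λ) (hD1 : 0 ≤ D) (hDΛ : D ≤ Λ ^ 2)
    (hN : (N : ℝ) ≤ 10 * (w * k * D * (1 + Real.log n)))
    (hP : (P : ℝ) = n * w * (k * q) * 2 * (l * (m * (12 * l + 2) + 4) + 1))
    (hB : B = N * m * n + P + (m + K) ^ l) :
    ((N * n + N * m * n + P + P * (1 + 6 * B.size) : ℕ) : ℝ) ≤ 10 ^ 6 * (T * Λ ^ 4) := by
  have hn' : (1 : ℝ) ≤ n := by exact_mod_cast hn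
  have hl' : (1 : ℝ) ≤ l := by exact_mod_cast hl
  have hm1' : (1 : ℝ) ≤ m := by exact_mod_cast hm1
  have hq : 1 ≤ q := hw.trans hwq
  have hK' : (2 : ℝ) ≤ K := by exact_mod_cast hK
  have hT0 : 0 < T := by linarith
  have hm12 : (m : ℝ) ≤ 12 * (n ^ 2 * w * k ^ 2 * q * H) := by
    rw [hm]
    have : 0 ≤ n ^ 2 * w * k ^ 2 * q := by positivity
    nlinarith
  have hnT : (n : ℝ) ≤ T := by
    rw [hT]
    have h1 : (1 : ℝ) ≤ w * (k * q) ^ 3 := one_le_mul_of_one_le_of_one_le hw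
      (one_le_pow₀ (one_le_mul_of_one_le_of_one_le hk hq))
    have h2 : (n : ℝ) ≤ n ^ 3 := le_self_pow₀ hn' (by norm_num)
    calc (n : ℝ) = 1 * n * 1 := by ring
      _ ≤ w * (k * q) ^ 3 * n ^ 3 * H ^ 2 := by
        gcongr
        exact one_le_pow₀ hH
  have hlogn : Real.log n ≤ Λ := hΛ ▸ Real.log_le_log (by linarith) hnT
  have hlogn0 : 0 ≤ Real.log n := Real.log_nonneg hn'
  -- the common factor of all estimates
  have hcore : (n : ℝ) ^ 3 * w ^ 2 * k ^ 3 * q ^ 2 * H ≤ T := by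
    rw [hT]
    calc (n : ℝ) ^ 3 * w ^ 2 * k ^ 3 * q ^ 2 * H
        = w * k ^ 3 * q ^ 2 * n ^ 3 * (w * H) := by ring
      -- K ≥ 2 gives 2^l ≤ K^l, so the third power of K^l in T pays for the second factor 2^l of the
      -- left side.
      _ ≤ w * k ^ 3 * q ^ 2 * n ^ 3 * (q * H ^ 2) := by
        gcongr
        exact le_self_pow₀ hH (by norm_num)
      _ = _ := by ring
  have hmT : (m : ℝ) ≤ 12 * T := by
    refine hm12.trans (mul_le_mul_of_nonneg_left (le_trans ?_ hcore) (by norm_num))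
    gcongr
    · norm_num
    · exact le_self_pow₀ hw (by norm_num)
    · norm_num
    · exact le_self_pow₀ hq (by norm_num)
  have hKT : (K : ℝ) ≤ T := by
    rw [hT]
    calc (K : ℝ) ≤ 1 * q * 1 * 1 := by linarith
      _ ≤ w * (k * q) ^ 3 * n ^ 3 * H ^ 2 := by
        gcongr
        · calc q ≤ k * q := le_mul_of_one_le_left (by linarith) hk
            _ ≤ (k * q) ^ 3 := le_self_pow₀ (one_le_mul_of_one_le_of_one_le hk hq) (by norm_num)
        · exact one_le_pow₀ hn'
        · exact one_le_pow₀ hH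
  have hS : (N : ℝ) * m * n ≤ 240 * Λ ^ 3 * T := by
    calc (N : ℝ) * m * n
        ≤ (10 * (w * k * D * (1 + Real.log n))) * (12 * (n ^ 2 * w * k ^ 2 * q * H)) * n := by
          gcongr
      _ = 120 * (D * (1 + Real.log n)) * (n ^ 3 * w ^ 2 * k ^ 3 * q * H) := by ring
      _ ≤ 120 * (Λ ^ 2 * (2 * Λ)) * T := by
          gcongr
          · linarith
          · refine le_trans ?_ hcore
            gcongr
            exact le_self_pow₀ hq (by norm_num)
      _ = _ := by ring
  have hPT : (P : ℝ) ≤ 1824 * Λ ^ 2 * T := by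
    have h1 : (l : ℝ) * (m * (12 * l + 2) + 4) + 1 ≤ 19 * (l ^ 2 * m) := by
      have h2 : (1 : ℝ) ≤ l * m := one_le_mul_of_one_le_of_one_le hl' hm1'
      have h3 : (l : ℝ) * m ≤ l ^ 2 * m := by
        gcongr
        exact le_self_pow₀ hl' (by norm_num)
      have h4 : (l : ℝ) ≤ l ^ 2 * m := by
        calc (l : ℝ) = l * 1 := by ring
          _ ≤ l * (l * m) := by gcongr
          _ = _ := by ring
      nlinarith
    calc (P : ℝ) ≤ n * w * (k * q) * 2 * (19 * (l ^ 2 * (12 * (n ^ 2 * w * k ^ 2 * q * H)))) := by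
          rw [hP]
          gcongr
          refine h1.trans ?_
          gcongr
      _ = 456 * l ^ 2 * (n ^ 3 * w ^ 2 * k ^ 3 * q ^ 2 * H) := by ring
      _ ≤ 456 * (2 * Λ) ^ 2 * T := by gcongr
      _ = _ := by ring
  have hsize := size_bound hT128 hΛ hΛ4 hlΛ (by omega) hS hPT hmT hKT hB
  have hNn : (N : ℝ) * n ≤ N * m * n := by
    have : (N : ℝ) * n * 1 ≤ N * n * m := by gcongr
    linarith
  push_cast
  have hΛ34 : Λ ^ 3 * T ≤ Λ ^ 4 * T := by
    gcongr
    · linarith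
    · norm_num
  -- The program length and the size of the numbers each contribute Λ²; this product fixes the
  -- exponent 4 of the logarithm.
  have hPs : (P : ℝ) * (1 + 6 * B.size) ≤ 1824 * Λ ^ 2 * T * (61 * Λ ^ 2) := by
    gcongr
    nlinarith
  have hΛ24 : Λ ^ 2 * T ≤ Λ ^ 4 * T := by
    gcongr
    · linarith
    · norm_num
  have hprod : 1824 * Λ ^ 2 * T * (61 * Λ ^ 2) = 111264 * (Λ ^ 4 * T) := by ring
  have h0 : 0 ≤ Λ ^ 4 * T := by positivity
  linarith [mul_comm T (Λ ^ 4)]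

/-- Bernoulli: (3/2)^l ≥ 1 + l/2. This is the origin of 3^l in the bound on the interventions: it
absorbs the factor l in front of 2^l. -/
theorem mul_two_pow_le (l : ℕ) : (l : ℝ) * 2 ^ l ≤ 2 * 3 ^ l := by
  have h := one_add_mul_le_pow (show (-2 : ℝ) ≤ 1 / 2 by norm_num) l
  have h2 : (3 : ℝ) ^ l = (1 + 1 / 2) ^ l * 2 ^ l := by
    rw [← mul_pow]
    norm_num
  rw [h2]
  have : (l : ℝ) ≤ 2 * (1 + 1 / 2) ^ l := by linarith
  calc (l : ℝ) * 2 ^ l ≤ 2 * (1 + 1 / 2) ^ l * 2 ^ l := by gcongr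
    _ = _ := by ring

/-! ### The main theorem -/

/-- Both parts share this step. The bound `hN` is weak enough to hold for either family of
interventions and still strong enough for the running time. -/
theorem exists_learner_of_covers {n d l K N : ℕ} {U : Type*} [Fintype U] {G : SMCG (Fin n) U}
    {ε : ℝ} (hn : 1 ≤ n) (hd : 1 ≤ d) (hK : 2 ≤ K) (hG : G.InClass d l) (hε : 0 < ε) (hε1 : ε ≤ 1)
    (I : Fin N ↪ Intervention (Fin n) (Fin K)) (hI : Covers G I G.districtSubsets)
    (hN : (N : ℝ) ≤ 10 * (2 ^ l * (K : ℝ) ^ (l * d) * (l * d ^ 2) * (1 + Real.log n)))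
    {M T : ℝ} (hM : M = (K : ℝ) ^ (l * (2 * d + 3)) * (n : ℝ) ^ 2 / ε ^ 4)
    (hT : T = (2 : ℝ) ^ l * (K : ℝ) ^ (l * (3 * d + 3)) * (n : ℝ) ^ 3 / ε ^ 4) :
    ∃ L : Learner G K, L.numInterventions = N ∧
      (L.numSamples : ℝ) ≤ 10 ^ 6 * (M * Real.log M ^ 4) ∧
      L.RunsInTime (10 ^ 6 * (T * Real.log T ^ 4)) ∧ L.Learns ε := by
  have : Nonempty (Fin n) := ⟨⟨0, hn⟩⟩
  have hl : 1 ≤ l := hG.one_le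
  obtain ⟨ρ, hρ⟩ := G.exists_isTopological
  let a : Fin K := ⟨0, by omega⟩
  -- The empty set also has to be isolated, so there is at least one intervention.
  obtain ⟨j₀, -⟩ := hI ∅ (SMCG.mem_districtSubsets.2 ⟨⟨0, hn⟩, empty_subset _⟩) (fun _ => a)
  obtain ⟨pick, hpick⟩ := hI.exists_isolates j₀
  -- A sample size of order ε⁻² is enough; the stated bounds allow ε⁻⁴.
  set E := ⌈1 / ε ^ 2⌉₊ with hE
  set m := 6 * n ^ 2 * 2 ^ l * (K ^ (l * d)) ^ 2 * K ^ l * E with hm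
  set k : ℝ := (K : ℝ) ^ (l * d) with hk
  set q : ℝ := (K : ℝ) ^ l with hq
  set w : ℝ := (2 : ℝ) ^ l with hw
  set H : ℝ := 1 / ε ^ 2 with hH
  have hn' : (1 : ℝ) ≤ n := by exact_mod_cast hn
  have hK' : (2 : ℝ) ≤ K := by exact_mod_cast hK
  have hd' : (1 : ℝ) ≤ d := by exact_mod_cast hd
  have hl' : (1 : ℝ) ≤ l := by exact_mod_cast hl
  have hk1 : 1 ≤ k := one_le_pow₀ (by linarith)
  have hw2 : 2 ≤ w := by
    calc (2 : ℝ) = 2 ^ 1 := by ring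
      _ ≤ 2 ^ l := pow_le_pow_right₀ (by norm_num) hl
  have hwq : w ≤ q := pow_le_pow_left₀ (by norm_num) hK' l
  have hwk : w ≤ k := hwq.trans (pow_le_pow_right₀ (by linarith) (Nat.le_mul_of_pos_right l hd))
  have hqk : q ≤ k := pow_le_pow_right₀ (by linarith) (Nat.le_mul_of_pos_right l hd)
  have hKq : (K : ℝ) ≤ q := le_self_pow₀ (by linarith) (by omega)
  have hq1 : 1 ≤ q := by linarith
  have hH1 : 1 ≤ H := by
    rw [hH, le_div_iff₀ (by positivity), one_mul]
    exact pow_le_one₀ hε.le hε1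
  have hEH : (E : ℝ) ≤ 2 * H := by
    have := Nat.ceil_lt_add_one (show 0 ≤ 1 / ε ^ 2 by positivity)
    rw [← hE] at this
    linarith
  have hHE : H ≤ E := Nat.le_ceil _
  have hmr : (m : ℝ) = 6 * n ^ 2 * w * k ^ 2 * q * E := by
    rw [hm]
    push_cast
    ring
  have hE1 : (1 : ℝ) ≤ E := hH1.trans hHE
  have hm1 : 1 ≤ m := by
    have hE1' : 1 ≤ E := by exact_mod_cast hE1
    have : 0 < K := by omega
    have : 0 < E := hE1'
    have : 0 < n := hn
    have : 0 < m := by rw [hm]; positivity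
    exact this
  have hM' : M = k ^ 2 * q ^ 3 * n ^ 2 * H ^ 2 := by
    rw [hM, hk, hq, hH, ← pow_mul, ← pow_mul, ← pow_add]
    rw [show l * d * 2 + l * 3 = l * (2 * d + 3) by ring]
    field_simp
  have hT' : T = w * (k * q) ^ 3 * n ^ 3 * H ^ 2 := by
    rw [hT, hk, hq, hH, ← pow_add, ← pow_mul]
    rw [show (l * d + l) * 3 = l * (3 * d + 3) by ring]
    field_simp
  have hk2 : 2 ≤ k := hw2.trans hwk
  have hq2 : 2 ≤ q := hw2.trans hwq
  have hM32 : 32 ≤ M := by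
    rw [hM']
    calc (32 : ℝ) = 2 ^ 2 * 2 ^ 3 * 1 ^ 2 * 1 ^ 2 := by norm_num
      _ ≤ k ^ 2 * q ^ 3 * n ^ 2 * H ^ 2 := by gcongr
  have hT128 : 128 ≤ T := by
    rw [hT']
    calc (128 : ℝ) = 2 * (2 * 2) ^ 3 * 1 ^ 3 * 1 ^ 2 := by norm_num
      _ ≤ w * (k * q) ^ 3 * n ^ 3 * H ^ 2 := by gcongr
  have hlog2 := Real.log_two_gt_d9
  have hlogM : 1 ≤ Real.log M := by
    have h1 := Real.log_le_log (by norm_num) hM32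
    rw [show (32 : ℝ) = 2 ^ 5 by norm_num, Real.log_pow] at h1
    push_cast at h1
    linarith
  have hlogT : 4 ≤ Real.log T := by
    have h1 := Real.log_le_log (by norm_num) hT128
    rw [show (128 : ℝ) = 2 ^ 7 by norm_num, Real.log_pow] at h1
    push_cast at h1
    linarith
  -- 2^{3ld} ≤ T and 3 log 2 > 1. So polynomial factors in l and d disappear in powers of log T.
  have hldT : (l : ℝ) * d ≤ Real.log T := by
    have h1 : (2 : ℝ) ^ (3 * (l * d)) ≤ T := by
      calc (2 : ℝ) ^ (3 * (l * d)) ≤ (K : ℝ) ^ (3 * (l * d)) :=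
            pow_le_pow_left₀ (by norm_num) hK' _
        _ = 1 * (k * 1) ^ 3 * 1 ^ 3 * 1 ^ 2 := by rw [hk]; ring
        _ ≤ w * (k * q) ^ 3 * n ^ 3 * H ^ 2 := by
            gcongr
            linarith
        _ = T := hT'.symm
    have h2 := Real.log_le_log (by positivity) h1
    rw [Real.log_pow] at h2
    push_cast at h2
    have h3 : (0 : ℝ) ≤ l * d := by positivity
    nlinarith
  have hlT : (l : ℝ) ≤ 2 * Real.log T := by
    have : (l : ℝ) * 1 ≤ l * d := by gcongr
    linarith
  set P := n * 2 ^ l * (K ^ (l * d) * K ^ l) * 2 * (l * (m * (12 * l + 2) + 4) + 1) with hP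
  refine ⟨tableLearner m ρ I pick a, rfl, ?_, ?_, ?_⟩
  · change (m : ℝ) ≤ _
    have h1 : (m : ℝ) ≤ 12 * M := by
      rw [hmr, hM']
      calc 6 * (n : ℝ) ^ 2 * w * k ^ 2 * q * E ≤ 6 * (n : ℝ) ^ 2 * q * k ^ 2 * q * (2 * H ^ 2) := by
            gcongr
            refine hEH.trans ?_
            gcongr
            exact le_self_pow₀ hH1 (by norm_num)
        _ = 12 * (k ^ 2 * q ^ 2 * n ^ 2 * H ^ 2) := by ring
        _ ≤ 12 * (k ^ 2 * q ^ 3 * n ^ 2 * H ^ 2) := by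
            gcongr
            norm_num
    have h2 : M ≤ M * Real.log M ^ 4 :=
      le_mul_of_one_le_right (by linarith) (one_le_pow₀ hlogM)
    linarith
  · refine tableLearner_runsInTime hG hl (P := P) (B := N * m * n + P + (m + K) ^ l) le_rfl
      le_rfl ?_
    refine time_bound (k := k) (q := q) (w := w) (H := H) (E := E) (D := (l : ℝ) * (d : ℝ) ^ 2)
      hn hl hK hk1
      (by linarith) hwq hKq hH1 hEH hm1 hmr hT' hT128 rfl hlogT hlT (by positivity) ?_ hN ?_ rfl
    · calc (l : ℝ) * (d : ℝ) ^ 2 ≤ (l : ℝ) ^ 2 * (d : ℝ) ^ 2 := by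
            gcongr
            exact le_self_pow₀ hl' (by norm_num)
        _ = ((l : ℝ) * d) ^ 2 := by ring
        _ ≤ Real.log T ^ 2 := by gcongr
    · rw [hP]
      push_cast
      ring
  · refine tableLearner_learns hG hρ hpick hn hε ?_ ?_
    · rw [hmr]
      calc ((K : ℝ) ^ l) ^ 2 = 1 * 1 ^ 2 * 1 * q ^ 2 * 1 * 1 := by rw [hq]; ring
        _ ≤ 6 * (n : ℝ) ^ 2 * w * k ^ 2 * q * E := by
            gcongr
            · norm_num
            · linarith
    · rw [hmr]
      have : 1 ≤ E * ε ^ 2 := by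
        have h1 : H * ε ^ 2 = 1 := by rw [hH]; field_simp
        exact h1 ▸ mul_le_mul_of_nonneg_right hHE (sq_nonneg ε)
      calc 6 * (n : ℝ) ^ 2 * 2 ^ l * ((K : ℝ) ^ (l * d)) ^ 2 * K ^ l
          = 6 * (n : ℝ) ^ 2 * w * k ^ 2 * q * 1 := by rw [hw, hk, hq]; ring
        _ ≤ 6 * (n : ℝ) ^ 2 * w * k ^ 2 * q * (E * ε ^ 2) := by gcongr
        _ = _ := by ring

theorem mainTheorem3 :
    ∃ (C : ℝ) (c : ℕ), 0 < C ∧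
      ∀ (n d l K : ℕ) (U : Type*) [Fintype U] (G : SMCG (Fin n) U) (ε : ℝ),
        1 ≤ n → 1 ≤ d → 1 ≤ K → G.InClass d l → 0 < ε → ε ≤ 1 →
        let M : ℝ := (K : ℝ) ^ (l * (2 * d + 3)) * (n : ℝ) ^ 2 / ε ^ 4
        let T : ℝ := (2 : ℝ) ^ l * (K : ℝ) ^ (l * (3 * d + 3)) * (n : ℝ) ^ 3 / ε ^ 4
        (2 ≤ n →
          ∃ L : Learner G K,
            (L.numInterventions : ℝ)
                ≤ C * ((K : ℝ) ^ (l * d) * (3 * (d : ℝ)) ^ l * Real.log n) ∧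
            (L.numSamples : ℝ) ≤ C * (M * Real.log M ^ c) ∧
            L.RunsInTime (C * (T * Real.log T ^ c)) ∧
            L.Learns ε) ∧
        (G.MaxDegreeLE d →
          ∃ L : Learner G K,
            (L.numInterventions : ℝ)
                ≤ C * ((K : ℝ) ^ (l * d) * (3 * (d : ℝ)) ^ l
                    * ((l : ℝ) * (d : ℝ) ^ 2 * Real.log K)) ∧
            (L.numSamples : ℝ) ≤ C * (M * Real.log M ^ c) ∧
            L.RunsInTime (C * (T * Real.log T ^ c)) ∧
            L.Learns ε) := by
  refine ⟨10 ^ 6, 4, by norm_num, fun n d l K U _ G ε hn hd hK hG hε hε1 => ?_⟩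
  intro M T
  have : Nonempty (Fin n) := ⟨⟨0, hn⟩⟩
  have hl : 1 ≤ l := hG.one_le
  have hn' : (1 : ℝ) ≤ n := by exact_mod_cast hn
  have hd' : (1 : ℝ) ≤ d := by exact_mod_cast hd
  have hlogn : 0 ≤ Real.log n := Real.log_nonneg hn'
  have hlog2 := Real.log_two_gt_d9
  have hε4 : ε ^ 4 ≤ 1 := pow_le_one₀ hε.le hε1
  -- For K = 1 the bound in the second part contains log K = 0 and forbids all interventions, and
  -- for n = ε = 1 also log M = 0, which forbids samples. All distributions are then trivial, and T
  -- ≥ 2^l ≥ 2 leaves time for writing the constant table.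
  rcases Nat.lt_or_ge K 2 with hK1 | hK2
  · obtain rfl : K = 1 := by omega
    have hM1 : 1 ≤ M := by
      simp only [M, Nat.cast_one, one_pow, one_mul]
      rw [le_div_iff₀ (by positivity), one_mul]
      exact hε4.trans (one_le_pow₀ hn')
    have hT2 : 2 ≤ T := by
      simp only [T, Nat.cast_one, one_pow, mul_one]
      rw [le_div_iff₀ (by positivity)]
      have h1 : (2 : ℝ) ^ 1 ≤ 2 ^ l := pow_le_pow_right₀ (by norm_num) hl
      have h2 : (1 : ℝ) ≤ n ^ 3 := one_le_pow₀ hn'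
      nlinarith
    have hlogT : 1 / 2 ≤ Real.log T := by
      have := Real.log_le_log (by norm_num) hT2
      linarith
    have hlogT4 : (1 / 2 : ℝ) ^ 4 ≤ Real.log T ^ 4 := pow_le_pow_left₀ (by norm_num) hlogT 4
    have htime : (7 : ℝ) ≤ 10 ^ 6 * (T * Real.log T ^ 4) := by nlinarith
    have hsamples : (((oneLetterLearner G).numSamples : ℕ) : ℝ)
        ≤ 10 ^ 6 * (M * Real.log M ^ 4) := by
      have := Real.log_nonneg hM1
      simp only [oneLetterLearner, Nat.cast_zero]
      positivity
    refine ⟨fun _ => ⟨oneLetterLearner G, ?_, hsamples, oneLetterLearner_runsInTime htime,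
      oneLetterLearner_learns hε⟩, fun _ => ⟨oneLetterLearner G, ?_, hsamples,
      oneLetterLearner_runsInTime htime, oneLetterLearner_learns hε⟩⟩
    · simp only [oneLetterLearner, Nat.cast_zero]
      positivity
    · simp [oneLetterLearner]
  · have hK' : (2 : ℝ) ≤ K := by exact_mod_cast hK2
    set k : ℝ := (K : ℝ) ^ (l * d)
    have hk0 : 0 < k := by positivity
    have hdl : (d : ℝ) ≤ d ^ l := le_self_pow₀ hd' (by omega)
    constructor
    · intro hn2
      obtain ⟨N, I, hI, hN⟩ := exists_covers_of_inClass hG hK hl hd hn2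
      obtain ⟨L, hL, h⟩ := exists_learner_of_covers hn hd hK2 hG hε hε1 I hI (hN.trans (by
        rw [mul_assoc _ ((l : ℝ) * d)]
        rw [mul_assoc _ ((l : ℝ) * (d : ℝ) ^ 2)]
        gcongr
        · exact le_self_pow₀ hd' (by norm_num)
        · linarith)) rfl rfl
      refine ⟨L, ?_, h⟩
      rw [hL]
      refine hN.trans ?_
      calc 10 * (2 ^ l * k * (l * d) * Real.log n)
          = 10 * ((l * 2 ^ l) * d * (k * Real.log n)) := by ring
        _ ≤ 10 * ((2 * 3 ^ l) * d ^ l * (k * Real.log n)) := by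
            refine mul_le_mul_of_nonneg_left (mul_le_mul_of_nonneg_right
              (mul_le_mul (mul_two_pow_le l) hdl (by positivity) (by positivity))
              (by positivity)) (by norm_num)
        _ = 20 * (k * (3 * d) ^ l * Real.log n) := by rw [mul_pow]; ring
        _ ≤ 10 ^ 6 * (k * (3 * d) ^ l * Real.log n) := by
            gcongr
            norm_num
    · intro hdeg
      obtain ⟨N, I, hI, hN⟩ := exists_covers_of_maxDegreeLE hG hdeg hK hl hd
      obtain ⟨L, hL, h⟩ := exists_learner_of_covers hn hd hK2 hG hε hε1 I hI (hN.trans (by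
        have h0 : 0 ≤ 2 ^ l * k * ((l : ℝ) * (d : ℝ) ^ 2) := by positivity
        have h1 : 2 ^ l * k * ((l : ℝ) * (d : ℝ) ^ 2) * 1
            ≤ 2 ^ l * k * ((l : ℝ) * (d : ℝ) ^ 2) * (1 + Real.log n) := by
          gcongr
          linarith
        linarith)) rfl rfl
      refine ⟨L, ?_, h⟩
      rw [hL]
      refine hN.trans ?_
      -- The number of interventions obtained is free of log K; this factor is inserted using K ≥ 2.
      have hlogK : 1 / 2 ≤ Real.log K := by
        have := Real.log_le_log (by norm_num) hK'
        linarith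
      calc 5 * (2 ^ l * k * (l * (d : ℝ) ^ 2))
          = 10 * (k * 2 ^ l * (l * (d : ℝ) ^ 2 * (1 / 2))) := by ring
        _ ≤ 10 ^ 6 * (k * (3 * d) ^ l * (l * (d : ℝ) ^ 2 * Real.log K)) := by
            gcongr
            · norm_num
            · linarith
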